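/- Let $n\ge 1$ and write points of $\mathbb R^{n+1}$ as $\bar x=(x,t)$, $x\in\mathbb R^n$, $t\in\mathbb R$. Let $\mathcal H^{n+1}_p$ be the $(n+1)$-dimensional Hausdorff measure on $\mathbb R^{n+1}$ for the parabolic distance $\mathrm{dist}_p\big((x,t),(y,u)\big)=\max\big(|x-y|,|t-u|^{1/2}\big)$, and let $W$ be the fundamental solution of the heat equation, $W(x,t)=(4\pi t)^{-n/2}e^{-|x|^2/(4t)}$ for $t>0$ and $W(x,t)=0$ for $t\le 0$. A parabolic cube of side length $\ell>0$ is a product $I_1\times\dots\times I_n\times I_{n+1}$ of intervals, with $|I_1|=\dots=|I_n|=\ell$ and $|I_{n+1}|=\ell^2$, and for a locally integrable function $h$ on $\mathbb R^{n+1}$ $$\|h\|_{*,p}=\sup_Q \frac1{|Q|}\int_Q\Big|h-\frac1{|Q|}\int_Q h\,dm\Big|\,dm ,$$ the supremum being over all parabolic cubes $Q$ ($m$ is Lebesgue measure). For a test function $\varphi\in C_c^\infty(\mathbb R^{n+1})$ put $$\partial_t^{1/2}\varphi(x,t)=\int_{\mathbb R}\frac{\varphi(x,s)-\varphi(x,t)}{|s-t|^{3/2}}\,ds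 .$$ For a compactly supported real distribution $\nu$ on $\mathbb R^{n+1}$ and $\psi\in C^\infty(\mathbb R^{n+1})$ with $\check W*\psi$ defined and smooth, where $(\check W*\psi)(\bar y)=\int W(\bar x-\bar y)\psi(\bar x)\,dm(\bar x)$, put $\langle W*\nu,\psi\rangle=\langle\nu,\check W*\psi\rangle$. The derivatives of the potential $W*\nu$ are the distributions given, for every test function $\varphi$, by $\langle\partial_{x_i}W*\nu,\varphi\rangle=-\langle W*\nu,\partial_{x_i}\varphi\rangle$ and $\langle\partial_t^{1/2}W*\nu,\varphi\rangle=\langle W*\nu,\partial_t^{1/2}\varphi\rangle$. A norm bound for one of these distributions means that it is represented by a locally integrable function that satisfies the bound. **Theorem.** There is a constant $C>0$, depending only on $n$, with the following property. Let $E\subset\mathbb R^{n+1}$ be a compact set with $\mathcal H^{n+1}_p(E)<\infty$, and let $\nu$ be a real distribution on $\mathbb R^{n+1}$ supported on $E$ such that $$\|\nabla_x W*\nu\|_{L^\infty(\mathbb R^{n+1})}\le 1,\qquad \|\partial_t^{1/2}W*\nu\|_{*,p}\le 1 .$$ Then $\nu$ is a (finite) signed measure that is absolutely continuous with respect to $\mathcal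 H^{n+1}_p|_E$, and there is a Borel function $f$ such that $\nu=f\,\mathcal H^{n+1}_p|_E$ and $\|f\|_{L^\infty(\mathcal H^{n+1}_p|_E)}\le C$. -/

import Mathlib

open MeasureTheory Set Filter TopologicalSpace
open scoped ENNReal Topology Distributions Manifold

namespace ParabolicHeat

/-- Space-time `ℝⁿ × ℝ`; a point is `(x, t)`, with the Euclidean norm on the space variable. -/
abbrev SpaceTime (n : ℕ) : Type := EuclideanSpace ℝ (Fin n) × ℝ

/-! ### Parabolic distance and parabolic Hausdorff measure -/

/-- Space-time with the parabolic distance `max (|x - y|, |t - u|^(1/2))`: the time line carries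
the distance `|t - u|^(1/2)`, and the product carries the maximum of the two distances. -/
def ParabolicSpace (n : ℕ) : Type :=
  EuclideanSpace ℝ (Fin n) × Metric.Snowflaking ℝ (1 / 2) one_half_pos one_half_lt_one.le

noncomputable instance (n : ℕ) : MetricSpace (ParabolicSpace n) :=
  inferInstanceAs (MetricSpace (EuclideanSpace ℝ (Fin n) ×
    Metric.Snowflaking ℝ (1 / 2) one_half_pos one_half_lt_one.le))

noncomputable instance (n : ℕ) : MeasurableSpace (ParabolicSpace n) := borel _

instance (n : ℕ) : BorelSpace (ParabolicSpace n) := ⟨rfl⟩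

/-- The identity map from space-time to space-time with the parabolic distance. -/
noncomputable def toParabolic {n : ℕ} (z : SpaceTime n) : ParabolicSpace n :=
  (z.1, Metric.Snowflaking.toSnowflaking z.2)

/-- The identity map from space-time with the parabolic distance to space-time. -/
noncomputable def ofParabolic {n : ℕ} (z : ParabolicSpace n) : SpaceTime n :=
  (z.1, Metric.Snowflaking.ofSnowflaking z.2)

theorem dist_toParabolic {n : ℕ} (z w : SpaceTime n) :
    dist (toParabolic z) (toParabolic w) = max ‖z.1 - w.1‖ (|z.2 - w.2| ^ (1 / 2 : ℝ)) := by
  change max (dist z.1 w.1) (dist z.2 w.2 ^ (1 / 2 : ℝ)) = _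
  rw [dist_eq_norm, Real.dist_eq]

theorem continuous_toParabolic {n : ℕ} :
    Continuous (toParabolic : SpaceTime n → ParabolicSpace n) := by
  change Continuous fun z : SpaceTime n =>
    ((z.1, Metric.Snowflaking.toSnowflaking z.2) : EuclideanSpace ℝ (Fin n) ×
      Metric.Snowflaking ℝ (1 / 2) one_half_pos one_half_lt_one.le)
  exact continuous_fst.prodMk (Metric.Snowflaking.continuous_toSnowflaking.comp continuous_snd)

theorem continuous_ofParabolic {n : ℕ} :
    Continuous (ofParabolic : ParabolicSpace n → SpaceTime n) := by
  change Continuous fun z : EuclideanSpace ℝ (Fin n) ×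
      Metric.Snowflaking ℝ (1 / 2) one_half_pos one_half_lt_one.le =>
    (z.1, Metric.Snowflaking.ofSnowflaking z.2)
  exact continuous_fst.prodMk (Metric.Snowflaking.continuous_ofSnowflaking.comp continuous_snd)

/-- The parabolic Hausdorff measure of dimension `d` (built from parabolic diameters), as a Borel
measure on space-time. -/
noncomputable def parabolicHausdorff (n : ℕ) (d : ℝ) : Measure (SpaceTime n) :=
  (Measure.hausdorffMeasure d : Measure (ParabolicSpace n)).map ofParabolic

theorem parabolicHausdorff_apply {n : ℕ} (d : ℝ) {s : Set (SpaceTime n)} (hs : MeasurableSet s) :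
    parabolicHausdorff n d s =
      (Measure.hausdorffMeasure d : Measure (ParabolicSpace n)) (toParabolic '' s) := by
  rw [parabolicHausdorff, Measure.map_apply continuous_ofParabolic.measurable hs]
  congr 1
  ext z
  constructor
  · intro hz
    exact ⟨ofParabolic z, hz, rfl⟩
  · rintro ⟨w, hw, rfl⟩
    exact hw

/-! ### Parabolic cubes and parabolic BMO -/

/-- The parabolic cube with lower corner `a` and side length `ℓ`: a product of `n` intervals of
length `ℓ` in space and an interval of length `ℓ²` in time. -/
def parabolicCube {n : ℕ} (a : SpaceTime n) (ℓ : ℝ) : Set (SpaceTime n) :=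
  {z | (∀ i, z.1 i ∈ Icc (a.1 i) (a.1 i + ℓ)) ∧ z.2 ∈ Icc a.2 (a.2 + ℓ ^ 2)}

/-- The parabolic BMO (semi)norm of a locally integrable function, with values in `[0, ∞]`. -/
noncomputable def parabolicBMO {n : ℕ} (h : SpaceTime n → ℝ) : ℝ≥0∞ :=
  ⨆ (a : SpaceTime n) (ℓ : ℝ) (_ : 0 < ℓ),
    ⨍⁻ z in parabolicCube a ℓ, ‖h z - ⨍ w in parabolicCube a ℓ, h w‖ₑ ∂volume

/-! ### Pairing a distribution with a smooth function -/

section Pairing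

variable {V : Type*} [NormedAddCommGroup V] [NormedSpace ℝ V]

open Classical in
/-- The pairing `⟨ν, ψ⟩` of a compactly supported distribution `ν` with a smooth function `ψ` that
need not have compact support: the value of `ν` at any test function that agrees with `ψ` in a
neighbourhood of the support of `ν`. -/
noncomputable def pairing (ν : 𝓓'((⊤ : Opens V), ℝ)) (ψ : V → ℝ) : ℝ :=
  if h : ∃ θ : 𝓓((⊤ : Opens V), ℝ), ⇑θ =ᶠ[𝓝ˢ (Distribution.dsupport ν)] ψ then ν h.choose else 0

variable [FiniteDimensional ℝ V]

/-- A distribution vanishes on the complement of its support. -/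
theorem apply_eq_zero_of_disjoint_dsupport (ν : 𝓓'((⊤ : Opens V), ℝ)) (φ : 𝓓((⊤ : Opens V), ℝ))
    (hφ : Disjoint (tsupport φ) (Distribution.dsupport ν)) : ν φ = 0 := by
  -- A finite subcover of the support of `φ` by open sets on which `ν` vanishes.
  have hc : tsupport φ ⊆ (Distribution.dsupport ν)ᶜ := hφ.subset_compl_right
  rw [Distribution.dsupport_compl_eq, sUnion_eq_iUnion] at hc
  obtain ⟨s, hs⟩ := φ.hasCompactSupport.isCompact.elim_finite_subcover _ (fun a => a.2.2) hc
  rw [← iUnion_subtype (fun i => i ∈ s) (fun i => (i.1 : Set V))] at hs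
  obtain ⟨ρ, hρ⟩ := SmoothPartitionOfUnity.exists_isSubordinate 𝓘(ℝ, V) (isClosed_tsupport φ)
    (fun i : s => (i.1 : Set V)) (fun i => i.1.2.2) hs
  -- The pieces of `φ`.
  let u : s → 𝓓((⊤ : Opens V), ℝ) := fun i =>
    ⟨fun x => ρ i x * φ x, (ρ i).contMDiff.contDiff.mul φ.contDiff, φ.hasCompactSupport.mul_left,
      fun _ _ => trivial⟩
  have hu : φ = ∑ i, u i := by
    ext x
    have : (∑ i, u i) x = ∑ i, ρ i x * φ x := by
      rw [FunLike.coe_sum, Finset.sum_apply]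
      rfl
    rw [this, ← Finset.sum_mul]
    by_cases hx : x ∈ tsupport φ
    · have := ρ.sum_eq_one hx
      rw [finsum_eq_sum_of_fintype] at this
      rw [this, one_mul]
    · rw [image_eq_zero_of_notMem_tsupport hx, mul_zero]
  rw [hu, map_sum]
  refine Finset.sum_eq_zero fun i _ => i.1.2.1 (u i) ?_
  exact (closure_mono (Function.support_mul_subset_left _ _)).trans (hρ i)

/-- The pairing does not depend on the choice of the test function. -/
theorem pairing_eq (ν : 𝓓'((⊤ : Opens V), ℝ)) {ψ : V → ℝ} (θ : 𝓓((⊤ : Opens V), ℝ))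
    (hθ : ⇑θ =ᶠ[𝓝ˢ (Distribution.dsupport ν)] ψ) : pairing ν ψ = ν θ := by
  have h : ∃ θ : 𝓓((⊤ : Opens V), ℝ), ⇑θ =ᶠ[𝓝ˢ (Distribution.dsupport ν)] ψ := ⟨θ, hθ⟩
  rw [pairing, dif_pos h, ← sub_eq_zero, ← map_sub]
  apply apply_eq_zero_of_disjoint_dsupport
  rw [Set.disjoint_right]
  intro x hx
  rw [notMem_tsupport_iff_eventuallyEq]
  have h1 : (⇑h.choose : V → ℝ) =ᶠ[𝓝 x] ⇑θ :=
    (h.choose_spec.trans hθ.symm).filter_mono (nhds_le_nhdsSet hx)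
  filter_upwards [h1] with y hy
  simp [hy]

/-- Every smooth function can be paired with a compactly supported distribution. -/
theorem exists_testFunction_eventuallyEq {K : Set V} (hK : IsCompact K) {ψ : V → ℝ}
    (hψ : ContDiff ℝ (⊤ : ℕ∞) ψ) : ∃ θ : 𝓓((⊤ : Opens V), ℝ), ⇑θ =ᶠ[𝓝ˢ K] ψ := by
  obtain ⟨K', hK', hKK'⟩ := exists_compact_superset hK
  obtain ⟨χ, h1, h0, -⟩ := exists_contMDiffMap_one_nhds_of_subset_interior (n := (⊤ : ℕ∞))
    𝓘(ℝ, V) hK.isClosed hKK'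
  have hχ : HasCompactSupport χ := HasCompactSupport.intro hK' h0
  refine ⟨⟨fun x => χ x * ψ x, χ.contMDiff.contDiff.mul hψ, hχ.mul_right, fun _ _ => trivial⟩, ?_⟩
  filter_upwards [h1] with x hx
  change χ x * ψ x = ψ x
  rw [hx, one_mul]

end Pairing

/-! ### Heat potentials -/

/-- The fundamental solution of the heat equation. -/
noncomputable def heatKernel {n : ℕ} (z : SpaceTime n) : ℝ :=
  if 0 < z.2 then
    1 / (4 * Real.pi * z.2) ^ ((n : ℝ) / 2) * Real.exp (-‖z.1‖ ^ 2 / (4 * z.2))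
  else 0

/-- `⟨W * ν, ψ⟩ = ⟨ν, W̌ * ψ⟩`, where `(W̌ * ψ)(w) = ∫ W(z - w) ψ(z) dz`. -/
noncomputable def heatPotential {n : ℕ} (ν : 𝓓'((⊤ : Opens (SpaceTime n)), ℝ))
    (ψ : SpaceTime n → ℝ) : ℝ :=
  pairing ν fun w => ∫ z, heatKernel (z - w) * ψ z

/-- The partial derivative in the `i`-th space variable. -/
noncomputable def spaceDeriv {n : ℕ} (i : Fin n) (φ : SpaceTime n → ℝ) (z : SpaceTime n) : ℝ :=
  fderiv ℝ φ z (EuclideanSpace.single i 1, 0)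

/-- The half derivative in time, `∫ (φ(x, s) - φ(x, t)) / |s - t|^(3/2) ds`. -/
noncomputable def halfTimeDeriv {n : ℕ} (φ : SpaceTime n → ℝ) (z : SpaceTime n) : ℝ :=
  ∫ s : ℝ, (φ (z.1, s) - φ z) / |s - z.2| ^ (3 / 2 : ℝ)

/-- The distribution `∇ₓ (W * ν)` is the locally integrable function `G`. -/
def IsSpaceGradientPotential {n : ℕ} (ν : 𝓓'((⊤ : Opens (SpaceTime n)), ℝ))
    (G : SpaceTime n → EuclideanSpace ℝ (Fin n)) : Prop :=
  LocallyIntegrable G ∧ ∀ (i : Fin n) (φ : 𝓓((⊤ : Opens (SpaceTime n)), ℝ)),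
    ∫ z, G z i * φ z = -heatPotential ν (spaceDeriv i φ)

/-- The distribution `∂ₜ^(1/2) (W * ν)` is the locally integrable function `h`. The operator
`∂ₜ^(1/2)` is symmetric, so that `⟨∂ₜ^(1/2) (W * ν), φ⟩ = ⟨W * ν, ∂ₜ^(1/2) φ⟩`. -/
def IsHalfTimeDerivPotential {n : ℕ} (ν : 𝓓'((⊤ : Opens (SpaceTime n)), ℝ))
    (h : SpaceTime n → ℝ) : Prop :=
  LocallyIntegrable h ∧ ∀ φ : 𝓓((⊤ : Opens (SpaceTime n)), ℝ),
    ∫ z, h z * φ z = heatPotential ν (halfTimeDeriv φ)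

end ParabolicHeat

/-! Since `W` is the fundamental solution, `ν = (∂ₜ - Δ)(W * ν)`, so `ν φ` is the sum of `∫ Gᵢ ∂ᵢφ`
minus `⟨W * ν, ∂ₜφ⟩` (`apply_eq_heatPotential`). To bring in the half derivative, `∂ₜ` is factored:
if `R` and `L` are the one-sided difference operators with kernel `|s|^(-3/2)`, then `R² = -4π ∂ₜ`,
`L² = 4π ∂ₜ` and `(R + L)(R - L) = -8π ∂ₜ` (`diffInt_evenKernel_oddKernel`). The even factor `R + L`
is `∂ₜ^(1/2)` and falls on `W * ν`; the odd factor falls on `φ`. Hence `-8π ⟨W * ν, ∂ₜφ⟩` is a limit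
of integrals of `h` against truncated odd half derivatives of `φ`.

Let `φ` be a bump of height `A` on a parabolic cube of side `ℓ`. The gradient term is at most a
constant times `A ℓ^(n+1)`. The odd half derivative of `φ` has integral zero and size `(A/ℓ)(1 +
|j|)^(-3/2)` on the `j`-th time translate of the cube, while the averages of a BMO function over
these translates drift only logarithmically, so the other term has the same bound
(`IsTimeBump.abs_integral_mul_diffInt_le`). Thus `ν` has growth of order `ℓ^(n+1)` on bumps
(`IsBump.abs_apply_le`).

Next, the part of `E` in the support of a test function is covered efficiently by cores of dyadic
bumps of many scales, and the test function is split by a partition of unity in which the bumps are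
removed coarse scales first. Each piece then involves only scales at least as coarse as its own and
is an admissible bump at that scale (`DyadicIndex.abs_fderiv_piece_le`). Summation gives `|ν φ| ≤ C
sup|φ| · H(supp φ ∩ E)` (`abs_apply_le_mul_hausdorff`). Slicing the range of `φ` into thin windows
improves the right side to `C ∫ |φ| dH` over `E` (`abs_apply_le_integral_abs`), and duality yields
the bounded density. -/

namespace ParabolicHeat

/-! ### Differentiation under the integral sign. -/

section SmoothIntegral

variable {V F α : Type*} [NormedAddCommGroup V] [NormedSpace ℝ V]
  [NormedAddCommGroup F] [NormedSpace ℝ F] [CompleteSpace F] [MeasurableSpace α] {μ : Measure α}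

/-- Differentiation under the integral sign, to all orders. -/
theorem hasFTaylorSeriesUpTo_integral {f : V → α → F}
    (hf : ∀ a, ContDiff ℝ (⊤ : ℕ∞) (f · a))
    (hm : ∀ (k : ℕ) (x : V), AEStronglyMeasurable (fun a => iteratedFDeriv ℝ k (f · a) x) μ)
    (hb : ∀ (k : ℕ) (x₀ : V), ∃ b : α → ℝ, Integrable b μ ∧
      ∀ᶠ x in 𝓝 x₀, ∀ a, ‖iteratedFDeriv ℝ k (f · a) x‖ ≤ b a) :
    HasFTaylorSeriesUpTo (⊤ : ℕ∞) (fun x => ∫ a, f x a ∂μ)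
      fun x k => ∫ a, iteratedFDeriv ℝ k (f · a) x ∂μ := by
  have hint : ∀ (k : ℕ) (x : V), Integrable (fun a => iteratedFDeriv ℝ k (f · a) x) μ := by
    intro k x
    obtain ⟨b, hbi, hb⟩ := hb k x
    exact hbi.mono' (hm k x) (Eventually.of_forall hb.self_of_nhds)
  have hder : ∀ (k : ℕ) (x : V), HasFDerivAt (fun x => ∫ a, iteratedFDeriv ℝ k (f · a) x ∂μ)
      (∫ a, iteratedFDeriv ℝ (k + 1) (f · a) x ∂μ).curryLeft x := by
    intro k x₀
    have hd : ∀ a x, HasFDerivAt (iteratedFDeriv ℝ k (f · a))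
        (iteratedFDeriv ℝ (k + 1) (f · a) x).curryLeft x := by
      intro a x
      exact (hf a).ftaylorSeries.fderiv k (by exact_mod_cast WithTop.coe_lt_top k) x
    let L : (ContinuousMultilinearMap ℝ (fun _ : Fin (k + 1) => V) F) →L[ℝ]
        (V →L[ℝ] ContinuousMultilinearMap ℝ (fun _ : Fin k => V) F) :=
      (continuousMultilinearCurryLeftEquiv ℝ (fun _ : Fin (k + 1) => V)
        F).toContinuousLinearEquiv.toContinuousLinearMap
    have h1 : (∫ a, iteratedFDeriv ℝ (k + 1) (f · a) x₀ ∂μ).curryLeft =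
        ∫ a, (iteratedFDeriv ℝ (k + 1) (f · a) x₀).curryLeft ∂μ := by
      exact (ContinuousLinearMap.integral_comp_comm (𝕜 := ℝ) (Fₗ := V →L[ℝ] ContinuousMultilinearMap ℝ (fun _ : Fin k => V) F) L (hint (k + 1) x₀)).symm
    rw [h1]
    obtain ⟨b, hbi, hb⟩ := hb (k + 1) x₀
    refine hasFDerivAt_integral_of_dominated_of_fderiv_le (bound := b)
      (F' := fun x a => (iteratedFDeriv ℝ (k + 1) (f · a) x).curryLeft) hb
      (Eventually.of_forall fun x => hm k x) (hint k x₀)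
      (L.continuous.comp_aestronglyMeasurable (hm (k + 1) x₀)) ?_ hbi ?_
    · refine Eventually.of_forall fun a x hx => ?_
      have := (continuousMultilinearCurryLeftEquiv ℝ (fun _ : Fin (k + 1) => V) F).norm_map
        (iteratedFDeriv ℝ (k + 1) (f · a) x)
      exact this.trans_le (hx a)
    · exact Eventually.of_forall fun a x _ => hd a x
  refine ⟨fun x => ?_, fun m _ x => hder m x, fun m _ => ?_⟩
  · let L := (continuousMultilinearCurryFin0 ℝ V F).toContinuousLinearEquiv.toContinuousLinearMap
    have := ContinuousLinearMap.integral_comp_comm L (hint 0 x)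
    refine this.symm.trans ?_
    congr 1
  · exact continuous_iff_continuousAt.2 fun x => (hder m x).continuousAt

theorem iteratedFDeriv_integral {f : V → α → F}
    (hf : ∀ a, ContDiff ℝ (⊤ : ℕ∞) (f · a))
    (hm : ∀ (k : ℕ) (x : V), AEStronglyMeasurable (fun a => iteratedFDeriv ℝ k (f · a) x) μ)
    (hb : ∀ (k : ℕ) (x₀ : V), ∃ b : α → ℝ, Integrable b μ ∧
      ∀ᶠ x in 𝓝 x₀, ∀ a, ‖iteratedFDeriv ℝ k (f · a) x‖ ≤ b a) (k : ℕ) (x : V) :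
    iteratedFDeriv ℝ k (fun x => ∫ a, f x a ∂μ) x = ∫ a, iteratedFDeriv ℝ k (f · a) x ∂μ :=
  ((hasFTaylorSeriesUpTo_integral hf hm hb).eq_iteratedFDeriv (by exact_mod_cast le_top) x).symm

theorem contDiff_integral {f : V → α → F}
    (hf : ∀ a, ContDiff ℝ (⊤ : ℕ∞) (f · a))
    (hm : ∀ (k : ℕ) (x : V), AEStronglyMeasurable (fun a => iteratedFDeriv ℝ k (f · a) x) μ)
    (hb : ∀ (k : ℕ) (x₀ : V), ∃ b : α → ℝ, Integrable b μ ∧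
      ∀ᶠ x in 𝓝 x₀, ∀ a, ‖iteratedFDeriv ℝ k (f · a) x‖ ≤ b a) :
    ContDiff ℝ (⊤ : ℕ∞) (fun x => ∫ a, f x a ∂μ) :=
  (hasFTaylorSeriesUpTo_integral hf hm hb).contDiff

end SmoothIntegral

/-! ### Bounded smooth functions and difference operators. -/

section SmoothBounded

variable {V : Type*} [NormedAddCommGroup V] [NormedSpace ℝ V]

/-- Smooth functions whose derivative of order `k` is bounded by `b k`. -/
structure SmoothBounded (u : V → ℝ) (b : ℕ → ℝ) : Prop where
  contDiff : ContDiff ℝ (⊤ : ℕ∞) u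
  bound : ∀ k x, ‖iteratedFDeriv ℝ k u x‖ ≤ b k

theorem SmoothBounded.nonneg {u : V → ℝ} {b : ℕ → ℝ} (hu : SmoothBounded u b) (k : ℕ) : 0 ≤ b k :=
  (norm_nonneg _).trans (hu.bound k 0)

theorem SmoothBounded.abs_le {u : V → ℝ} {b : ℕ → ℝ} (hu : SmoothBounded u b) (x : V) :
    |u x| ≤ b 0 := by
  simpa using hu.bound 0 x

theorem SmoothBounded.iteratedFDeriv_sub_le {u : V → ℝ} {b : ℕ → ℝ} (hu : SmoothBounded u b)
    (k : ℕ) (x y : V) : ‖iteratedFDeriv ℝ k u x - iteratedFDeriv ℝ k u y‖ ≤ b (k + 1) * ‖x - y‖ := by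
  refine Convex.norm_image_sub_le_of_norm_fderiv_le (s := univ) (𝕜 := ℝ) (fun z _ => ?_)
    (fun z _ => ?_) convex_univ trivial trivial
  · exact (hu.contDiff.differentiable_iteratedFDeriv (by exact_mod_cast WithTop.coe_lt_top k)) z
  · rw [norm_fderiv_iteratedFDeriv]
    exact hu.bound (k + 1) z

theorem iteratedFDeriv_comp_add_right_sub {u : V → ℝ} (hu : ContDiff ℝ (⊤ : ℕ∞) u) (v : V) (k : ℕ)
    (x : V) : iteratedFDeriv ℝ k (fun x => u (x + v) - u x) x =
      iteratedFDeriv ℝ k u (x + v) - iteratedFDeriv ℝ k u x := by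
  have h1 : ContDiff ℝ (⊤ : ℕ∞) fun x => u (x + v) := hu.comp (contDiff_id.add contDiff_const)
  have hk : (k : WithTop ℕ∞) ≤ ((⊤ : ℕ∞) : WithTop ℕ∞) := by exact_mod_cast le_top
  have := iteratedFDeriv_sub_apply (x := x) (h1.contDiffAt.of_le hk) (hu.contDiffAt.of_le hk)
  refine this.trans ?_
  rw [iteratedFDeriv_comp_add_right]

/-- Triangle inequality for large steps, mean value inequality for small ones. The weight `min 1
|s|` is the one against which a `DiffKernel` is integrable. -/
theorem SmoothBounded.diff_le {u : V → ℝ} {b : ℕ → ℝ} (hu : SmoothBounded u b) {e : V}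
    (he : ‖e‖ ≤ 1) (k : ℕ) (s : ℝ) (x : V) :
    ‖iteratedFDeriv ℝ k (fun x => u (x + s • e) - u x) x‖ ≤ 2 * (b k + b (k + 1)) * min 1 |s| := by
  rw [iteratedFDeriv_comp_add_right_sub hu.contDiff]
  have h0 := hu.nonneg k
  have h1 := hu.nonneg (k + 1)
  rcases le_total 1 |s| with h | h
  · rw [min_eq_left h]
    refine (norm_sub_le _ _).trans ?_
    linarith [hu.bound k (x + s • e), hu.bound k x]
  · rw [min_eq_right h]
    refine (hu.iteratedFDeriv_sub_le k _ _).trans ?_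
    have : ‖x + s • e - x‖ ≤ |s| := by
      rw [add_sub_cancel_left, norm_smul, Real.norm_eq_abs]
      exact mul_le_of_le_one_right (abs_nonneg s) he
    nlinarith [abs_nonneg s, mul_le_mul_of_nonneg_left this h1, mul_nonneg h0 (abs_nonneg s),
      mul_nonneg h1 (abs_nonneg s)]

/-- A kernel of order less than one: `∫ |κ(s)| min(1, |s|) ds < ∞`. -/
structure DiffKernel (κ : ℝ → ℝ) : Prop where
  measurable : Measurable κ
  integrable : Integrable fun s => κ s * min 1 |s|

/-- The operator `u ↦ ∫ κ(s) (u(· + s e) - u) ds`. -/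
noncomputable def diffInt (e : V) (κ : ℝ → ℝ) (u : V → ℝ) (x : V) : ℝ :=
  ∫ s, κ s * (u (x + s • e) - u x)

theorem DiffKernel.integrable_mul {κ : ℝ → ℝ} (hκ : DiffKernel κ) {g : ℝ → ℝ} {M : ℝ}
    (hg : AEStronglyMeasurable g) (h : ∀ s, |g s| ≤ M * min 1 |s|) :
    Integrable fun s => κ s * g s := by
  refine (hκ.integrable.norm.const_mul M).mono' (hκ.measurable.aestronglyMeasurable.mul hg)
    (Eventually.of_forall fun s => ?_)
  rw [norm_mul, norm_mul, Real.norm_eq_abs (g s), Real.norm_of_nonneg (by positivity : 0 ≤ min 1 |s|)]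
  nlinarith [h s, norm_nonneg (κ s)]

theorem diffInt_aux (κ : ℝ → ℝ) {e : V} (he : ‖e‖ ≤ 1) {u : V → ℝ}
    {b : ℕ → ℝ} (hu : SmoothBounded u b) :
    (∀ s, ContDiff ℝ (⊤ : ℕ∞) fun x => κ s * (u (x + s • e) - u x)) ∧
    (∀ k s x, iteratedFDeriv ℝ k (fun x => κ s * (u (x + s • e) - u x)) x =
      κ s • (iteratedFDeriv ℝ k u (x + s • e) - iteratedFDeriv ℝ k u x)) ∧
    (∀ k s x, ‖iteratedFDeriv ℝ k (fun x => κ s * (u (x + s • e) - u x)) x‖ ≤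
      2 * (b k + b (k + 1)) * ‖κ s * min 1 |s|‖) := by
  have h1 : ∀ s : ℝ, ContDiff ℝ (⊤ : ℕ∞) fun x => u (x + s • e) - u x := by
    intro s
    have := hu.contDiff
    fun_prop
  have h2 : ∀ k s x, iteratedFDeriv ℝ k (fun x => κ s * (u (x + s • e) - u x)) x =
      κ s • iteratedFDeriv ℝ k (fun x => (u (x + s • e) - u x)) x := by
    intro k s x
    have := iteratedFDeriv_const_smul_apply (a := κ s) (x := x)
      ((h1 s).contDiffAt.of_le (by exact_mod_cast le_top : (k : WithTop ℕ∞) ≤ _))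
    exact this
  refine ⟨fun s => contDiff_const.mul (h1 s), fun k s x => ?_, fun k s x => ?_⟩
  · rw [h2, iteratedFDeriv_comp_add_right_sub hu.contDiff]
  · rw [h2, norm_smul, norm_mul, Real.norm_of_nonneg (by positivity : 0 ≤ min 1 |s|)]
    nlinarith [hu.diff_le he k s x, norm_nonneg (κ s)]

theorem iteratedFDeriv_diffInt {κ : ℝ → ℝ} (hκ : DiffKernel κ) {e : V} (he : ‖e‖ ≤ 1) {u : V → ℝ}
    {b : ℕ → ℝ} (hu : SmoothBounded u b) :
    ContDiff ℝ (⊤ : ℕ∞) (diffInt e κ u) ∧ ∀ k x, iteratedFDeriv ℝ k (diffInt e κ u) x =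
      ∫ s, κ s • (iteratedFDeriv ℝ k u (x + s • e) - iteratedFDeriv ℝ k u x) := by
  obtain ⟨h1, h2, h3⟩ := diffInt_aux κ he hu
  have hm : ∀ (k : ℕ) (x : V), AEStronglyMeasurable
      (fun s => iteratedFDeriv ℝ k (fun x => κ s * (u (x + s • e) - u x)) x) volume := by
    intro k x
    simp_rw [h2]
    refine hκ.measurable.aestronglyMeasurable.smul (Continuous.aestronglyMeasurable ?_)
    have := hu.contDiff.continuous_iteratedFDeriv (m := k) (by exact_mod_cast le_top)
    fun_prop
  have hb : ∀ (k : ℕ) (x₀ : V), ∃ c : ℝ → ℝ, Integrable c volume ∧ ∀ᶠ x in 𝓝 x₀, ∀ s,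
      ‖iteratedFDeriv ℝ k (fun x => κ s * (u (x + s • e) - u x)) x‖ ≤ c s := fun k x₀ =>
    ⟨_, hκ.integrable.norm.const_mul _, Eventually.of_forall fun x s => h3 k s x⟩
  refine ⟨contDiff_integral h1 hm hb, fun k x => ?_⟩
  have := iteratedFDeriv_integral h1 hm hb k x
  simp_rw [h2] at this
  exact this

/-- Closure under difference operators is what allows two half derivatives to be composed. The
bounds are linear in the weighted mass of `κ`, so the tail of a truncated kernel is small in all
derivatives at once. -/
theorem SmoothBounded.diffInt {κ : ℝ → ℝ} (hκ : DiffKernel κ) {e : V} (he : ‖e‖ ≤ 1) {u : V → ℝ}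
    {b : ℕ → ℝ} (hu : SmoothBounded u b) :
    SmoothBounded (diffInt e κ u)
      fun k => 2 * (b k + b (k + 1)) * ∫ s, ‖κ s * min 1 |s|‖ := by
  obtain ⟨h1, h2⟩ := iteratedFDeriv_diffInt hκ he hu
  obtain ⟨-, h4, h3⟩ := diffInt_aux κ he hu
  refine ⟨h1, fun k x => ?_⟩
  rw [h2, ← integral_const_mul]
  refine norm_integral_le_of_norm_le (hκ.integrable.norm.const_mul _)
    (Eventually.of_forall fun s => ?_)
  rw [← h4]
  exact h3 k s x

end SmoothBounded

end ParabolicHeat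

namespace ParabolicHeat

/-! ### Directional derivatives and iterated difference operators -/

section Diff

variable {V : Type*} [NormedAddCommGroup V] [NormedSpace ℝ V]

theorem SmoothBounded.fderiv_apply {u : V → ℝ} {b : ℕ → ℝ} (hu : SmoothBounded u b) {v : V}
    (hv : ‖v‖ ≤ 1) : SmoothBounded (fun x => fderiv ℝ u x v) fun k => b (k + 1) := by
  have h1 : ContDiff ℝ (⊤ : ℕ∞) (fderiv ℝ u) :=
    hu.contDiff.fderiv_right (by exact_mod_cast le_top)
  refine ⟨h1.clm_apply contDiff_const, fun k x => ?_⟩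
  refine (norm_iteratedFDeriv_clm_apply_const (h1.contDiffAt)
    (by exact_mod_cast le_top : (k : WithTop ℕ∞) ≤ _)).trans ?_
  rw [norm_iteratedFDeriv_fderiv]
  exact (mul_le_mul hv (hu.bound _ _) (norm_nonneg _) zero_le_one).trans_eq (one_mul _)

theorem fderiv_diffInt {κ : ℝ → ℝ} (hκ : DiffKernel κ) {e : V} (he : ‖e‖ ≤ 1) {u : V → ℝ}
    {b : ℕ → ℝ} (hu : SmoothBounded u b) (x v : V) :
    fderiv ℝ (diffInt e κ u) x v = diffInt e κ (fun y => fderiv ℝ u y v) x := by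
  obtain ⟨-, h2⟩ := iteratedFDeriv_diffInt hκ he hu
  have h := congrArg (fun L => L fun _ => v) (h2 1 x)
  simp only [iteratedFDeriv_one_apply] at h
  rw [h, ContinuousMultilinearMap.integral_apply]
  · simp [diffInt, iteratedFDeriv_one_apply]
  · obtain ⟨-, h4, h3⟩ := diffInt_aux κ he hu
    refine (hκ.integrable.norm.const_mul (2 * (b 1 + b (1 + 1)))).mono' ?_
      (Eventually.of_forall fun s => (h4 1 s x) ▸ h3 1 s x)
    refine hκ.measurable.aestronglyMeasurable.smul (Continuous.aestronglyMeasurable ?_)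
    have := hu.contDiff.continuous_iteratedFDeriv (m := 1) (by exact_mod_cast le_top)
    fun_prop

theorem SmoothBounded.diff_abs_le {u : V → ℝ} {b : ℕ → ℝ} (hu : SmoothBounded u b) {e : V}
    (he : ‖e‖ ≤ 1) (s : ℝ) (x : V) : |u (x + s • e) - u x| ≤ 2 * (b 0 + b 1) * min 1 |s| := by
  simpa using hu.diff_le he 0 s x

theorem SmoothBounded.integrable_diffInt {κ : ℝ → ℝ} (hκ : DiffKernel κ) {e : V} (he : ‖e‖ ≤ 1)
    {u : V → ℝ} {b : ℕ → ℝ} (hu : SmoothBounded u b) (x : V) :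
    Integrable fun s => κ s * (u (x + s • e) - u x) := by
  refine hκ.integrable_mul (Continuous.aestronglyMeasurable ?_) fun s => hu.diff_abs_le he s x
  have := hu.contDiff.continuous
  fun_prop

theorem SmoothBounded.add {u v : V → ℝ} {b c : ℕ → ℝ} (hu : SmoothBounded u b)
    (hv : SmoothBounded v c) : SmoothBounded (fun x => u x + v x) fun k => b k + c k := by
  refine ⟨hu.contDiff.add hv.contDiff, fun k x => ?_⟩
  have hk : (k : WithTop ℕ∞) ≤ ((⊤ : ℕ∞) : WithTop ℕ∞) := by exact_mod_cast le_top
  have := iteratedFDeriv_add_apply (x := x) (hu.contDiff.contDiffAt.of_le hk)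
    (hv.contDiff.contDiffAt.of_le hk)
  refine (congrArg norm this).trans_le ((norm_add_le _ _).trans ?_)
  exact add_le_add (hu.bound k x) (hv.bound k x)

theorem SmoothBounded.const_mul {u : V → ℝ} {b : ℕ → ℝ} (hu : SmoothBounded u b) (c : ℝ) :
    SmoothBounded (fun x => c * u x) fun k => |c| * b k := by
  refine ⟨contDiff_const.mul hu.contDiff, fun k x => ?_⟩
  have hk : (k : WithTop ℕ∞) ≤ ((⊤ : ℕ∞) : WithTop ℕ∞) := by exact_mod_cast le_top
  have := iteratedFDeriv_const_smul_apply (a := c) (x := x) (hu.contDiff.contDiffAt.of_le hk)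
  refine (congrArg norm this).trans_le ?_
  rw [norm_smul, Real.norm_eq_abs]
  exact mul_le_mul_of_nonneg_left (hu.bound k x) (abs_nonneg c)

theorem SmoothBounded.sub {u v : V → ℝ} {b c : ℕ → ℝ} (hu : SmoothBounded u b)
    (hv : SmoothBounded v c) : SmoothBounded (fun x => u x - v x) fun k => b k + c k := by
  simpa [sub_eq_add_neg] using hu.add (hv.const_mul (-1))

theorem diffInt_sub_right {κ : ℝ → ℝ} (hκ : DiffKernel κ) {e : V} (he : ‖e‖ ≤ 1)
    {u v : V → ℝ} {b c : ℕ → ℝ} (hu : SmoothBounded u b) (hv : SmoothBounded v c) (x : V) :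
    diffInt e κ (fun y => u y - v y) x = diffInt e κ u x - diffInt e κ v x := by
  rw [diffInt, diffInt, diffInt,
    ← integral_sub (hu.integrable_diffInt hκ he x) (hv.integrable_diffInt hκ he x)]
  congr 1 with s
  ring

theorem diffInt_add_left {κ κ' : ℝ → ℝ} (hκ : DiffKernel κ) (hκ' : DiffKernel κ') {e : V}
    (he : ‖e‖ ≤ 1) {u : V → ℝ} {b : ℕ → ℝ} (hu : SmoothBounded u b) (x : V) :
    diffInt e (fun s => κ s + κ' s) u x = diffInt e κ u x + diffInt e κ' u x := by
  rw [diffInt, diffInt, diffInt,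
    ← integral_add (hu.integrable_diffInt hκ he x) (hu.integrable_diffInt hκ' he x)]
  congr 1 with s
  ring

theorem diffInt_sub_left {κ κ' : ℝ → ℝ} (hκ : DiffKernel κ) (hκ' : DiffKernel κ') {e : V}
    (he : ‖e‖ ≤ 1) {u : V → ℝ} {b : ℕ → ℝ} (hu : SmoothBounded u b) (x : V) :
    diffInt e (fun s => κ s - κ' s) u x = diffInt e κ u x - diffInt e κ' u x := by
  rw [diffInt, diffInt, diffInt,
    ← integral_sub (hu.integrable_diffInt hκ he x) (hu.integrable_diffInt hκ' he x)]
  congr 1 with s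
  ring

/-- The second difference of `u` in the direction `e`. -/
def secondDiff (e : V) (u : V → ℝ) (x : V) (s r : ℝ) : ℝ :=
  (u (x + s • e + r • e) - u (x + s • e)) - (u (x + r • e) - u x)

theorem secondDiff_comm (e : V) (u : V → ℝ) (x : V) (s r : ℝ) :
    secondDiff e u x s r = secondDiff e u x r s := by
  rw [secondDiff, secondDiff, add_right_comm]
  ring

/-- The first difference in `r` is itself bounded and smooth with a factor `min 1 |r|`, so the first
difference estimate applies to it again. The product of weights makes the double integral for two
half-order kernels absolutely convergent. -/
theorem SmoothBounded.secondDiff_le {u : V → ℝ} {b : ℕ → ℝ} (hu : SmoothBounded u b) {e : V}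
    (he : ‖e‖ ≤ 1) (x : V) (s r : ℝ) :
    |secondDiff e u x s r| ≤ 4 * (b 0 + 2 * b 1 + b 2) * (min 1 |s| * min 1 |r|) := by
  have hsm : SmoothBounded (fun y => u (y + r • e) - u y)
      fun k => 2 * (b k + b (k + 1)) * min 1 |r| := by
    refine ⟨?_, fun k y => hu.diff_le he k r y⟩
    have := hu.contDiff
    fun_prop
  refine (hsm.diff_abs_le he s x).trans_eq ?_
  ring

theorem integrable_secondDiff {κ κ' : ℝ → ℝ} (hκ : DiffKernel κ) (hκ' : DiffKernel κ') {e : V}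
    (he : ‖e‖ ≤ 1) {u : V → ℝ} {b : ℕ → ℝ} (hu : SmoothBounded u b) (x : V) :
    Integrable (fun p : ℝ × ℝ => κ p.1 * κ' p.2 * secondDiff e u x p.1 p.2) := by
  refine ((hκ.integrable.mul_prod hκ'.integrable).norm.const_mul
    (4 * (b 0 + 2 * b 1 + b 2))).mono' ?_ (Eventually.of_forall fun p => ?_)
  · refine AEStronglyMeasurable.mul ?_ (Continuous.aestronglyMeasurable ?_)
    · exact ((hκ.measurable.comp measurable_fst).mul
        (hκ'.measurable.comp measurable_snd)).aestronglyMeasurable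
    · have := hu.contDiff.continuous
      unfold secondDiff
      fun_prop
  · rw [norm_mul, norm_mul, norm_mul, norm_mul, norm_mul,
      Real.norm_of_nonneg (by positivity : 0 ≤ min 1 |p.1|),
      Real.norm_of_nonneg (by positivity : 0 ≤ min 1 |p.2|)]
    have := mul_le_mul_of_nonneg_left (hu.secondDiff_le he x p.1 p.2)
      (mul_nonneg (norm_nonneg (κ p.1)) (norm_nonneg (κ' p.2)))
    refine this.trans_eq ?_
    ring

theorem diffInt_diffInt {κ κ' : ℝ → ℝ} (hκ' : DiffKernel κ') {e : V}
    (he : ‖e‖ ≤ 1) {u : V → ℝ} {b : ℕ → ℝ} (hu : SmoothBounded u b) (x : V) :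
    diffInt e κ (diffInt e κ' u) x = ∫ s, ∫ r, κ s * κ' r * secondDiff e u x s r := by
  rw [diffInt]
  congr 1 with s
  rw [diffInt, diffInt, ← integral_sub (hu.integrable_diffInt hκ' he _)
    (hu.integrable_diffInt hκ' he _), ← integral_const_mul]
  congr 1 with r
  rw [secondDiff]
  ring

/-- Fubini together with the symmetry of the second difference in its two steps. -/
theorem diffInt_comm {κ κ' : ℝ → ℝ} (hκ : DiffKernel κ) (hκ' : DiffKernel κ') {e : V}
    (he : ‖e‖ ≤ 1) {u : V → ℝ} {b : ℕ → ℝ} (hu : SmoothBounded u b) (x : V) :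
    diffInt e κ (diffInt e κ' u) x = diffInt e κ' (diffInt e κ u) x := by
  rw [diffInt_diffInt hκ' he hu, diffInt_diffInt hκ he hu,
    integral_integral_swap (integrable_secondDiff hκ hκ' he hu x)]
  congr 1 with r
  congr 1 with s
  rw [secondDiff_comm]
  ring

/-- Continuity of the composition of two difference operators along bounded sequences. -/
theorem tendsto_diffInt_diffInt {κ κ' : ℝ → ℝ} (hκ : DiffKernel κ) (hκ' : DiffKernel κ') {e : V}
    (he : ‖e‖ ≤ 1) {u : ℕ → V → ℝ} {v : V → ℝ} {b : ℕ → ℕ → ℝ} {c : ℕ → ℝ} {M : ℝ}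
    (hu : ∀ j, SmoothBounded (u j) (b j)) (hv : SmoothBounded v c)
    (hM : ∀ j x s r, |secondDiff e (u j) x s r| ≤ M * (min 1 |s| * min 1 |r|))
    (hlim : ∀ x, Tendsto (u · x) atTop (𝓝 (v x))) (x : V) :
    Tendsto (fun j => diffInt e κ (diffInt e κ' (u j)) x) atTop
      (𝓝 (diffInt e κ (diffInt e κ' v) x)) := by
  have hform : ∀ {w : V → ℝ} {d : ℕ → ℝ}, SmoothBounded w d →
      diffInt e κ (diffInt e κ' w) x =
        ∫ p : ℝ × ℝ, κ p.1 * κ' p.2 * secondDiff e w x p.1 p.2 := by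
    intro w d hw
    rw [diffInt_diffInt hκ' he hw]
    exact (integral_prod _ (integrable_secondDiff hκ hκ' he hw x)).symm
  simp_rw [hform (hu _), hform hv]
  refine tendsto_integral_of_dominated_convergence
    (fun p => M * ‖(κ p.1 * min 1 |p.1|) * (κ' p.2 * min 1 |p.2|)‖)
    (fun j => (integrable_secondDiff hκ hκ' he (hu j) x).aestronglyMeasurable)
    ((hκ.integrable.mul_prod hκ'.integrable).norm.const_mul M)
    (fun j => Eventually.of_forall fun p => ?_) (Eventually.of_forall fun p => ?_)
  · rw [norm_mul, norm_mul, norm_mul, norm_mul, norm_mul,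
      Real.norm_of_nonneg (by positivity : 0 ≤ min 1 |p.1|),
      Real.norm_of_nonneg (by positivity : 0 ≤ min 1 |p.2|)]
    have := mul_le_mul_of_nonneg_left (hM j x p.1 p.2)
      (mul_nonneg (norm_nonneg (κ p.1)) (norm_nonneg (κ' p.2)))
    refine this.trans_eq ?_
    ring
  · exact tendsto_const_nhds.mul (((hlim _).sub (hlim _)).sub ((hlim _).sub (hlim _)))

theorem exists_smoothBounded {u : V → ℝ} (hu : ContDiff ℝ (⊤ : ℕ∞) u) (hc : HasCompactSupport u) :
    ∃ b, SmoothBounded u b := by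
  have : ∀ k : ℕ, ∃ C, ∀ x, ‖iteratedFDeriv ℝ k u x‖ ≤ C := fun k =>
    (hc.iteratedFDeriv k).exists_bound_of_continuous
      (hu.continuous_iteratedFDeriv (by exact_mod_cast le_top))
  choose b hb using this
  exact ⟨b, hu, hb⟩

end Diff

/-! ### The kernels of order one half -/

/-- The one-sided kernel `s ↦ s^(-3/2)` on the positive half line. -/
noncomputable def rightKernel (s : ℝ) : ℝ := (s * √s)⁻¹

/-- The one-sided kernel `s ↦ |s|^(-3/2)` on the negative half line. -/
noncomputable def leftKernel (s : ℝ) : ℝ := rightKernel (-s)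

/-- One-sidedness comes from the conventions `√s = 0` for `s ≤ 0` and `0⁻¹ = 0`; the same convention
makes `(√s)⁻¹` one-sided below. -/
theorem rightKernel_of_nonpos {s : ℝ} (hs : s ≤ 0) : rightKernel s = 0 := by
  simp [rightKernel, Real.sqrt_eq_zero_of_nonpos hs]

theorem rightKernel_eq_rpow {s : ℝ} (hs : 0 < s) : rightKernel s = s ^ (-(3 / 2) : ℝ) := by
  rw [rightKernel, Real.sqrt_eq_rpow, Real.rpow_neg hs.le]
  congr 1
  nth_rewrite 1 [← Real.rpow_one s]
  rw [← Real.rpow_add hs]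
  norm_num

theorem rightKernel_nonneg (s : ℝ) : 0 ≤ rightKernel s := by
  rcases le_or_gt s 0 with h | h
  · rw [rightKernel_of_nonpos h]
  · unfold rightKernel
    positivity

/-- The weighted kernel is `s^(-1/2)` on `(0, 1]` and `s^(-3/2)` beyond. -/
theorem diffKernel_rightKernel : DiffKernel rightKernel := by
  refine ⟨by unfold rightKernel; fun_prop, ?_⟩
  have hm : AEStronglyMeasurable (fun s => rightKernel s * min 1 |s|) :=
    (by unfold rightKernel; fun_prop : Measurable _).aestronglyMeasurable
  have h1 : IntegrableOn (fun s => rightKernel s * min 1 |s|) (Iic 0) :=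
    (integrableOn_zero (μ := volume)).congr_fun
      (fun s hs => by simp [rightKernel_of_nonpos hs]) measurableSet_Iic
  have h2 : IntegrableOn (fun s => rightKernel s * min 1 |s|) (Ioc 0 1) := by
    have : IntegrableOn (fun s : ℝ => s ^ (-(1 / 2) : ℝ)) (Ioc 0 1) := by
      have := (intervalIntegral.intervalIntegrable_rpow' (a := 0) (b := 1)
        (by norm_num : (-1 : ℝ) < -(1 / 2)))
      rwa [intervalIntegrable_iff_integrableOn_Ioc_of_le zero_le_one] at this
    refine this.congr_fun (fun s hs => ?_) measurableSet_Ioc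
    rw [rightKernel_eq_rpow hs.1, abs_of_pos hs.1, min_eq_right hs.2]
    nth_rewrite 3 [← Real.rpow_one s]
    rw [← Real.rpow_add hs.1]
    norm_num
  have h3 : IntegrableOn (fun s => rightKernel s * min 1 |s|) (Ioi 1) := by
    refine (integrableOn_Ioi_rpow_of_lt (by norm_num : (-(3 / 2) : ℝ) < -1) zero_lt_one).congr_fun
      (fun s hs => ?_) measurableSet_Ioi
    have hs' : (0 : ℝ) < s := zero_lt_one.trans hs
    rw [rightKernel_eq_rpow hs', abs_of_pos hs', min_eq_left (le_of_lt hs), mul_one]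
  rw [← integrableOn_univ]
  refine ((h1.union h2).union h3).mono_set fun s _ => ?_
  rcases le_or_gt s 0 with h | h
  · exact Or.inl (Or.inl h)
  · rcases le_or_gt s 1 with h' | h'
    · exact Or.inl (Or.inr ⟨h, h'⟩)
    · exact Or.inr h'

theorem diffKernel_leftKernel : DiffKernel leftKernel := by
  refine ⟨diffKernel_rightKernel.measurable.comp measurable_neg, ?_⟩
  simpa [leftKernel] using diffKernel_rightKernel.integrable.comp_neg

end ParabolicHeat

/-! ### Abel's integral and the square of a one-sided half derivative. -/

namespace ParabolicHeat

/-- This is the Beta integral `B(1/2, 1/2) = π`. The primitive is `arcsin (2s/c - 1)`, and since its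
derivative is nonnegative, continuity of the primitive already gives integrability. -/
theorem integrableOn_inv_sqrt_mul_sub {c : ℝ} (hc : 0 < c) :
    IntegrableOn (fun s => (√s)⁻¹ * (√(c - s))⁻¹) (Ioc 0 c) ∧
      ∫ s in 0..c, (√s)⁻¹ * (√(c - s))⁻¹ = Real.pi := by
  have hcont : ContinuousOn (fun s => Real.arcsin (2 * s / c - 1)) (Icc 0 c) := by fun_prop
  have hd : ∀ s ∈ Ioo 0 c, HasDerivAt (fun s => Real.arcsin (2 * s / c - 1))
      ((√s)⁻¹ * (√(c - s))⁻¹) s := by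
    intro s ⟨h0, h1⟩
    have hlt : 0 < s / c := by positivity
    have hlt1 : s / c < 1 := (div_lt_one hc).2 h1
    have e1 : 2 * s / c = 2 * (s / c) := by ring
    have h2 : HasDerivAt (fun s => 2 * s / c - 1) (2 / c) s := by
      have := (((hasDerivAt_id s).const_mul 2).div_const c).sub_const 1
      simpa using this
    have := (Real.hasDerivAt_arcsin (x := 2 * s / c - 1) (by rw [e1]; linarith)
      (by rw [e1]; linarith)).comp s h2
    refine this.congr_deriv ?_
    have h3 : 1 - (2 * s / c - 1) ^ 2 = (2 / c) ^ 2 * (s * (c - s)) := by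
      field_simp
      ring
    rw [h3, Real.sqrt_mul (by positivity), Real.sqrt_sq (by positivity), Real.sqrt_mul h0.le]
    have : 0 < √s := Real.sqrt_pos.2 h0
    have : 0 < √(c - s) := Real.sqrt_pos.2 (by linarith)
    field_simp
  have hint : IntegrableOn (fun s => (√s)⁻¹ * (√(c - s))⁻¹) (Ioc 0 c) :=
    intervalIntegral.integrableOn_deriv_of_nonneg hcont hd fun s _ => by positivity
  refine ⟨hint, ?_⟩
  rw [intervalIntegral.integral_eq_sub_of_hasDerivAt_of_le hc.le hcont hd
    ((intervalIntegrable_iff_integrableOn_Ioc_of_le hc.le).2 hint)]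
  have : 2 * c / c - 1 = 1 := by field_simp; norm_num
  rw [this]
  norm_num

theorem integral_inv_sqrt_mul_sub (c : ℝ) (hc : 0 < c) :
    Integrable (fun s => (√s)⁻¹ * (√(c - s))⁻¹) ∧ ∫ s, (√s)⁻¹ * (√(c - s))⁻¹ = Real.pi := by
  obtain ⟨h1, h2⟩ := integrableOn_inv_sqrt_mul_sub hc
  have h0 : ∀ s ∉ Ioc 0 c, (√s)⁻¹ * (√(c - s))⁻¹ = 0 := by
    intro s hs
    rcases le_or_gt s 0 with h | h
    · simp [Real.sqrt_eq_zero_of_nonpos h]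
    · have : c - s ≤ 0 := by
        by_contra h'
        exact hs ⟨h, by linarith⟩
      simp [Real.sqrt_eq_zero_of_nonpos this]
  refine ⟨(integrableOn_iff_integrable_of_support_subset ?_).1 h1, ?_⟩
  · intro s hs
    by_contra h
    exact hs (h0 s h)
  · rw [← setIntegral_eq_integral_of_forall_compl_eq_zero h0,
      ← intervalIntegral.integral_of_le hc.le, h2]

/-- The half-order integral composed with itself is `π` times the ordinary integral. -/
theorem integral_inv_sqrt_integral_inv_sqrt {h : ℝ → ℝ} (hc : Continuous h)
    (hi : Integrable h) :
    Integrable (fun s => (√s)⁻¹ * ∫ r, (√r)⁻¹ * h (s + r)) ∧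
      ∫ s, (√s)⁻¹ * ∫ r, (√r)⁻¹ * h (s + r) = Real.pi * ∫ c in Ioi 0, h c := by
  -- With `c = s + r` the iterated integral becomes a double integral of `G (c, s)`; integrating in
  -- `s` first produces the Beta integral, which equals `π` for `c > 0`.
  let G : ℝ × ℝ → ℝ := fun p => (√p.2)⁻¹ * (√(p.1 - p.2))⁻¹ * h p.1
  have hGm : Measurable G := by
    have := hc.measurable
    fun_prop
  have h0 : ∀ c ≤ 0, ∀ s, (√s)⁻¹ * (√(c - s))⁻¹ = 0 := by
    intro c hc s
    rcases le_or_gt s 0 with h | h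
    · simp [Real.sqrt_eq_zero_of_nonpos h]
    · simp [Real.sqrt_eq_zero_of_nonpos (by linarith : c - s ≤ 0)]
  have hval : ∀ c, Integrable (fun s => G (c, s)) ∧
      ∫ s, G (c, s) = (Ioi 0).indicator (fun c => Real.pi * h c) c ∧
      ∫ s, ‖G (c, s)‖ = (Ioi 0).indicator (fun c => Real.pi * ‖h c‖) c := by
    intro c
    rcases le_or_gt c 0 with hc | hc
    · have : ∀ s, G (c, s) = 0 := fun s => by simp only [G, h0 c hc s, zero_mul]
      simp [this, hc.not_gt]
    · obtain ⟨h1, h2⟩ := integral_inv_sqrt_mul_sub c hc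
      refine ⟨h1.mul_const (h c), ?_, ?_⟩
      · simp only [G]
        rw [integral_mul_const, h2, indicator_of_mem (by exact hc)]
      · have : ∀ s, ‖G (c, s)‖ = (√s)⁻¹ * (√(c - s))⁻¹ * ‖h c‖ := by
          intro s
          simp only [G]
          rw [norm_mul, Real.norm_of_nonneg (by positivity)]
        simp_rw [this]
        rw [integral_mul_const, h2, indicator_of_mem (by exact hc)]
  have hG : Integrable G (volume.prod volume) := by
    rw [integrable_prod_iff hGm.aestronglyMeasurable]
    refine ⟨Eventually.of_forall fun c => (hval c).1, ?_⟩
    simp_rw [(hval _).2.2]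
    exact (hi.norm.const_mul _).indicator measurableSet_Ioi
  have hinner : ∀ s, ∫ c, G (c, s) = (√s)⁻¹ * ∫ r, (√r)⁻¹ * h (s + r) := by
    intro s
    rw [← integral_const_mul, ← integral_add_left_eq_self _ s]
    congr 1 with r
    simp only [G, add_sub_cancel_left]
    ring
  have hswap : ∫ c, ∫ s, G (c, s) = ∫ s, ∫ c, G (c, s) := integral_integral_swap hG
  refine ⟨by simpa only [hinner] using hG.integral_prod_right, ?_⟩
  simp_rw [hinner, (hval _).2.1] at hswap
  rw [← hswap, integral_indicator measurableSet_Ioi, integral_const_mul]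

/-- Integration by parts for the one-sided difference operator. -/
theorem diffInt_leftKernel_eq {g : ℝ → ℝ} {b : ℕ → ℝ} (hg : SmoothBounded g b) (x : ℝ)
    (hi : Integrable fun s => (√s)⁻¹ * deriv g (x - s)) :
    diffInt 1 leftKernel g x = -2 * ∫ s, (√s)⁻¹ * deriv g (x - s) := by
  have hgd : Differentiable ℝ g := hg.contDiff.differentiable (by simp)
  have hI : Integrable fun s => rightKernel s * (g (x - s) - g x) := by
    have := (hg.integrable_diffInt (e := (1 : ℝ)) diffKernel_leftKernel (by simp) x).comp_neg
    simpa [leftKernel, sub_eq_add_neg] using this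
  have h1 : diffInt 1 leftKernel g x = ∫ s in Ioi 0, (g (x - s) - g x) * rightKernel s := by
    rw [setIntegral_eq_integral_of_forall_compl_eq_zero]
    · rw [diffInt, ← integral_neg_eq_self]
      congr 1 with s
      simp only [leftKernel, neg_neg, smul_eq_mul, mul_one, ← sub_eq_add_neg]
      ring
    · intro s hs
      simp [rightKernel_of_nonpos (not_lt.1 hs)]
  have h2 : ∫ s, (√s)⁻¹ * deriv g (x - s) = ∫ s in Ioi 0, (√s)⁻¹ * deriv g (x - s) := by
    rw [setIntegral_eq_integral_of_forall_compl_eq_zero]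
    intro s hs
    simp [Real.sqrt_eq_zero_of_nonpos (not_lt.1 hs)]
  rw [h1, h2]
  have hu : ∀ s ∈ Ioi (0 : ℝ), HasDerivAt (fun s => g (x - s) - g x) (-deriv g (x - s)) s := by
    intro s _
    have := (hgd (x - s)).hasDerivAt.comp s ((hasDerivAt_id s).const_sub x)
    simpa using this.sub_const (g x)
  have hv : ∀ s ∈ Ioi (0 : ℝ), HasDerivAt (fun s => -2 * (√s)⁻¹) (rightKernel s) s := by
    intro s hs
    have hs' : (0 : ℝ) < s := hs
    have := ((Real.hasDerivAt_sqrt hs'.ne').inv (Real.sqrt_pos.2 hs').ne').const_mul (-2)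
    refine this.congr_deriv ?_
    rw [rightKernel, Real.sq_sqrt hs'.le]
    have : 0 < √s := Real.sqrt_pos.2 hs'
    field_simp
  have hbound : ∀ s, |g (x - s) - g x| ≤ 2 * (b 0 + b 1) * min 1 |s| := by
    intro s
    simpa [sub_eq_add_neg] using hg.diff_abs_le (e := (1 : ℝ)) (by simp) (-s) x
  have hb0 : 0 ≤ b 0 + b 1 := add_nonneg (hg.nonneg 0) (hg.nonneg 1)
  -- The primitive of the kernel is `-2 s^(-1/2)`. Both boundary terms vanish: near `0` the
  -- difference is `O(s)`, leaving `O(√s)`, and at infinity it is bounded.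
  have key := integral_Ioi_mul_deriv_eq_deriv_mul (a := (0 : ℝ)) (a' := 0) (b' := 0) hu hv ?_ ?_ ?_ ?_
  · rw [key, ← integral_const_mul, sub_zero, zero_sub, ← integral_neg]
    congr 1 with s
    ring
  · exact (hI.congr (Eventually.of_forall fun s => mul_comm _ _)).integrableOn
  · refine ((hi.const_mul 2).congr (Eventually.of_forall fun s => ?_)).integrableOn
    simp only [Pi.mul_apply]
    ring
  · have hlim : Tendsto (fun s : ℝ => 4 * (b 0 + b 1) * √s) (𝓝[>] 0) (𝓝 0) := by
      have : ContinuousAt (fun s : ℝ => 4 * (b 0 + b 1) * √s) 0 := by fun_prop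
      have := this.tendsto
      simp only [Real.sqrt_zero, mul_zero] at this
      exact this.mono_left nhdsWithin_le_nhds
    refine squeeze_zero_norm' ?_ hlim
    filter_upwards [self_mem_nhdsWithin] with s hs
    have hs' : (0 : ℝ) < s := hs
    have h3 := Real.sqrt_pos.2 hs'
    have h4 : |g (x - s) - g x| ≤ 2 * (b 0 + b 1) * s := by
      refine (hbound s).trans (mul_le_mul_of_nonneg_left ?_ (by positivity))
      rw [abs_of_pos hs']
      exact min_le_right _ _
    rw [Pi.mul_apply, norm_mul, norm_mul, norm_inv, Real.norm_of_nonneg h3.le, Real.norm_eq_abs]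
    calc |g (x - s) - g x| * (‖(-2 : ℝ)‖ * (√s)⁻¹)
        ≤ 2 * (b 0 + b 1) * s * (2 * (√s)⁻¹) := by
          norm_num
          gcongr
      _ = 4 * (b 0 + b 1) * √s := by
          nth_rewrite 1 [← Real.mul_self_sqrt hs'.le]
          field_simp
          ring
  · have hlim : Tendsto (fun s : ℝ => 4 * (b 0 + b 1) * (√s)⁻¹) atTop (𝓝 0) := by
      have := (tendsto_inv_atTop_zero.comp Real.tendsto_sqrt_atTop).const_mul (4 * (b 0 + b 1))
      simpa using this
    refine squeeze_zero_norm' ?_ hlim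
    filter_upwards with s
    have h4 : |g (x - s) - g x| ≤ 2 * (b 0 + b 1) := by
      refine (hbound s).trans ?_
      exact mul_le_of_le_one_right (by positivity) (min_le_left _ _)
    rw [Pi.mul_apply, norm_mul, norm_mul, norm_inv, Real.norm_of_nonneg (Real.sqrt_nonneg s),
      Real.norm_eq_abs]
    calc |g (x - s) - g x| * (‖(-2 : ℝ)‖ * (√s)⁻¹)
        ≤ 2 * (b 0 + b 1) * (2 * (√s)⁻¹) := by
          norm_num
          gcongr
      _ = 4 * (b 0 + b 1) * (√s)⁻¹ := by ring

theorem SmoothBounded.deriv {g : ℝ → ℝ} {b : ℕ → ℝ} (hg : SmoothBounded g b) :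
    SmoothBounded (deriv g) fun k => b (k + 1) := by
  simpa [fderiv_apply_one_eq_deriv] using hg.fderiv_apply (v := (1 : ℝ)) (by simp)

theorem integrable_inv_sqrt_mul_of_hasCompactSupport {h : ℝ → ℝ} (hc : Continuous h)
    (hs : HasCompactSupport h) : Integrable fun s => (√s)⁻¹ * h s := by
  have hloc : LocallyIntegrable fun s : ℝ => (√s)⁻¹ := by
    rw [locallyIntegrable_iff]
    intro K hK
    obtain ⟨R, hR⟩ := hK.isBounded.subset_closedBall 0
    have hR' : K ⊆ Icc (-|R|) |R| := fun s hs => by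
      have := hR hs
      rw [Real.closedBall_eq_Icc] at this
      exact ⟨by linarith [this.1, le_abs_self R], by linarith [this.2, le_abs_self R]⟩
    refine IntegrableOn.mono_set ?_ hR'
    have h1 : IntegrableOn (fun s : ℝ => (√s)⁻¹) (Iic 0) :=
      (integrableOn_zero (μ := volume)).congr_fun
        (fun s hs => by simp [Real.sqrt_eq_zero_of_nonpos hs]) measurableSet_Iic
    have h2 : IntegrableOn (fun s : ℝ => (√s)⁻¹) (Ioc 0 |R|) := by
      have := (intervalIntegral.intervalIntegrable_rpow' (a := 0) (b := |R|)
        (by norm_num : (-1 : ℝ) < -(1 / 2)))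
      rw [intervalIntegrable_iff_integrableOn_Ioc_of_le (abs_nonneg R)] at this
      refine this.congr_fun (fun s hs => ?_) measurableSet_Ioc
      change s ^ (-(1 / 2) : ℝ) = _
      rw [Real.rpow_neg hs.1.le, Real.sqrt_eq_rpow]
    refine (h1.union h2).mono_set fun s hs => ?_
    rcases le_or_gt s 0 with h | h
    · exact Or.inl h
    · exact Or.inr ⟨h, hs.2⟩
  simpa [mul_comm] using hloc.integrable_smul_left_of_hasCompactSupport hc hs

/-- The square of the one-sided half derivative, on test functions. -/
theorem diffInt_leftKernel_leftKernel_of_hasCompactSupport {f : ℝ → ℝ}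
    (hf : ContDiff ℝ (⊤ : ℕ∞) f) (hs : HasCompactSupport f) (x : ℝ) :
    diffInt 1 leftKernel (diffInt 1 leftKernel f) x = 4 * Real.pi * deriv f x := by
  have he : ‖(1 : ℝ)‖ ≤ 1 := by simp
  obtain ⟨b, hb⟩ := exists_smoothBounded hf hs
  have hf1 : ContDiff ℝ (⊤ : ℕ∞) (deriv f) := hb.deriv.contDiff
  have hcs : ∀ (g : ℝ → ℝ) (x : ℝ), HasCompactSupport g → HasCompactSupport fun s => g (x - s) :=
    fun g x hg => hg.comp_homeomorph (Homeomorph.subLeft x)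
  have hint : ∀ {g : ℝ → ℝ} (_ : Continuous g) (_ : HasCompactSupport g) (x : ℝ),
      Integrable fun s => (√s)⁻¹ * g (x - s) := fun hg hgs x =>
    integrable_inv_sqrt_mul_of_hasCompactSupport (hg.comp (continuous_sub_left x)) (hcs _ x hgs)
  have hf2 : Continuous (deriv (deriv f)) := hb.deriv.deriv.contDiff.continuous
  -- Each half derivative is `-2` times a half integral of a derivative, so the square is `4` times
  -- a double half integral of `f''`. By Abel's identity this is `4π` times the integral of `f''`
  -- over `(-∞, x)`.
  have hD : ∀ y, deriv (diffInt 1 leftKernel f) y = -2 * ∫ r, (√r)⁻¹ * deriv (deriv f) (y - r) := by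
    intro y
    rw [← fderiv_apply_one_eq_deriv, fderiv_diffInt diffKernel_leftKernel he hb]
    simp_rw [fderiv_apply_one_eq_deriv]
    exact diffInt_leftKernel_eq hb.deriv y (hint hf2 hs.deriv.deriv y)
  obtain ⟨h1, h2⟩ := integral_inv_sqrt_integral_inv_sqrt
    (hf2.comp (continuous_sub_left x))
    ((hf2.comp (continuous_sub_left x)).integrable_of_hasCompactSupport
      (hcs _ x hs.deriv.deriv))
  have hform : (fun s => (√s)⁻¹ * deriv (diffInt 1 leftKernel f) (x - s)) = fun s =>
      -2 * ((√s)⁻¹ * ∫ r, (√r)⁻¹ * ((deriv (deriv f)) ∘ fun y => x - y) (s + r)) := by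
    ext s
    rw [hD]
    simp only [Function.comp_apply, ← sub_sub]
    ring
  have h3 : ∫ c in Ioi 0, ((deriv (deriv f)) ∘ fun y => x - y) c = deriv f x := by
    have hd : ∀ c ∈ Ici (0 : ℝ), HasDerivAt (fun c => -deriv f (x - c))
        (((deriv (deriv f)) ∘ fun y => x - y) c) c := by
      intro c _
      refine ((hf1.differentiable (by simp) (x - c)).hasDerivAt.comp c
        ((hasDerivAt_id c).const_sub x)).neg.congr_deriv ?_
      simp
    have hlim : Tendsto (fun c => -deriv f (x - c)) atTop (𝓝 0) := by
      have := (hcs _ x hs.deriv).is_zero_at_infty.mono_left atTop_le_cocompact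
      simpa using this.neg
    rw [integral_Ioi_of_hasDerivAt_of_tendsto' hd
      ((hf2.comp (continuous_sub_left x)).integrable_of_hasCompactSupport
        (hcs _ x hs.deriv.deriv)).integrableOn hlim]
    simp
  rw [diffInt_leftKernel_eq (hb.diffInt diffKernel_leftKernel he) x
    (hform ▸ h1.const_mul (-2)), hform, integral_const_mul, h2, h3]
  ring

end ParabolicHeat

/-! ### Half derivatives of bounded smooth functions and the factorization of the time derivative.
-/

namespace ParabolicHeat

theorem SmoothBounded.mul {V : Type*} [NormedAddCommGroup V] [NormedSpace ℝ V] {u v : V → ℝ}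
    {b c : ℕ → ℝ} (hu : SmoothBounded u b) (hv : SmoothBounded v c) :
    SmoothBounded (fun x => u x * v x)
      fun k => ∑ i ∈ Finset.range (k + 1), (k.choose i : ℝ) * b i * c (k - i) := by
  refine ⟨hu.contDiff.mul hv.contDiff, fun k x => ?_⟩
  refine (norm_iteratedFDeriv_mul_le hu.contDiff hv.contDiff x
    (by exact_mod_cast le_top : (k : WithTop ℕ∞) ≤ _)).trans (Finset.sum_le_sum fun i _ => ?_)
  have := hu.nonneg i
  gcongr
  · exact hu.bound i x
  · exact hv.bound (k - i) x

/-- Because `‖L‖ ≤ 1`, the bounds `b` survive unchanged. This serves for dilated cutoffs with bounds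
uniform in the dilation, for reflections and for restrictions to lines. -/
theorem SmoothBounded.comp_affine {V W : Type*} [NormedAddCommGroup V] [NormedSpace ℝ V]
    [NormedAddCommGroup W] [NormedSpace ℝ W] {u : V → ℝ}
    {b : ℕ → ℝ} (hu : SmoothBounded u b) (L : W →L[ℝ] V) (hL : ‖L‖ ≤ 1) (x : V) :
    SmoothBounded (fun y => u (x + L y)) b := by
  have h1 : ContDiff ℝ (⊤ : ℕ∞) fun y => u (x + y) := by
    have := hu.contDiff
    fun_prop
  refine ⟨h1.comp L.contDiff, fun k y => ?_⟩
  have := L.iteratedFDeriv_comp_right h1 y (by exact_mod_cast le_top : (k : WithTop ℕ∞) ≤ _)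
  refine (congrArg norm this).trans_le ?_
  refine (ContinuousMultilinearMap.norm_compContinuousLinearMap_le _ _).trans ?_
  rw [iteratedFDeriv_comp_add_left]
  refine (mul_le_mul (hu.bound k _) (Finset.prod_le_one (fun _ _ => norm_nonneg _) fun _ _ => hL)
    (Finset.prod_nonneg fun _ _ => norm_nonneg _) (hu.nonneg k)).trans_eq (mul_one _)

/-- The square of the one-sided half derivative, on bounded smooth functions. -/
theorem diffInt_leftKernel_leftKernel {f : ℝ → ℝ} {b : ℕ → ℝ} (hf : SmoothBounded f b) (x : ℝ) :
    diffInt 1 leftKernel (diffInt 1 leftKernel f) x = 4 * Real.pi * deriv f x := by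
  have he : ‖(1 : ℝ)‖ ≤ 1 := by simp
  let χ : ContDiffBump (0 : ℝ) := ⟨1, 2, one_pos, one_lt_two⟩
  have hχs : HasCompactSupport χ := χ.hasCompactSupport
  have hχd : ContDiff ℝ (⊤ : ℕ∞) χ := χ.contDiff
  obtain ⟨c, hc⟩ := exists_smoothBounded hχd hχs
  have hpos : ∀ j : ℕ, 0 < ((j : ℝ) + 1)⁻¹ := fun j => by positivity
  have hle : ∀ j : ℕ, ((j : ℝ) + 1)⁻¹ ≤ 1 := fun j => by
    rw [inv_le_one₀ (by positivity)]
    linarith [Nat.cast_nonneg (α := ℝ) j]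
  let χj : ℕ → ℝ → ℝ := fun j t => χ (0 + (((j : ℝ) + 1)⁻¹ • ContinuousLinearMap.id ℝ ℝ) t)
  have hχj : ∀ j, SmoothBounded (χj j) c := fun j => hc.comp_affine _ (by
    rw [norm_smul, Real.norm_of_nonneg (hpos j).le]
    exact mul_le_one₀ (hle j) (norm_nonneg _) ContinuousLinearMap.norm_id_le) 0
  have happ : ∀ j t, χj j t = χ (((j : ℝ) + 1)⁻¹ * t) := fun j t => by simp [χj]
  have hcs : ∀ j, HasCompactSupport (χj j) := fun j => by
    have := hχs.comp_homeomorph (Homeomorph.mulLeft₀ ((j : ℝ) + 1)⁻¹ (hpos j).ne')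
    have h : χj j = χ ∘ Homeomorph.mulLeft₀ ((j : ℝ) + 1)⁻¹ (hpos j).ne' := by
      ext t
      simp [happ]
    rwa [h]
  have hone : ∀ (j : ℕ) (t : ℝ), |t| ≤ (j : ℝ) + 1 → χj j t = 1 := fun j t ht => by
    rw [happ]
    apply χ.one_of_mem_closedBall
    rw [mem_closedBall_zero_iff, norm_mul, Real.norm_of_nonneg (hpos j).le, Real.norm_eq_abs,
      inv_mul_le_iff₀ (by positivity)]
    simpa [χ] using ht
  have hm := fun j => hf.mul (hχj j)
  have hlim : ∀ y, ∀ᶠ j : ℕ in atTop, |y| ≤ (j : ℝ) := fun y => by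
    filter_upwards [eventually_ge_atTop ⌈|y|⌉₊] with j hj using Nat.ceil_le.1 hj
  have h1 := tendsto_diffInt_diffInt diffKernel_leftKernel diffKernel_leftKernel he hm hf
    (fun j x s r => (hm j).secondDiff_le he x s r) (fun y => tendsto_const_nhds.congr' (by
      filter_upwards [hlim y] with j hj
      rw [hone j y (by linarith), mul_one])) x
  refine tendsto_nhds_unique h1 (tendsto_const_nhds.congr' ?_)
  filter_upwards [hlim x] with j hj
  rw [diffInt_leftKernel_leftKernel_of_hasCompactSupport (hm j).contDiff (hcs j).mul_left]
  congr 1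
  refine Filter.EventuallyEq.deriv_eq ?_
  have : ∀ᶠ y in 𝓝 x, |y| < (j : ℝ) + 1 :=
    (continuous_abs.continuousAt.eventually_lt_const (by linarith))
  filter_upwards [this] with y hy
  rw [hone j y hy.le, mul_one]

theorem diffInt_rightKernel_comp_neg (g : ℝ → ℝ) (x : ℝ) :
    diffInt 1 rightKernel g x = diffInt 1 leftKernel (fun y => g (-y)) (-x) := by
  rw [diffInt, diffInt, ← integral_neg_eq_self]
  congr 1 with s
  simp only [leftKernel, smul_eq_mul, mul_one, neg_add_rev, neg_neg]
  rw [add_comm]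

theorem diffInt_rightKernel_rightKernel {f : ℝ → ℝ} {b : ℕ → ℝ} (hf : SmoothBounded f b) (x : ℝ) :
    diffInt 1 rightKernel (diffInt 1 rightKernel f) x = -(4 * Real.pi * deriv f x) := by
  have hneg : SmoothBounded (fun y => f (-y)) b := by
    have := hf.comp_affine (-ContinuousLinearMap.id ℝ ℝ) (by simp) 0
    simpa using this
  rw [diffInt_rightKernel_comp_neg]
  have : (fun y => diffInt 1 rightKernel f (-y)) = diffInt 1 leftKernel fun y => f (-y) := by
    ext y
    rw [diffInt_rightKernel_comp_neg, neg_neg]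
  rw [this, diffInt_leftKernel_leftKernel hneg]
  have : deriv (fun y => f (-y)) (-x) = -deriv f x := by
    rw [deriv_comp_neg, neg_neg]
  rw [this]
  ring

/-- The kernel `s ↦ |s|^(-3/2)` of the half derivative. -/
noncomputable def evenKernel (s : ℝ) : ℝ := rightKernel s + leftKernel s

/-- The kernel `s ↦ sgn(s) |s|^(-3/2)`. -/
noncomputable def oddKernel (s : ℝ) : ℝ := rightKernel s - leftKernel s

theorem diffKernel_evenKernel : DiffKernel evenKernel := by
  refine ⟨diffKernel_rightKernel.measurable.add diffKernel_leftKernel.measurable, ?_⟩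
  refine (diffKernel_rightKernel.integrable.add diffKernel_leftKernel.integrable).congr
    (Eventually.of_forall fun s => ?_)
  simp only [evenKernel, Pi.add_apply, add_mul]

theorem diffKernel_oddKernel : DiffKernel oddKernel := by
  refine ⟨diffKernel_rightKernel.measurable.sub diffKernel_leftKernel.measurable, ?_⟩
  refine (diffKernel_rightKernel.integrable.sub diffKernel_leftKernel.integrable).congr
    (Eventually.of_forall fun s => ?_)
  simp only [oddKernel, Pi.sub_apply, sub_mul]

/-- The operator moves points only along lines parallel to `e`, so identities on `ℝ` transfer to
`V`. -/
theorem diffInt_line {V : Type*} [NormedAddCommGroup V] [NormedSpace ℝ V] (e : V) (κ : ℝ → ℝ)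
    (u : V → ℝ) (x : V) (t : ℝ) :
    diffInt e κ u (x + t • e) = diffInt 1 κ (fun t => u (x + t • e)) t := by
  simp only [diffInt, smul_eq_mul, mul_one, add_smul, add_assoc]

/-- The composition of the even and the odd half derivatives is a multiple of the derivative. -/
theorem diffInt_evenKernel_oddKernel {V : Type*} [NormedAddCommGroup V] [NormedSpace ℝ V] {e : V}
    (he : ‖e‖ ≤ 1) {u : V → ℝ} {b : ℕ → ℝ} (hu : SmoothBounded u b) (x : V) :
    diffInt e evenKernel (diffInt e oddKernel u) x = -(8 * Real.pi) * fderiv ℝ u x e := by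
  have he1 : ‖(1 : ℝ)‖ ≤ 1 := by simp
  have hf : SmoothBounded (fun t : ℝ => u (x + t • e)) b := by
    have := hu.comp_affine (ContinuousLinearMap.toSpanSingleton ℝ e) (by simpa using he) x
    simpa using this
  have hd : deriv (fun t : ℝ => u (x + t • e)) 0 = fderiv ℝ u x e := by
    have h1 : HasFDerivAt u (fderiv ℝ u x) (x + (0 : ℝ) • e) := by
      simpa using (hu.contDiff.differentiable (by simp) x).hasFDerivAt
    have h2 : HasDerivAt (fun t : ℝ => x + t • e) e 0 := by
      simpa using ((hasDerivAt_id (0 : ℝ)).smul_const e).const_add x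
    exact (h1.comp_hasDerivAt 0 h2).deriv
  have h0 := diffInt_line e evenKernel (diffInt e oddKernel u) x 0
  rw [zero_smul, add_zero] at h0
  rw [h0]
  simp_rw [diffInt_line]
  have hl := diffKernel_leftKernel
  have hr := diffKernel_rightKernel
  have hodd : (fun t : ℝ => diffInt 1 oddKernel (fun t : ℝ => u (x + t • e)) t) = fun t =>
      diffInt 1 rightKernel (fun t : ℝ => u (x + t • e)) t -
        diffInt 1 leftKernel (fun t : ℝ => u (x + t • e)) t := by
    ext t
    exact diffInt_sub_left hr hl he1 hf t
  have hfr := hf.diffInt hr he1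
  have hfl := hf.diffInt hl he1
  rw [hodd]
  -- `(R + L)(R - L) = R² - L²`: the mixed terms cancel because the one-sided operators commute, and
  -- `R²` and `-L²` each contribute `-4π` times the derivative.
  have heven := diffInt_add_left hr hl he1 (hfr.sub hfl) 0
  refine heven.trans ?_
  rw [diffInt_sub_right hr he1 hfr hfl, diffInt_sub_right hl he1 hfr hfl,
    diffInt_comm hl hr he1 hf]
  have e1 := diffInt_rightKernel_rightKernel hf 0
  have e2 := diffInt_leftKernel_leftKernel hf 0
  rw [hd] at e1 e2
  rw [e1, e2]
  ring

end ParabolicHeat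

namespace ParabolicHeat

variable {n : ℕ}

instance : (volume : Measure (SpaceTime n)).IsAddHaarMeasure :=
  inferInstanceAs ((volume : Measure (EuclideanSpace ℝ (Fin n))).prod
    (volume : Measure ℝ)).IsAddHaarMeasure

/-! ### The heat kernel -/

theorem heatKernel_nonneg (z : SpaceTime n) : 0 ≤ heatKernel z := by
  unfold heatKernel
  split_ifs with h
  · positivity
  · rfl

theorem measurable_heatKernel : Measurable (heatKernel : SpaceTime n → ℝ) := by
  unfold heatKernel
  refine Measurable.ite (measurableSet_lt measurable_const measurable_snd) ?_ measurable_const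
  fun_prop

theorem heatKernel_of_nonpos (x : EuclideanSpace ℝ (Fin n)) {t : ℝ} (ht : t ≤ 0) :
    heatKernel (x, t) = 0 := by
  simp [heatKernel, not_lt.2 ht]

theorem heatKernel_of_pos (x : EuclideanSpace ℝ (Fin n)) {t : ℝ} (ht : 0 < t) :
    heatKernel (x, t) = 1 / (4 * Real.pi * t) ^ ((n : ℝ) / 2) *
      Real.exp (-(1 / (4 * t)) * ‖x‖ ^ 2) := by
  simp only [heatKernel, ht, if_true]
  congr 2
  ring

theorem integrable_exp_neg_mul_norm_sq {b : ℝ} (hb : 0 < b) :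
    Integrable fun x : EuclideanSpace ℝ (Fin n) => Real.exp (-b * ‖x‖ ^ 2) := by
  have := GaussianFourier.integrable_cexp_neg_mul_sq_norm_add (V := EuclideanSpace ℝ (Fin n))
    (b := (b : ℂ)) (by simpa using hb) 0 0
  refine (this.norm).congr (Eventually.of_forall fun x => ?_)
  simp [Complex.norm_exp, ← Complex.ofReal_pow, ← Complex.ofReal_mul]

theorem integrable_heatKernel_slice (t : ℝ) :
    Integrable fun x : EuclideanSpace ℝ (Fin n) => heatKernel (x, t) := by
  rcases le_or_gt t 0 with h | h
  · simp [heatKernel_of_nonpos _ h]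
  · simp_rw [heatKernel_of_pos _ h]
    exact (integrable_exp_neg_mul_norm_sq (by positivity)).const_mul _

theorem integral_heatKernel_slice {t : ℝ} (ht : 0 < t) :
    ∫ x : EuclideanSpace ℝ (Fin n), heatKernel (x, t) = 1 := by
  simp_rw [heatKernel_of_pos _ ht]
  rw [integral_const_mul, GaussianFourier.integral_rexp_neg_mul_sq_norm (by positivity)]
  have h1 : Real.pi / (1 / (4 * t)) = 4 * Real.pi * t := by field_simp
  rw [h1, finrank_euclideanSpace_fin, one_div, inv_mul_cancel₀]
  positivity

theorem integral_heatKernel_slice_le (t : ℝ) :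
    ∫ x : EuclideanSpace ℝ (Fin n), heatKernel (x, t) ≤ 1 := by
  rcases le_or_gt t 0 with h | h
  · simp [heatKernel_of_nonpos _ h]
  · exact (integral_heatKernel_slice h).le

/-- Every time slice of the kernel has mass at most one, so cutting off in time alone gives
integrability. For this reason test functions are majorized below only by a function of time. -/
theorem integrable_heatKernel_mul_time {a : ℝ → ℝ} (ha : Integrable a) :
    Integrable fun z : SpaceTime n => heatKernel z * a z.2 := by
  have hm : AEStronglyMeasurable (fun z : SpaceTime n => heatKernel z * a z.2)
      (volume.prod volume) :=
    measurable_heatKernel.aestronglyMeasurable.mul ha.aestronglyMeasurable.comp_snd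
  change Integrable (fun z : SpaceTime n => heatKernel z * a z.2) (volume.prod volume)
  rw [integrable_prod_iff' hm]
  refine ⟨Eventually.of_forall fun t => (integrable_heatKernel_slice t).mul_const (a t), ?_⟩
  refine ha.norm.mono' hm.norm.prod_swap.integral_prod_right' (Eventually.of_forall fun t => ?_)
  simp_rw [norm_mul, Real.norm_of_nonneg (heatKernel_nonneg _)]
  rw [integral_mul_const, Real.norm_of_nonneg
    (mul_nonneg (integral_nonneg fun _ => heatKernel_nonneg _) (norm_nonneg _))]
  exact mul_le_of_le_one_left (norm_nonneg _) (integral_heatKernel_slice_le t)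

theorem integral_heatKernel_mul_time_le {a : ℝ → ℝ} (ha : Integrable a) (h0 : ∀ t, 0 ≤ a t) :
    ∫ z : SpaceTime n, heatKernel z * a z.2 ≤ ∫ t, a t := by
  have h := integrable_heatKernel_mul_time (n := n) ha
  have := integral_prod_symm _ h
  refine this.trans_le (integral_mono h.integral_prod_right ha fun t => ?_)
  change ∫ x, heatKernel (x, t) * a t ≤ a t
  rw [integral_mul_const]
  exact mul_le_of_le_one_left (h0 t) (integral_heatKernel_slice_le t)

/-- The potential `W̌ * φ`. -/
noncomputable def backwardPotential (φ : SpaceTime n → ℝ) (w : SpaceTime n) : ℝ :=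
  ∫ z, heatKernel z * φ (z + w)

/-- After translation the parameter `w` sits in the smooth factor, so derivatives in `w` never touch
the singular kernel. -/
theorem heatPotential_eq (ν : 𝓓'((⊤ : Opens (SpaceTime n)), ℝ)) (φ : SpaceTime n → ℝ) :
    heatPotential ν φ = pairing ν (backwardPotential φ) := by
  unfold heatPotential backwardPotential
  congr 1 with w
  rw [← integral_add_right_eq_self _ w]
  simp

/-- The indicator function of a bounded interval of times. -/
noncomputable def timeCutoff (R t : ℝ) : ℝ := (Icc (-R) R).indicator 1 t

theorem timeCutoff_nonneg (R t : ℝ) : 0 ≤ timeCutoff R t :=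
  indicator_nonneg (fun _ _ => zero_le_one) t

theorem timeCutoff_of_abs_le {R t : ℝ} (h : |t| ≤ R) : timeCutoff R t = 1 :=
  indicator_of_mem (s := Icc (-R) R) (abs_le.1 h) _

theorem integrable_timeCutoff (R : ℝ) : Integrable (timeCutoff R) :=
  (integrable_indicator_iff measurableSet_Icc).2 (by
    exact integrableOn_const (by simp) (by simp))

theorem integral_timeCutoff {R : ℝ} (hR : 0 ≤ R) (c : ℝ) : ∫ t, timeCutoff R (t + c) = 2 * R := by
  rw [integral_add_right_eq_self (timeCutoff R) c]
  unfold timeCutoff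
  rw [integral_indicator measurableSet_Icc]
  simp only [Pi.one_apply, integral_const, measureReal_restrict_apply_univ, Real.volume_real_Icc,
    smul_eq_mul, mul_one]
  rw [max_eq_left (by linarith)]
  ring

/-- Smooth functions with compact support in time-strip form. -/
structure IsTest (φ : SpaceTime n → ℝ) : Prop where
  contDiff : ContDiff ℝ (⊤ : ℕ∞) φ
  hasCompactSupport : HasCompactSupport φ

theorem IsTest.exists_bound {φ : SpaceTime n → ℝ} (hφ : IsTest φ) :
    ∃ (b : ℕ → ℝ) (R : ℝ), 0 ≤ R ∧ SmoothBounded φ b ∧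
      ∀ k z, ‖iteratedFDeriv ℝ k φ z‖ ≤ b k * timeCutoff R z.2 := by
  obtain ⟨b, hb⟩ := exists_smoothBounded hφ.contDiff hφ.hasCompactSupport
  obtain ⟨R, hR⟩ := hφ.hasCompactSupport.isCompact.isBounded.subset_closedBall 0
  refine ⟨b, max R 0, le_max_right _ _, hb, fun k z => ?_⟩
  by_cases hz : z ∈ tsupport φ
  · have h1 : ‖z‖ ≤ R := by simpa using hR hz
    rw [timeCutoff_of_abs_le, mul_one]
    · exact hb.bound k z
    · exact ((norm_snd_le z).trans h1).trans (le_max_left _ _)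
  · have : iteratedFDeriv ℝ k φ z = 0 := by
      by_contra h
      exact hz (support_iteratedFDeriv_subset k h)
    rw [this, norm_zero]
    exact mul_nonneg (hb.nonneg k) (timeCutoff_nonneg _ _)

theorem heatKernel_aux {φ : SpaceTime n → ℝ} (hφ : IsTest φ) :
    (∀ z, ContDiff ℝ (⊤ : ℕ∞) fun w => heatKernel z * φ (z + w)) ∧
    (∀ k z w, iteratedFDeriv ℝ k (fun w => heatKernel z * φ (z + w)) w =
      heatKernel z • iteratedFDeriv ℝ k φ (z + w)) ∧
    (∀ (k : ℕ) (w : SpaceTime n), AEStronglyMeasurable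
      (fun z => iteratedFDeriv ℝ k (fun w => heatKernel z * φ (z + w)) w) volume) ∧
    (∀ (k : ℕ) (w₀ : SpaceTime n), ∃ c : SpaceTime n → ℝ, Integrable c volume ∧ ∀ᶠ w in 𝓝 w₀, ∀ z,
      ‖iteratedFDeriv ℝ k (fun w => heatKernel z * φ (z + w)) w‖ ≤ c z) := by
  obtain ⟨b, R, hR, hb, hbR⟩ := hφ.exists_bound
  have h1 : ∀ z, ContDiff ℝ (⊤ : ℕ∞) fun w => φ (z + w) := by
    intro z
    have := hφ.contDiff
    fun_prop
  have h2 : ∀ k z w, iteratedFDeriv ℝ k (fun w => heatKernel z * φ (z + w)) w =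
      heatKernel z • iteratedFDeriv ℝ k φ (z + w) := by
    intro k z w
    have := iteratedFDeriv_const_smul_apply (a := heatKernel z) (x := w)
      ((h1 z).contDiffAt.of_le (by exact_mod_cast le_top : (k : WithTop ℕ∞) ≤ _))
    rw [iteratedFDeriv_comp_add_left] at this
    exact this
  refine ⟨fun z => contDiff_const.mul (h1 z), h2, fun k w => ?_, fun k w₀ => ?_⟩
  · simp_rw [h2]
    refine measurable_heatKernel.aestronglyMeasurable.smul (Continuous.aestronglyMeasurable ?_)
    have := hφ.contDiff.continuous_iteratedFDeriv (m := k) (by exact_mod_cast le_top)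
    fun_prop
  -- The radius `R + |w₀.2| + 1` covers the time supports of `φ (· + w)` for all `w` in the unit
  -- ball around `w₀`.
  · refine ⟨fun z => b k * (heatKernel z * timeCutoff (R + |w₀.2| + 1) z.2),
      (integrable_heatKernel_mul_time (integrable_timeCutoff _)).const_mul _, ?_⟩
    filter_upwards [Metric.ball_mem_nhds w₀ one_pos] with w hw z
    rw [h2, norm_smul, Real.norm_of_nonneg (heatKernel_nonneg _)]
    have h3 : timeCutoff R (z + w).2 ≤ timeCutoff (R + |w₀.2| + 1) z.2 := by
      have h4 : |w.2 - w₀.2| < 1 := (norm_snd_le (w - w₀)).trans_lt (by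
        simpa [dist_eq_norm] using hw)
      rw [Prod.snd_add]
      by_cases hz : |z.2 + w.2| ≤ R
      · rw [timeCutoff_of_abs_le hz, timeCutoff_of_abs_le]
        have := abs_sub_abs_le_abs_sub w.2 w₀.2
        have := abs_sub_abs_le_abs_sub z.2 (-w.2)
        rw [abs_neg, sub_neg_eq_add] at this
        linarith
      · have : timeCutoff R (z.2 + w.2) = 0 :=
          indicator_of_notMem (s := Icc (-R) R) (fun h => hz (abs_le.2 h)) _
        rw [this]
        exact timeCutoff_nonneg _ _
    calc heatKernel z * ‖iteratedFDeriv ℝ k φ (z + w)‖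
        ≤ heatKernel z * (b k * timeCutoff (R + |w₀.2| + 1) z.2) := by
          refine mul_le_mul_of_nonneg_left ((hbR k _).trans ?_) (heatKernel_nonneg _)
          exact mul_le_mul_of_nonneg_left h3 (hb.nonneg k)
      _ = _ := by ring

theorem iteratedFDeriv_backwardPotential {φ : SpaceTime n → ℝ} (hφ : IsTest φ) (k : ℕ)
    (w : SpaceTime n) : iteratedFDeriv ℝ k (backwardPotential φ) w =
      ∫ z, heatKernel z • iteratedFDeriv ℝ k φ (z + w) := by
  obtain ⟨h1, h2, h3, h4⟩ := heatKernel_aux hφ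
  have := iteratedFDeriv_integral h1 h3 h4 k w
  simp_rw [h2] at this
  exact this

/-- The potential need not have compact support, but each derivative integrates the kernel over a
time strip of length `2 * R`, and each slice has mass at most one. -/
theorem smoothBounded_backwardPotential {φ : SpaceTime n → ℝ} (hφ : IsTest φ) :
    ∃ b, SmoothBounded (backwardPotential φ) b := by
  obtain ⟨h1, h2, h3, h4⟩ := heatKernel_aux hφ
  obtain ⟨b, R, hR, hb, hbR⟩ := hφ.exists_bound
  refine ⟨fun k => b k * (2 * R), contDiff_integral h1 h3 h4, fun k w => ?_⟩
  have hi : Integrable fun t => timeCutoff R (t + w.2) := (integrable_timeCutoff R).comp_add_right _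
  rw [iteratedFDeriv_backwardPotential hφ, ← integral_timeCutoff hR w.2]
  calc ‖∫ z, heatKernel z • iteratedFDeriv ℝ k φ (z + w)‖
      ≤ ∫ z : SpaceTime n, b k * (heatKernel z * timeCutoff R (z.2 + w.2)) := by
        refine norm_integral_le_of_norm_le
          ((integrable_heatKernel_mul_time hi).const_mul _) (Eventually.of_forall fun z => ?_)
        rw [norm_smul, Real.norm_of_nonneg (heatKernel_nonneg _)]
        exact (mul_le_mul_of_nonneg_left (hbR k (z + w)) (heatKernel_nonneg _)).trans_eq
          (by simp only [Prod.snd_add]; ring)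
    _ ≤ _ := by
        rw [integral_const_mul]
        exact mul_le_mul_of_nonneg_left
          (integral_heatKernel_mul_time_le hi fun _ => timeCutoff_nonneg _ _) (hb.nonneg k)

theorem fderiv_backwardPotential {φ : SpaceTime n → ℝ} (hφ : IsTest φ) (w v : SpaceTime n) :
    fderiv ℝ (backwardPotential φ) w v = backwardPotential (fun z => fderiv ℝ φ z v) w := by
  have h := congrArg (fun L => L fun _ => v) (iteratedFDeriv_backwardPotential hφ 1 w)
  simp only [iteratedFDeriv_one_apply] at h
  rw [h, ContinuousMultilinearMap.integral_apply]
  · simp [backwardPotential, iteratedFDeriv_one_apply]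
  · obtain ⟨h1, h2, h3, h4⟩ := heatKernel_aux hφ
    obtain ⟨c, hc, hb⟩ := h4 1 w
    exact hc.mono' (by simpa only [h2] using h3 1 w)
      (Eventually.of_forall fun z => by simpa only [h2] using hb.self_of_nhds z)

theorem IsTest.fderiv_apply {φ : SpaceTime n → ℝ} (hφ : IsTest φ) (v : SpaceTime n) :
    IsTest fun z => fderiv ℝ φ z v :=
  ⟨(hφ.contDiff.fderiv_right (by exact_mod_cast le_top)).clm_apply contDiff_const,
    hφ.hasCompactSupport.fderiv_apply ℝ v⟩

theorem IsTest.continuous {φ : SpaceTime n → ℝ} (hφ : IsTest φ) : Continuous φ :=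
  hφ.contDiff.continuous

end ParabolicHeat

namespace ParabolicHeat

variable {n : ℕ}

/-- The unit vector in the time direction. -/
def timeVec : SpaceTime n := (0, 1)

theorem norm_timeVec_le : ‖(timeVec : SpaceTime n)‖ ≤ 1 := by
  simp [timeVec, Prod.norm_def]

/-- The potential commutes with difference operators in time. -/
theorem backwardPotential_diffInt {κ : ℝ → ℝ} (hκ : DiffKernel κ) {φ : SpaceTime n → ℝ}
    (hφ : IsTest φ) (w : SpaceTime n) :
    backwardPotential (diffInt timeVec κ φ) w = diffInt timeVec κ (backwardPotential φ) w := by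
  obtain ⟨b, R, hR, hb, hbR⟩ := hφ.exists_bound
  have hφ0 : ∀ z, |φ z| ≤ b 0 * timeCutoff R z.2 := fun z => by simpa using hbR 0 z
  let c : ℝ := 2 * (b 0 + b 1)
  have hc : 0 ≤ c := by
    have := hb.nonneg 0
    have := hb.nonneg 1
    positivity
  let F : SpaceTime n × ℝ → ℝ := fun p =>
    heatKernel p.1 * (κ p.2 * (φ (p.1 + w + p.2 • timeVec) - φ (p.1 + w)))
  have hcont := hφ.continuous
  have hFm : Measurable F := by
    refine (measurable_heatKernel.comp measurable_fst).mul
      ((hκ.measurable.comp measurable_snd).mul (Continuous.measurable ?_))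
    fun_prop
  have hi : ∀ s, Integrable fun t => timeCutoff R (t + s) :=
    fun s => (integrable_timeCutoff R).comp_add_right s
  -- Majorant for Fubini: the weight `|κ(s)| min(1, |s|)` times the heat kernel, restricted to the
  -- two time strips where one of the two values of `φ` can be nonzero.
  have hFb : ∀ z s, ‖F (z, s)‖ ≤ c * ‖κ s * min 1 |s|‖ *
      (heatKernel z * (timeCutoff R (z.2 + (w.2 + s)) + timeCutoff R (z.2 + w.2))) := by
    intro z s
    have hd : |φ (z + w + s • timeVec) - φ (z + w)| ≤ c * min 1 |s| *
        (timeCutoff R (z.2 + (w.2 + s)) + timeCutoff R (z.2 + w.2)) := by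
      have h1 := hb.diff_abs_le norm_timeVec_le s (z + w)
      have e1 : (z + w + s • timeVec).2 = z.2 + (w.2 + s) := by
        simp [timeVec, add_assoc]
      have h2 := hφ0 (z + w + s • timeVec)
      have h3 := hφ0 (z + w)
      rw [e1] at h2
      rw [Prod.snd_add] at h3
      have hm : 0 ≤ c * min 1 |s| := by positivity
      by_cases hz : |z.2 + (w.2 + s)| ≤ R
      · rw [timeCutoff_of_abs_le hz]
        exact h1.trans (le_mul_of_one_le_right hm (by linarith [timeCutoff_nonneg R (z.2 + w.2)]))
      · by_cases hz' : |z.2 + w.2| ≤ R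
        · rw [timeCutoff_of_abs_le hz']
          exact h1.trans (le_mul_of_one_le_right hm
            (by linarith [timeCutoff_nonneg R (z.2 + (w.2 + s))]))
        · have e2 : timeCutoff R (z.2 + (w.2 + s)) = 0 :=
            indicator_of_notMem (s := Icc (-R) R) (fun h => hz (abs_le.2 h)) _
          have e3 : timeCutoff R (z.2 + w.2) = 0 :=
            indicator_of_notMem (s := Icc (-R) R) (fun h => hz' (abs_le.2 h)) _
          rw [e2, mul_zero] at h2
          rw [e3, mul_zero] at h3
          rw [abs_nonpos_iff.1 h2, abs_nonpos_iff.1 h3, e2, e3]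
          simp
    simp only [F]
    rw [norm_mul, norm_mul, norm_mul, Real.norm_of_nonneg (heatKernel_nonneg z),
      Real.norm_of_nonneg (by positivity : 0 ≤ min 1 |s|)]
    calc heatKernel z * (‖κ s‖ * |φ (z + w + s • timeVec) - φ (z + w)|)
        ≤ heatKernel z * (‖κ s‖ * (c * min 1 |s| *
          (timeCutoff R (z.2 + (w.2 + s)) + timeCutoff R (z.2 + w.2)))) := by
          have := heatKernel_nonneg z
          gcongr
      _ = _ := by ring
  have hdom : ∀ s, Integrable fun z : SpaceTime n => c * ‖κ s * min 1 |s|‖ *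
      (heatKernel z * (timeCutoff R (z.2 + (w.2 + s)) + timeCutoff R (z.2 + w.2))) := fun s =>
    (integrable_heatKernel_mul_time ((hi (w.2 + s)).add (hi w.2))).const_mul _
  have hF : Integrable F (volume.prod volume) := by
    rw [integrable_prod_iff' hFm.aestronglyMeasurable]
    refine ⟨Eventually.of_forall fun s => (hdom s).mono'
      (hFm.comp (measurable_id.prodMk measurable_const)).aestronglyMeasurable
      (Eventually.of_forall fun z => hFb z s), ?_⟩
    refine (hκ.integrable.norm.const_mul (c * (4 * R))).mono'
      hFm.aestronglyMeasurable.norm.prod_swap.integral_prod_right' (Eventually.of_forall fun s => ?_)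
    rw [Real.norm_of_nonneg (integral_nonneg fun _ => norm_nonneg _)]
    calc ∫ z, ‖F (z, s)‖ ≤ ∫ z : SpaceTime n, c * ‖κ s * min 1 |s|‖ *
          (heatKernel z * (timeCutoff R (z.2 + (w.2 + s)) + timeCutoff R (z.2 + w.2))) :=
          integral_mono_of_nonneg (Eventually.of_forall fun _ => norm_nonneg _) (hdom s)
            (Eventually.of_forall fun z => hFb z s)
      _ ≤ c * ‖κ s * min 1 |s|‖ * (4 * R) := by
          rw [integral_const_mul]
          refine mul_le_mul_of_nonneg_left ?_ (by positivity)
          refine (integral_heatKernel_mul_time_le ((hi (w.2 + s)).add (hi w.2)) fun t =>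
            add_nonneg (timeCutoff_nonneg _ _) (timeCutoff_nonneg _ _)).trans_eq ?_
          have := integral_add (hi (w.2 + s)) (hi w.2)
          refine this.trans ?_
          rw [integral_timeCutoff hR, integral_timeCutoff hR]
          ring
      _ = _ := by ring
  have hint : ∀ w, Integrable fun z => heatKernel z * φ (z + w) := by
    intro w
    obtain ⟨-, h2, h3, h4⟩ := heatKernel_aux hφ
    refine ((integrable_heatKernel_mul_time (n := n) (hi w.2)).const_mul (b 0)).mono' ?_
      (Eventually.of_forall fun z => ?_)
    · exact measurable_heatKernel.aestronglyMeasurable.mul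
        (by fun_prop : Continuous fun z => φ (z + w)).aestronglyMeasurable
    · rw [norm_mul, Real.norm_of_nonneg (heatKernel_nonneg _)]
      exact (mul_le_mul_of_nonneg_left (hφ0 (z + w)) (heatKernel_nonneg _)).trans_eq
        (by simp only [Prod.snd_add]; ring)
  calc backwardPotential (diffInt timeVec κ φ) w = ∫ z, ∫ s, F (z, s) := by
        unfold backwardPotential
        congr 1 with z
        rw [diffInt, ← integral_const_mul]
    _ = ∫ s, ∫ z, F (z, s) := integral_integral_swap hF
    _ = diffInt timeVec κ (backwardPotential φ) w := by
        rw [diffInt]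
        congr 1 with s
        unfold backwardPotential
        rw [← integral_sub (hint _) (hint _), ← integral_const_mul]
        congr 1 with z
        simp only [F, add_assoc]
        ring

/-! ### The heat kernel is a fundamental solution -/

/-- The first moment controls the terms with a factor `ξ` that appear when averages in self-similar
variables are differentiated in time. -/
theorem integrable_norm_mul_heatKernel_one :
    Integrable fun x : EuclideanSpace ℝ (Fin n) => ‖x‖ * heatKernel (x, 1) := by
  have h : ∀ x : EuclideanSpace ℝ (Fin n), heatKernel (x, 1) =
      1 / (4 * Real.pi * 1) ^ ((n : ℝ) / 2) * Real.exp (-(1 / (4 * 1)) * ‖x‖ ^ 2) :=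
    fun x => heatKernel_of_pos x one_pos
  refine (((integrable_exp_neg_mul_norm_sq (n := n) (b := 1 / 8) (by norm_num)).const_mul
    (1 / (4 * Real.pi * 1) ^ ((n : ℝ) / 2))).const_mul 8).mono' ?_ (Eventually.of_forall fun x => ?_)
  · exact continuous_norm.aestronglyMeasurable.mul
      (integrable_heatKernel_slice (n := n) 1).aestronglyMeasurable
  · rw [norm_mul, norm_norm, Real.norm_of_nonneg (heatKernel_nonneg _), h]
    have h1 : ‖x‖ ≤ 8 * Real.exp (1 / 8 * ‖x‖ ^ 2) := by
      have := Real.add_one_le_exp (1 / 8 * ‖x‖ ^ 2)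
      nlinarith [sq_nonneg (‖x‖ - 4)]
    -- The Gaussian is split into two equal factors: one absorbs `‖x‖`, the other remains
    -- integrable.
    have h2 : Real.exp (-(1 / (4 * 1)) * ‖x‖ ^ 2) =
        Real.exp (-(1 / 8) * ‖x‖ ^ 2) * Real.exp (-(1 / 8) * ‖x‖ ^ 2) := by
      rw [← Real.exp_add]
      congr 1
      ring
    have h3 : Real.exp (1 / 8 * ‖x‖ ^ 2) * Real.exp (-(1 / 8) * ‖x‖ ^ 2) = 1 := by
      rw [← Real.exp_add]
      simp
    rw [h2]
    set k := 1 / (4 * Real.pi * 1) ^ ((n : ℝ) / 2)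
    have hk : 0 ≤ k := by positivity
    set q := Real.exp (-(1 / 8) * ‖x‖ ^ 2)
    have hq : 0 ≤ q := (Real.exp_pos _).le
    calc ‖x‖ * (k * (q * q)) ≤ (8 * Real.exp (1 / 8 * ‖x‖ ^ 2)) * (k * (q * q)) := by gcongr
      _ = 8 * (k * q) * (Real.exp (1 / 8 * ‖x‖ ^ 2) * q) := by ring
      _ = 8 * (k * q) := by rw [h3, mul_one]

/-- The slice integral of the heat kernel, in self-similar variables. -/
theorem integral_heatKernel_slice_mul {t : ℝ} (ht : 0 < t) (g : EuclideanSpace ℝ (Fin n) → ℝ) :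
    ∫ x, heatKernel (x, t) * g x = ∫ ξ, heatKernel (ξ, 1) * g (√t • ξ) := by
  have hs : 0 < √t := Real.sqrt_pos.2 ht
  have h := Measure.integral_comp_smul volume (fun x : EuclideanSpace ℝ (Fin n) =>
    heatKernel (x, t) * g x) (√t)
  have h1 : ∀ ξ : EuclideanSpace ℝ (Fin n),
      heatKernel (√t • ξ, t) = (√t ^ n)⁻¹ * heatKernel (ξ, 1) := by
    intro ξ
    rw [heatKernel_of_pos _ ht, heatKernel_of_pos _ one_pos, norm_smul, Real.norm_of_nonneg hs.le,
      mul_pow, Real.sq_sqrt ht.le]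
    have e1 : -(1 / (4 * t)) * (t * ‖ξ‖ ^ 2) = -(1 / (4 * 1)) * ‖ξ‖ ^ 2 := by
      field_simp
    have e2 : (4 * Real.pi * t) ^ ((n : ℝ) / 2) = √t ^ n * (4 * Real.pi * 1) ^ ((n : ℝ) / 2) := by
      rw [mul_one, Real.mul_rpow (by positivity) ht.le, Real.sqrt_eq_rpow, ← Real.rpow_natCast,
        ← Real.rpow_mul ht.le, mul_comm]
      congr 2
      ring
    rw [e1, e2, one_div, mul_inv, one_div]
    ring
  simp_rw [h1, mul_assoc] at h
  rw [integral_const_mul, finrank_euclideanSpace_fin, abs_of_pos (by positivity), smul_eq_mul] at h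
  exact (mul_left_cancel₀ (by positivity) h).symm

/-- Gaussian integration by parts. -/
theorem integral_heatKernel_one_mul_coord {g : EuclideanSpace ℝ (Fin n) → ℝ}
    (hg : ContDiff ℝ 1 g) {M M' : ℝ} (hM : ∀ x, |g x| ≤ M) (hM' : ∀ x, ‖fderiv ℝ g x‖ ≤ M')
    (i : Fin n) :
    ∫ ξ, heatKernel (ξ, 1) * (ξ i * g ξ) =
      2 * ∫ ξ, heatKernel (ξ, 1) * fderiv ℝ g ξ (EuclideanSpace.single i 1) := by
  let γ : EuclideanSpace ℝ (Fin n) → ℝ := fun ξ => heatKernel (ξ, 1)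
  have hγi : Integrable γ := integrable_heatKernel_slice 1
  have hγd : ∀ ξ, HasFDerivAt γ ((-(1 / 2) : ℝ) • γ ξ • innerSL ℝ ξ) ξ := by
    intro ξ
    have hγ : γ = fun ξ => 1 / (4 * Real.pi * 1) ^ ((n : ℝ) / 2) *
        Real.exp (-(1 / (4 * 1)) * ‖ξ‖ ^ 2) := by
      ext ξ
      exact heatKernel_of_pos ξ one_pos
    have h1 := (((hasStrictFDerivAt_norm_sq ξ).hasFDerivAt.const_mul
      (-(1 / (4 * 1)) : ℝ)).exp).const_mul (1 / (4 * Real.pi * 1) ^ ((n : ℝ) / 2))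
    rw [hγ]
    refine h1.congr_fderiv ?_
    ext v
    simp
    ring
  -- The relation `∂ᵢγ = -ξᵢγ/2` for this normalization is the origin of the factor `2`.
  have hd : ∀ ξ, fderiv ℝ γ ξ (EuclideanSpace.single i 1) = -(1 / 2) * (γ ξ * ξ i) := by
    intro ξ
    rw [(hγd ξ).fderiv]
    simp [EuclideanSpace.inner_single_right]
  have hcoord : ∀ ξ : EuclideanSpace ℝ (Fin n), |ξ i| ≤ ‖ξ‖ := fun ξ => by
    simpa using EuclideanSpace.norm_eq ξ ▸ PiLp.norm_apply_le ξ i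
  have hγm : AEStronglyMeasurable γ := hγi.aestronglyMeasurable
  have i1 : Integrable fun ξ => γ ξ * g ξ :=
    (hγi.norm.mul_const M).mono' (hγm.mul hg.continuous.aestronglyMeasurable)
      (Eventually.of_forall fun ξ => by
        rw [norm_mul]
        exact mul_le_mul_of_nonneg_left (hM ξ) (norm_nonneg _))
  have i2 : Integrable fun ξ => γ ξ * fderiv ℝ g ξ (EuclideanSpace.single i 1) :=
    (hγi.norm.mul_const M').mono' (hγm.mul
      ((hg.continuous_fderiv one_ne_zero).clm_apply continuous_const).aestronglyMeasurable)
      (Eventually.of_forall fun ξ => by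
        rw [norm_mul]
        refine mul_le_mul_of_nonneg_left ?_ (norm_nonneg _)
        refine ((fderiv ℝ g ξ).le_opNorm _).trans ?_
        simpa using hM' ξ)
  have i3 : Integrable fun ξ => fderiv ℝ γ ξ (EuclideanSpace.single i 1) * g ξ := by
    refine (integrable_norm_mul_heatKernel_one.mul_const M).mono' ?_
      (Eventually.of_forall fun ξ => ?_)
    · simp_rw [hd]
      exact ((hγm.mul (by fun_prop : Continuous fun ξ : EuclideanSpace ℝ (Fin n) =>
        ξ i).aestronglyMeasurable).const_mul _).mul hg.continuous.aestronglyMeasurable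
    · have h0 : 0 ≤ γ ξ := heatKernel_nonneg _
      rw [hd, norm_mul, norm_mul, norm_mul, Real.norm_of_nonneg h0]
      calc ‖(-(1 / 2) : ℝ)‖ * (γ ξ * ‖ξ i‖) * ‖g ξ‖ ≤ 1 * (γ ξ * ‖ξ‖) * M := by
            have := hcoord ξ
            have := hM ξ
            simp only [Real.norm_eq_abs]
            gcongr
            rw [abs_of_neg] <;> norm_num
        _ = ‖ξ‖ * heatKernel (ξ, 1) * M := by
            simp only [γ]
            ring
  have key := integral_mul_fderiv_eq_neg_fderiv_mul_of_integrable i3 i2 i1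
    (fun ξ _ => (hγd ξ).differentiableAt) (fun ξ _ => hg.differentiable one_ne_zero ξ)
  have e1 : ∫ ξ, heatKernel (ξ, 1) * fderiv ℝ g ξ (EuclideanSpace.single i 1) =
      ∫ ξ, γ ξ * fderiv ℝ g ξ (EuclideanSpace.single i 1) := rfl
  rw [e1, key, ← integral_neg, ← integral_const_mul]
  congr 1 with ξ
  rw [hd]
  simp only [γ]
  ring

end ParabolicHeat

namespace ParabolicHeat

variable {n : ℕ}

theorem contDiff_slice {φ : SpaceTime n → ℝ} (hφ : ContDiff ℝ (⊤ : ℕ∞) φ) (c t : ℝ) :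
    ContDiff ℝ 1 fun ξ : EuclideanSpace ℝ (Fin n) => φ (c • ξ, t) := by
  have : ContDiff ℝ 1 φ := hφ.of_le (by exact_mod_cast le_top)
  fun_prop

theorem fderiv_slice {φ : SpaceTime n → ℝ} (hφ : ContDiff ℝ (⊤ : ℕ∞) φ) (c t : ℝ)
    (ξ v : EuclideanSpace ℝ (Fin n)) :
    fderiv ℝ (fun ξ : EuclideanSpace ℝ (Fin n) => φ (c • ξ, t)) ξ v =
      c * fderiv ℝ φ (c • ξ, t) (v, 0) := by
  have h1 : HasFDerivAt (fun ξ : EuclideanSpace ℝ (Fin n) => (c • ξ, t))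
      ((c • ContinuousLinearMap.id ℝ _).prod 0) ξ :=
    ((hasFDerivAt_id ξ).const_smul c).prodMk (hasFDerivAt_const t ξ)
  have h2 := ((hφ.differentiable (by simp)) (c • ξ, t)).hasFDerivAt.comp ξ h1
  have h3 := h2.fderiv
  change fderiv ℝ (fun ξ : EuclideanSpace ℝ (Fin n) => φ (c • ξ, t)) ξ = _ at h3
  rw [h3]
  have h4 : ((c • v, 0) : SpaceTime n) = c • (v, 0) := by simp
  have h5 : ((c • ContinuousLinearMap.id ℝ (EuclideanSpace ℝ (Fin n))).prod
      (0 : EuclideanSpace ℝ (Fin n) →L[ℝ] ℝ)) v = c • ((v, 0) : SpaceTime n) := by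
    rw [← h4]
    rfl
  rw [ContinuousLinearMap.comp_apply, h5, map_smul, smul_eq_mul]

/-- Slice averages of a test function against the heat kernel. -/
noncomputable def heatAverage (φ : SpaceTime n → ℝ) (t : ℝ) : ℝ :=
  ∫ ξ : EuclideanSpace ℝ (Fin n), heatKernel (ξ, 1) * φ (√t • ξ, t)

theorem norm_spaceVec_le (i : Fin n) :
    ‖((EuclideanSpace.single i 1, 0) : SpaceTime n)‖ ≤ 1 := by
  simp [Prod.norm_def]

/-- In self-similar variables the time derivative falls only on `φ` and gives `∂ₜφ + (2√t)⁻¹ ξ·∇φ`.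
Gaussian integration by parts in `ξ` contributes a factor `2√t` and turns the second term into `Δφ`.
-/
theorem hasDerivAt_heatAverage {φ : SpaceTime n → ℝ} (hφ : IsTest φ) {t : ℝ} (ht : 0 < t) :
    HasDerivAt (heatAverage φ) (heatAverage (fun z => fderiv ℝ φ z timeVec +
      ∑ i, spaceDeriv i (spaceDeriv i φ) z) t) t := by
  obtain ⟨b, hb⟩ := exists_smoothBounded hφ.contDiff hφ.hasCompactSupport
  have hnf : ∀ z, ‖fderiv ℝ φ z‖ ≤ b 1 := fun z => by
    rw [← norm_iteratedFDeriv_one]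
    exact hb.bound 1 z
  have hb1 := hb.nonneg 1
  have hγi : Integrable fun ξ : EuclideanSpace ℝ (Fin n) => heatKernel (ξ, 1) :=
    integrable_heatKernel_slice 1
  have hcont := hφ.continuous
  have hcont' : Continuous (fderiv ℝ φ) := hφ.contDiff.continuous_fderiv (by simp)
  let F' : ℝ → EuclideanSpace ℝ (Fin n) → ℝ := fun s ξ =>
    heatKernel (ξ, 1) * fderiv ℝ φ (√s • ξ, s) ((1 / (2 * √s)) • ξ, 1)
  have hF : ∀ s, 0 < s → ∀ ξ : EuclideanSpace ℝ (Fin n),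
      HasDerivAt (fun s => heatKernel (ξ, 1) * φ (√s • ξ, s)) (F' s ξ) s := by
    intro s hs ξ
    have h1 : HasDerivAt (fun s : ℝ => ((√s • ξ, s) : SpaceTime n)) ((1 / (2 * √s)) • ξ, 1) s :=
      ((Real.hasDerivAt_sqrt hs.ne').smul_const ξ).prodMk (hasDerivAt_id s)
    exact (((hφ.contDiff.differentiable (by simp)) _).hasFDerivAt.comp_hasDerivAt s h1).const_mul _
  have hint : ∀ s, Integrable fun ξ : EuclideanSpace ℝ (Fin n) =>
      heatKernel (ξ, 1) * φ (√s • ξ, s) := by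
    intro s
    refine (hγi.norm.mul_const (b 0)).mono' (hγi.aestronglyMeasurable.mul
      (by fun_prop : Continuous fun ξ : EuclideanSpace ℝ (Fin n) =>
        φ (√s • ξ, s)).aestronglyMeasurable) (Eventually.of_forall fun ξ => ?_)
    rw [norm_mul]
    exact mul_le_mul_of_nonneg_left (hb.abs_le _) (norm_nonneg _)
  -- Staying above `t / 2` keeps the factor `1 / √s` bounded, as domination requires.
  have hmem : Ioi (t / 2) ∈ 𝓝 t := Ioi_mem_nhds (by linarith)
  have hder := hasDerivAt_integral_of_dominated_loc_of_deriv_le (μ := volume)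
    (F := fun s (ξ : EuclideanSpace ℝ (Fin n)) => heatKernel (ξ, 1) * φ (√s • ξ, s))
    (F' := F') (bound := fun ξ => b 1 * ((1 / (2 * √(t / 2))) * (‖ξ‖ * heatKernel (ξ, 1)) +
      heatKernel (ξ, 1))) hmem
    (Eventually.of_forall fun s => (hint s).aestronglyMeasurable) (hint t)
    (hγi.aestronglyMeasurable.mul (by fun_prop : Continuous fun ξ : EuclideanSpace ℝ (Fin n) =>
      fderiv ℝ φ (√t • ξ, t) ((1 / (2 * √t)) • ξ, 1)).aestronglyMeasurable)
    (Eventually.of_forall fun ξ s hs => ?_)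
    (((integrable_norm_mul_heatKernel_one.const_mul _).add hγi).const_mul _)
    (Eventually.of_forall fun ξ s hs => hF s (lt_trans (by positivity) hs) ξ)
  · refine hder.2.congr_deriv ?_
    have hlin : ∀ ξ : EuclideanSpace ℝ (Fin n), F' t ξ =
        heatKernel (ξ, 1) * fderiv ℝ φ (√t • ξ, t) timeVec +
        ∑ i, (1 / (2 * √t)) * (heatKernel (ξ, 1) * (ξ i * spaceDeriv i φ (√t • ξ, t))) := by
      intro ξ
      have e1 : (((1 / (2 * √t)) • ξ, 1) : SpaceTime n) = timeVec +
          ∑ i, ((1 / (2 * √t)) * ξ i) • ((EuclideanSpace.single i 1, 0) : SpaceTime n) := by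
        have e2 : ξ = ∑ i, ξ i • EuclideanSpace.single i (1 : ℝ) := by
          ext j
          simp [Finset.sum_apply, Pi.single_apply]
        refine Prod.ext ?_ ?_
        · rw [Prod.fst_add, Prod.fst_sum]
          simp only [timeVec, Prod.smul_mk, zero_add, mul_smul]
          rw [← Finset.smul_sum, ← e2]
        · simp [timeVec, Prod.snd_sum]
      simp only [F']
      rw [e1, map_add, map_sum, mul_add, Finset.mul_sum]
      congr 1
      refine Finset.sum_congr rfl fun i _ => ?_
      rw [map_smul, smul_eq_mul]
      simp only [spaceDeriv]
      ring
    have hsd : ∀ i, SmoothBounded (spaceDeriv i φ) fun k => b (k + 1) := fun i =>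
      hb.fderiv_apply (norm_spaceVec_le i)
    have hsdd : ∀ i, SmoothBounded (spaceDeriv i (spaceDeriv i φ)) fun k => b (k + 1 + 1) :=
      fun i => (hsd i).fderiv_apply (norm_spaceVec_le i)
    have ht' : 0 < √t := Real.sqrt_pos.2 ht
    have hIBP : ∀ i, ∫ ξ : EuclideanSpace ℝ (Fin n),
        heatKernel (ξ, 1) * (ξ i * spaceDeriv i φ (√t • ξ, t)) =
        2 * √t * ∫ ξ, heatKernel (ξ, 1) * spaceDeriv i (spaceDeriv i φ) (√t • ξ, t) := by
      intro i
      have hM' : ∀ ξ : EuclideanSpace ℝ (Fin n),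
          ‖fderiv ℝ (fun ξ : EuclideanSpace ℝ (Fin n) => spaceDeriv i φ (√t • ξ, t)) ξ‖ ≤
          √t * b 2 := by
        intro ξ
        refine ContinuousLinearMap.opNorm_le_bound _ (mul_nonneg ht'.le (hb.nonneg 2)) fun v => ?_
        rw [fderiv_slice (hsd i).contDiff, norm_mul, Real.norm_of_nonneg ht'.le, mul_assoc]
        refine mul_le_mul_of_nonneg_left ?_ ht'.le
        refine ((fderiv ℝ (spaceDeriv i φ) _).le_opNorm _).trans ?_
        have h1 : ‖fderiv ℝ (spaceDeriv i φ) (√t • ξ, t)‖ ≤ b 2 := by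
          rw [← norm_iteratedFDeriv_one]
          exact (hsd i).bound 1 _
        have h2 : ‖((v, 0) : SpaceTime n)‖ = ‖v‖ := by simp [Prod.norm_def]
        rw [h2]
        exact mul_le_mul_of_nonneg_right h1 (norm_nonneg _)
      have := integral_heatKernel_one_mul_coord (contDiff_slice (hsd i).contDiff (√t) t)
        (fun ξ => (hsd i).abs_le _) hM' i
      rw [this, mul_assoc, ← integral_const_mul (√t)]
      congr 2 with ξ
      rw [fderiv_slice (hsd i).contDiff]
      simp only [spaceDeriv]
      ring
    have hbi : ∀ {u : SpaceTime n → ℝ} {c : ℕ → ℝ}, SmoothBounded u c →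
        Integrable fun ξ : EuclideanSpace ℝ (Fin n) => heatKernel (ξ, 1) * u (√t • ξ, t) := by
      intro u c hu
      have := hu.contDiff.continuous
      refine (hγi.norm.mul_const (c 0)).mono' (hγi.aestronglyMeasurable.mul
        (by fun_prop : Continuous fun ξ : EuclideanSpace ℝ (Fin n) =>
          u (√t • ξ, t)).aestronglyMeasurable) (Eventually.of_forall fun ξ => ?_)
      rw [norm_mul]
      exact mul_le_mul_of_nonneg_left (hu.abs_le _) (norm_nonneg _)
    have hci : ∀ i, Integrable fun ξ : EuclideanSpace ℝ (Fin n) =>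
        (1 / (2 * √t)) * (heatKernel (ξ, 1) * (ξ i * spaceDeriv i φ (√t • ξ, t))) := by
      intro i
      have := (hsd i).contDiff.continuous
      refine Integrable.const_mul ((integrable_norm_mul_heatKernel_one.mul_const (b 1)).mono'
        (hγi.aestronglyMeasurable.mul (by fun_prop : Continuous fun ξ : EuclideanSpace ℝ (Fin n) =>
          ξ i * spaceDeriv i φ (√t • ξ, t)).aestronglyMeasurable)
        (Eventually.of_forall fun ξ => ?_)) _
      rw [Pi.mul_apply, norm_mul, norm_mul, Real.norm_of_nonneg (heatKernel_nonneg _)]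
      have h1 : ‖ξ i‖ ≤ ‖ξ‖ := PiLp.norm_apply_le ξ i
      have h2 : ‖spaceDeriv i φ (√t • ξ, t)‖ ≤ b 1 := (hsd i).abs_le _
      have h3 : 0 ≤ heatKernel ((ξ, 1) : SpaceTime n) := heatKernel_nonneg _
      calc heatKernel (ξ, 1) * (‖ξ i‖ * ‖spaceDeriv i φ (√t • ξ, t)‖)
          ≤ heatKernel (ξ, 1) * (‖ξ‖ * b 1) := by gcongr
        _ = _ := by ring
    simp_rw [hlin]
    rw [integral_add (hbi (hb.fderiv_apply norm_timeVec_le))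
      (integrable_finsetSum _ fun i _ => hci i), integral_finsetSum _ fun i _ => hci i]
    simp_rw [integral_const_mul, hIBP]
    unfold heatAverage
    simp_rw [mul_add, Finset.mul_sum]
    rw [integral_add (hbi (hb.fderiv_apply norm_timeVec_le))
      (integrable_finsetSum _ fun i _ => hbi (hsdd i)),
      integral_finsetSum _ fun i _ => hbi (hsdd i)]
    congr 1
    refine Finset.sum_congr rfl fun i _ => ?_
    field_simp
  · have hs' : 0 < t / 2 := by positivity
    have hs2 : t / 2 < s := hs
    have h0 : 0 ≤ heatKernel ((ξ, 1) : SpaceTime n) := heatKernel_nonneg _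
    simp only [F']
    rw [norm_mul, Real.norm_of_nonneg h0]
    have h1 : ‖(((1 / (2 * √s)) • ξ, 1) : SpaceTime n)‖ ≤ 1 / (2 * √(t / 2)) * ‖ξ‖ + 1 := by
      rw [Prod.norm_def, norm_one, norm_smul, Real.norm_of_nonneg (by positivity)]
      refine max_le ?_ (by linarith [show 0 ≤ 1 / (2 * √(t / 2)) * ‖ξ‖ by positivity])
      have : 1 / (2 * √s) * ‖ξ‖ ≤ 1 / (2 * √(t / 2)) * ‖ξ‖ := by
        have := Real.sqrt_pos.2 hs'
        gcongr
      linarith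
    calc heatKernel (ξ, 1) * ‖fderiv ℝ φ (√s • ξ, s) ((1 / (2 * √s)) • ξ, 1)‖
        ≤ heatKernel (ξ, 1) * (b 1 * (1 / (2 * √(t / 2)) * ‖ξ‖ + 1)) := by
          refine mul_le_mul_of_nonneg_left ?_ h0
          refine ((fderiv ℝ φ _).le_opNorm _).trans ?_
          exact mul_le_mul (hnf _) h1 (norm_nonneg _) hb1
      _ = _ := by ring

/-- Continuity up to `t = 0`, with the value in `heatAverage_zero`, takes the place of an
approximate identity argument for the kernel at time zero. -/
theorem continuous_heatAverage {φ : SpaceTime n → ℝ} (hφ : IsTest φ) :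
    Continuous (heatAverage φ) := by
  obtain ⟨b, hb⟩ := exists_smoothBounded hφ.contDiff hφ.hasCompactSupport
  have hγi : Integrable fun ξ : EuclideanSpace ℝ (Fin n) => heatKernel (ξ, 1) :=
    integrable_heatKernel_slice 1
  have hcont := hφ.continuous
  refine continuous_of_dominated (bound := fun ξ => ‖heatKernel (ξ, 1)‖ * b 0) (fun t => ?_)
    (fun t => Eventually.of_forall fun ξ => ?_) (hγi.norm.mul_const _)
    (Eventually.of_forall fun ξ => ?_)
  · exact hγi.aestronglyMeasurable.mul (by fun_prop : Continuous fun ξ :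
      EuclideanSpace ℝ (Fin n) => φ (√t • ξ, t)).aestronglyMeasurable
  · rw [norm_mul]
    exact mul_le_mul_of_nonneg_left (hb.abs_le _) (norm_nonneg _)
  · fun_prop

theorem heatAverage_zero (φ : SpaceTime n → ℝ) : heatAverage φ 0 = φ 0 := by
  unfold heatAverage
  simp only [Real.sqrt_zero, zero_smul]
  rw [integral_mul_const, integral_heatKernel_slice one_pos, one_mul]
  rfl

theorem integrable_heatKernel_mul {ψ : SpaceTime n → ℝ} (hψ : IsTest ψ) :
    Integrable fun z => heatKernel z * ψ z := by
  obtain ⟨b, R, hR, hb, hbR⟩ := hψ.exists_bound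
  refine ((integrable_heatKernel_mul_time (n := n) (integrable_timeCutoff R)).const_mul
    (b 0)).mono' (measurable_heatKernel.aestronglyMeasurable.mul
    hψ.continuous.aestronglyMeasurable) (Eventually.of_forall fun z => ?_)
  rw [norm_mul, Real.norm_of_nonneg (heatKernel_nonneg _)]
  refine (mul_le_mul_of_nonneg_left (by simpa using hbR 0 z) (heatKernel_nonneg _)).trans_eq ?_
  ring

theorem integral_heatKernel_mul {ψ : SpaceTime n → ℝ} (hψ : IsTest ψ) :
    IntegrableOn (heatAverage ψ) (Ioi 0) ∧
      ∫ z, heatKernel z * ψ z = ∫ t in Ioi 0, heatAverage ψ t := by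
  have hi : Integrable (fun z : SpaceTime n => heatKernel z * ψ z) (volume.prod volume) :=
    integrable_heatKernel_mul hψ
  have h1 : ∀ t ∈ Ioi (0 : ℝ), ∫ x, heatKernel (x, t) * ψ (x, t) = heatAverage ψ t := fun t ht =>
    integral_heatKernel_slice_mul ht fun x => ψ (x, t)
  refine ⟨hi.integral_prod_right.integrableOn.congr_fun h1 measurableSet_Ioi, ?_⟩
  rw [← setIntegral_congr_fun measurableSet_Ioi h1, setIntegral_eq_integral_of_forall_compl_eq_zero]
  · exact integral_prod_symm _ hi
  · intro t ht
    simp [heatKernel_of_nonpos _ (not_lt.1 ht)]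

theorem IsTest.comp_add_right {φ : SpaceTime n → ℝ} (hφ : IsTest φ) (w : SpaceTime n) :
    IsTest fun z => φ (z + w) := by
  refine ⟨?_, hφ.hasCompactSupport.comp_homeomorph (Homeomorph.addRight w)⟩
  have := hφ.contDiff
  fun_prop

theorem IsTest.add {φ ψ : SpaceTime n → ℝ} (hφ : IsTest φ) (hψ : IsTest ψ) :
    IsTest fun z => φ z + ψ z :=
  ⟨hφ.contDiff.add hψ.contDiff, hφ.hasCompactSupport.add hψ.hasCompactSupport⟩

theorem IsTest.sum {ι : Type*} (s : Finset ι) {φ : ι → SpaceTime n → ℝ} (hφ : ∀ i, IsTest (φ i)) :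
    IsTest fun z => ∑ i ∈ s, φ i z := by
  classical
  induction s using Finset.induction_on with
  | empty =>
    simp only [Finset.sum_empty]
    exact ⟨contDiff_const, HasCompactSupport.zero⟩
  | insert a s ha ih =>
    simp_rw [Finset.sum_insert ha]
    exact (hφ a).add ih

theorem IsTest.spaceDeriv {φ : SpaceTime n → ℝ} (hφ : IsTest φ) (i : Fin n) :
    IsTest (spaceDeriv i φ) :=
  hφ.fderiv_apply _

/-- The backward heat operator inverts the potential. -/
theorem backwardPotential_heat {φ : SpaceTime n → ℝ} (hφ : IsTest φ) (w : SpaceTime n) :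
    backwardPotential (fun z => fderiv ℝ φ z timeVec) w +
      ∑ i, backwardPotential (spaceDeriv i (spaceDeriv i φ)) w = -φ w := by
  have hφw := hφ.comp_add_right w
  have hψ : IsTest fun z => fderiv ℝ φ z timeVec + ∑ i, spaceDeriv i (spaceDeriv i φ) z :=
    (hφ.fderiv_apply _).add (IsTest.sum _ fun i => (hφ.spaceDeriv i).spaceDeriv i)
  have hshift : ∀ i : Fin n, ∀ f : SpaceTime n → ℝ, spaceDeriv i (fun z => f (z + w)) =
      fun z => spaceDeriv i f (z + w) := by
    intro i f
    ext z
    simp only [spaceDeriv, fderiv_comp_add_right]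
  have h0 : (fun z => fderiv ℝ (fun z => φ (z + w)) z timeVec +
      ∑ i, spaceDeriv i (spaceDeriv i fun z => φ (z + w)) z) =
      fun z => fderiv ℝ φ (z + w) timeVec + ∑ i, spaceDeriv i (spaceDeriv i φ) (z + w) := by
    ext z
    simp only [hshift, fderiv_comp_add_right]
  obtain ⟨h1, h2⟩ := integral_heatKernel_mul (hψ.comp_add_right w)
  have hlim : Tendsto (heatAverage fun z => φ (z + w)) atTop (𝓝 0) := by
    obtain ⟨b, R, hR, hb, hbR⟩ := hφw.exists_bound
    refine tendsto_const_nhds.congr' ?_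
    filter_upwards [eventually_gt_atTop R] with t ht
    unfold heatAverage
    have h3 : ∀ ξ : EuclideanSpace ℝ (Fin n), φ ((√t • ξ, t) + w) = 0 := by
      intro ξ
      have := hbR 0 (√t • ξ, t)
      have h4 : timeCutoff R t = 0 :=
        indicator_of_notMem (s := Icc (-R) R) (fun h => ht.not_ge h.2) _
      simpa [h4] using this
    simp [h3]
  -- The fundamental theorem of calculus on `(0, ∞)`: the averages vanish once `t` is beyond the
  -- time support, so only the value at `t = 0` remains, which is `φ w`.
  have hFTC := integral_Ioi_of_hasDerivAt_of_tendsto (a := 0)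
    (continuous_heatAverage hφw).continuousWithinAt
    (fun t ht => hasDerivAt_heatAverage hφw ht) (by rw [h0]; exact h1) hlim
  rw [h0, ← h2, heatAverage_zero, zero_add, zero_sub] at hFTC
  rw [← hFTC]
  simp_rw [mul_add, Finset.mul_sum]
  have i1 := integrable_heatKernel_mul ((hφ.fderiv_apply timeVec).comp_add_right w)
  have i2 := fun i => integrable_heatKernel_mul (((hφ.spaceDeriv i).spaceDeriv i).comp_add_right w)
  rw [integral_add i1 (integrable_finsetSum _ fun i _ => i2 i), integral_finsetSum _ fun i _ => i2 i]
  rfl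

end ParabolicHeat

namespace ParabolicHeat

/-! ### Continuity of the pairing -/

section PairingContinuity

variable {V : Type*} [NormedAddCommGroup V] [NormedSpace ℝ V] [FiniteDimensional ℝ V]

/-- A single cutoff, equal to one near the support of `ν`, works for all smooth `ψ`. The pairing,
defined by a choice for each `ψ`, is therefore linear and continuous in `ψ`. -/
theorem exists_cutoff_pairing (ν : 𝓓'((⊤ : Opens V), ℝ))
    (hν : IsCompact (Distribution.dsupport ν)) :
    ∃ (χ : V → ℝ) (hχ : ContDiff ℝ (⊤ : ℕ∞) χ) (hχc : HasCompactSupport χ),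
      ∀ (ψ : V → ℝ) (hψ : ContDiff ℝ (⊤ : ℕ∞) ψ), pairing ν ψ =
        ν ⟨fun x => χ x * ψ x, hχ.mul hψ, hχc.mul_right, fun _ _ => trivial⟩ := by
  obtain ⟨θ, hθ⟩ := exists_testFunction_eventuallyEq hν (ψ := fun _ => (1 : ℝ)) contDiff_const
  refine ⟨θ, θ.contDiff, θ.hasCompactSupport, fun ψ hψ => ?_⟩
  refine pairing_eq ν _ ?_
  filter_upwards [hθ] with x hx
  change θ x * ψ x = ψ x
  rw [hx, one_mul]

theorem pairing_testFunction (ν : 𝓓'((⊤ : Opens V), ℝ)) (φ : 𝓓((⊤ : Opens V), ℝ)) :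
    pairing ν φ = ν φ :=
  pairing_eq ν φ (Eventually.of_forall fun _ => rfl)

theorem pairing_add (ν : 𝓓'((⊤ : Opens V), ℝ)) (hν : IsCompact (Distribution.dsupport ν))
    {u v : V → ℝ} (hu : ContDiff ℝ (⊤ : ℕ∞) u) (hv : ContDiff ℝ (⊤ : ℕ∞) v) :
    pairing ν (fun x => u x + v x) = pairing ν u + pairing ν v := by
  obtain ⟨χ, hχ, hχc, h⟩ := exists_cutoff_pairing ν hν
  rw [h _ (hu.add hv), h _ hu, h _ hv, ← map_add]
  congr 1
  ext x
  exact mul_add _ _ _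

theorem pairing_const_mul (ν : 𝓓'((⊤ : Opens V), ℝ)) (hν : IsCompact (Distribution.dsupport ν))
    {u : V → ℝ} (hu : ContDiff ℝ (⊤ : ℕ∞) u) (c : ℝ) :
    pairing ν (fun x => c * u x) = c * pairing ν u := by
  obtain ⟨χ, hχ, hχc, h⟩ := exists_cutoff_pairing ν hν
  rw [h _ (contDiff_const.mul hu), h _ hu, ← smul_eq_mul c (ν _), ← map_smul]
  congr 1
  ext x
  exact mul_left_comm _ _ _

theorem pairing_sum (ν : 𝓓'((⊤ : Opens V), ℝ)) (hν : IsCompact (Distribution.dsupport ν))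
    {ι : Type*} (s : Finset ι) {u : ι → V → ℝ} (hu : ∀ i, ContDiff ℝ (⊤ : ℕ∞) (u i)) :
    pairing ν (fun x => ∑ i ∈ s, u i x) = ∑ i ∈ s, pairing ν (u i) := by
  classical
  induction s using Finset.induction_on with
  | empty =>
    have := pairing_const_mul ν hν (u := fun _ => 0) contDiff_const 0
    simpa using this
  | insert a s ha ih =>
    simp_rw [Finset.sum_insert ha]
    rw [pairing_add ν hν (hu a) (ContDiff.sum fun i _ => hu i), ih]

/-- On functions supported in a fixed compact set, `ν` is bounded by finitely many derivative
seminorms. The form `ε * b k` expresses that all derivatives are small at the same rate, so the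
pairing is small too. -/
theorem exists_pairing_le (ν : 𝓓'((⊤ : Opens V), ℝ)) (hν : IsCompact (Distribution.dsupport ν))
    (b : ℕ → ℝ) : ∃ C, ∀ (u : V → ℝ) (ε : ℝ), 0 ≤ ε → SmoothBounded u (fun k => ε * b k) →
      |pairing ν u| ≤ C * ε := by
  obtain ⟨χ, hχ, hχc, h⟩ := exists_cutoff_pairing ν hν
  obtain ⟨c, hc⟩ := exists_smoothBounded hχ hχc
  let K : Compacts V := ⟨tsupport χ, hχc⟩
  let L : 𝓓_{K}(V, ℝ) →L[ℝ] ℝ :=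
    ν.comp (TestFunction.ofSupportedInCLM ℝ (K := K) (fun _ _ => trivial))
  obtain ⟨s, C, -, hs⟩ := Seminorm.bound_of_continuous
    (ContDiffMapSupportedIn.withSeminorms ℝ V ℝ ⊤ K) ((normSeminorm ℝ ℝ).comp L.toLinearMap)
    (continuous_norm.comp L.continuous)
  let B : ℕ → ℝ := fun k => ∑ i ∈ Finset.range (k + 1), (k.choose i : ℝ) * c i * b (k - i)
  refine ⟨C * ∑ k ∈ s, |B k|, fun u ε hε hu => ?_⟩
  have hm := hc.mul hu
  let f : 𝓓_{K}(V, ℝ) := ⟨fun x => χ x * u x, hm.contDiff, fun x hx => by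
    change χ x * u x = 0
    rw [image_eq_zero_of_notMem_tsupport hx, zero_mul]⟩
  have h1 : |pairing ν u| = ((normSeminorm ℝ ℝ).comp L.toLinearMap) f := by
    rw [h u hu.contDiff]
    rfl
  rw [h1]
  refine (hs f).trans ?_
  rw [smul_apply, NNReal.smul_def, smul_eq_mul, mul_assoc]
  refine mul_le_mul_of_nonneg_left ?_ C.2
  refine Seminorm.finset_sup_apply_le (by positivity) fun k hk => ?_
  have hBk : |B k| ≤ ∑ k ∈ s, |B k| :=
    Finset.single_le_sum (f := fun k => |B k|) (fun _ _ => abs_nonneg _) hk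
  rw [ContDiffMapSupportedIn.seminorm_top_le_iff ℝ (by positivity)]
  intro x _
  refine (hm.bound k x).trans ?_
  have : ∑ i ∈ Finset.range (k + 1), (k.choose i : ℝ) * c i * (ε * b (k - i)) = B k * ε := by
    rw [Finset.sum_mul]
    refine Finset.sum_congr rfl fun i _ => ?_
    ring
  rw [this]
  exact mul_le_mul_of_nonneg_right ((le_abs_self _).trans hBk) hε

end PairingContinuity

/-! ### Truncations of the odd half derivative -/

variable {n : ℕ}

theorem evenKernel_eq (s : ℝ) : evenKernel s = (|s| ^ (3 / 2 : ℝ))⁻¹ := by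
  have h : ∀ s : ℝ, 0 < s → rightKernel s = (|s| ^ (3 / 2 : ℝ))⁻¹ := fun s hs => by
    rw [rightKernel_eq_rpow hs, abs_of_pos hs, Real.rpow_neg hs.le]
  rcases lt_trichotomy s 0 with hs | rfl | hs
  · rw [evenKernel, rightKernel_of_nonpos hs.le, zero_add, leftKernel, h _ (neg_pos.2 hs), abs_neg]
  · simp [evenKernel, leftKernel, rightKernel]
  · rw [evenKernel, leftKernel, rightKernel_of_nonpos (neg_nonpos.2 hs.le), add_zero, h s hs]

theorem halfTimeDeriv_eq (φ : SpaceTime n → ℝ) :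
    halfTimeDeriv φ = diffInt timeVec evenKernel φ := by
  ext z
  rw [halfTimeDeriv, diffInt, ← integral_add_right_eq_self _ z.2]
  congr 1 with s
  have : z + s • (timeVec : SpaceTime n) = (z.1, s + z.2) := by
    ext <;> simp [timeVec, add_comm]
  rw [evenKernel_eq, this, add_sub_cancel_right]
  ring

/-- The truncated kernel `sgn(s) |s|^(-3/2)` on `[-R, R]`. -/
noncomputable def truncKernel (R s : ℝ) : ℝ := (Icc (-R) R).indicator oddKernel s

theorem diffKernel_truncKernel (R : ℝ) : DiffKernel (truncKernel R) := by
  refine ⟨diffKernel_oddKernel.measurable.indicator measurableSet_Icc, ?_⟩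
  refine (diffKernel_oddKernel.integrable.indicator (measurableSet_Icc (a := -R) (b := R))).congr
    (Eventually.of_forall fun s => ?_)
  simp only [truncKernel, indicator_mul_left]

theorem diffKernel_sub_truncKernel (R : ℝ) :
    DiffKernel fun s => oddKernel s - truncKernel R s := by
  refine ⟨diffKernel_oddKernel.measurable.sub (diffKernel_truncKernel R).measurable, ?_⟩
  refine (diffKernel_oddKernel.integrable.sub (diffKernel_truncKernel R).integrable).congr
    (Eventually.of_forall fun s => ?_)
  simp only [Pi.sub_apply, sub_mul]

theorem tendsto_integral_sub_truncKernel :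
    Tendsto (fun j : ℕ => ∫ s, ‖(oddKernel s - truncKernel j s) * min 1 |s|‖) atTop (𝓝 0) := by
  have h : ∀ s (j : ℕ), ‖(oddKernel s - truncKernel j s) * min 1 |s|‖ ≤
      ‖oddKernel s * min 1 |s|‖ := by
    intro s j
    rw [norm_mul, norm_mul]
    refine mul_le_mul_of_nonneg_right ?_ (norm_nonneg _)
    unfold truncKernel
    by_cases hs : s ∈ Icc (-(j : ℝ)) j
    · simp [indicator_of_mem hs]
    · simp [indicator_of_notMem hs]
  have := tendsto_integral_of_dominated_convergence
    (F := fun (j : ℕ) s => ‖(oddKernel s - truncKernel j s) * min 1 |s|‖) (f := fun _ => (0 : ℝ))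
    (μ := volume) (fun s => ‖oddKernel s * min 1 |s|‖)
    (fun j => (diffKernel_sub_truncKernel j).integrable.norm.aestronglyMeasurable)
    diffKernel_oddKernel.integrable.norm
    (fun j => Eventually.of_forall fun s => by simpa using h s j)
    (Eventually.of_forall fun s => ?_)
  · simpa using this
  · refine tendsto_const_nhds.congr' ?_
    filter_upwards [eventually_ge_atTop ⌈|s|⌉₊] with j hj
    have hs : s ∈ Icc (-(j : ℝ)) j := abs_le.1 (Nat.ceil_le.1 hj)
    simp [truncKernel, indicator_of_mem hs]

/-- The reason for truncating: the full odd half derivative of a test function generally has a tail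
of order `|t|^(-3/2)`, so the hypothesis on `h` cannot be tested with it directly. -/
theorem isTest_diffInt_truncKernel {φ : SpaceTime n → ℝ} (hφ : IsTest φ) (R : ℝ) :
    IsTest (diffInt timeVec (truncKernel R) φ) := by
  obtain ⟨b, hb⟩ := exists_smoothBounded hφ.contDiff hφ.hasCompactSupport
  refine ⟨(hb.diffInt (diffKernel_truncKernel R) norm_timeVec_le).contDiff, ?_⟩
  obtain ⟨ρ, hρ⟩ := hφ.hasCompactSupport.isCompact.isBounded.subset_closedBall 0
  have h0 : ∀ z, ρ < ‖z‖ → φ z = 0 := fun z hz => by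
    by_contra h
    exact absurd (hρ (subset_tsupport φ h)) (by simpa using hz)
  refine HasCompactSupport.intro (isCompact_closedBall (0 : SpaceTime n) (ρ + |R|)) fun z hz => ?_
  have hz' : ρ + |R| < ‖z‖ := by simpa using hz
  rw [diffInt]
  refine (integral_congr_ae (Eventually.of_forall fun s => ?_)).trans (integral_zero _ _)
  change truncKernel R s * (φ (z + s • timeVec) - φ z) = 0
  by_cases hs : s ∈ Icc (-R) R
  · have h1 : |s| ≤ |R| := (abs_le.2 hs).trans (le_abs_self R)
    have h2 : ‖s • (timeVec : SpaceTime n)‖ ≤ |R| := by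
      rw [norm_smul, Real.norm_eq_abs]
      exact (mul_le_of_le_one_right (abs_nonneg s) norm_timeVec_le).trans h1
    have h3 := norm_sub_le (z + s • timeVec) (s • (timeVec : SpaceTime n))
    rw [add_sub_cancel_right] at h3
    rw [h0 z (by linarith [abs_nonneg R]), h0 _ (by linarith)]
    simp
  · simp [truncKernel, indicator_of_notMem hs]

/-- A smooth function with compact support, as a test function. -/
def IsTest.toTest {φ : SpaceTime n → ℝ} (hφ : IsTest φ) : 𝓓((⊤ : Opens (SpaceTime n)), ℝ) :=
  ⟨φ, hφ.contDiff, hφ.hasCompactSupport, fun _ _ => trivial⟩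

theorem isTest_coe (φ : 𝓓((⊤ : Opens (SpaceTime n)), ℝ)) : IsTest (φ : SpaceTime n → ℝ) :=
  ⟨φ.contDiff, φ.hasCompactSupport⟩

/-- The time derivative of the potential as a limit of half derivatives. -/
theorem tendsto_integral_mul_diffInt_truncKernel {ν : 𝓓'((⊤ : Opens (SpaceTime n)), ℝ)}
    (hν : IsCompact (Distribution.dsupport ν)) {h : SpaceTime n → ℝ}
    (hh : IsHalfTimeDerivPotential ν h) {φ : SpaceTime n → ℝ} (hφ : IsTest φ) :
    Tendsto (fun j : ℕ => ∫ z, h z * diffInt timeVec (truncKernel j) φ z) atTop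
      (𝓝 (-(8 * Real.pi) * heatPotential ν fun z => fderiv ℝ φ z timeVec)) := by
  have he := norm_timeVec_le (n := n)
  obtain ⟨b, hb⟩ := smoothBounded_backwardPotential hφ
  set u := backwardPotential φ
  have h1 : ∀ j : ℕ, ∫ z, h z * diffInt timeVec (truncKernel j) φ z =
      pairing ν (diffInt timeVec evenKernel (diffInt timeVec (truncKernel j) u)) := by
    intro j
    -- The truncated odd half derivative is an admissible test function, and both difference
    -- operators commute with the potential.
    have ht := isTest_diffInt_truncKernel hφ j
    refine (hh.2 ht.toTest).trans ?_
    rw [heatPotential_eq]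
    congr 1
    change backwardPotential (halfTimeDeriv (diffInt timeVec (truncKernel j) φ)) = _
    rw [halfTimeDeriv_eq]
    ext w
    rw [backwardPotential_diffInt diffKernel_evenKernel ht]
    congr 1
    ext w
    exact backwardPotential_diffInt (diffKernel_truncKernel j) hφ w
  have h2 : (-(8 * Real.pi) * heatPotential ν fun z => fderiv ℝ φ z timeVec) =
      pairing ν (diffInt timeVec evenKernel (diffInt timeVec oddKernel u)) := by
    have h3 : diffInt timeVec evenKernel (diffInt timeVec oddKernel u) =
        fun w => -(8 * Real.pi) * backwardPotential (fun z => fderiv ℝ φ z timeVec) w := by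
      ext w
      rw [diffInt_evenKernel_oddKernel he hb, fderiv_backwardPotential hφ]
    obtain ⟨c, hc⟩ := smoothBounded_backwardPotential (hφ.fderiv_apply timeVec)
    rw [h3, pairing_const_mul ν hν hc.contDiff, heatPotential_eq]
  rw [h2]
  simp_rw [h1]
  rw [tendsto_iff_norm_sub_tendsto_zero]
  set I : ℝ := ∫ s, ‖evenKernel s * min 1 |s|‖
  -- These are the derivative bounds for the even half derivative of the truncation error, with the
  -- mass of the kernel tail factored out as `ε`. The constant `C` is thus independent of `j`, and
  -- the tail mass tends to zero.
  obtain ⟨C, hC⟩ := exists_pairing_le ν hν fun k =>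
    2 * (2 * (b k + b (k + 1)) + 2 * (b (k + 1) + b (k + 1 + 1))) * I
  have hlim := tendsto_integral_sub_truncKernel.const_mul C
  rw [mul_zero] at hlim
  refine squeeze_zero (fun _ => norm_nonneg _) (fun j => ?_) hlim
  have hodd := hb.diffInt diffKernel_oddKernel he
  have htr := hb.diffInt (diffKernel_truncKernel j) he
  have htail := hb.diffInt (diffKernel_sub_truncKernel j) he
  have h4 : pairing ν (diffInt timeVec evenKernel (diffInt timeVec oddKernel u)) =
      pairing ν (diffInt timeVec evenKernel (diffInt timeVec (truncKernel j) u)) +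
      pairing ν (diffInt timeVec evenKernel
        (diffInt timeVec (fun s => oddKernel s - truncKernel j s) u)) := by
    rw [← pairing_add ν hν (htr.diffInt diffKernel_evenKernel he).contDiff
      (htail.diffInt diffKernel_evenKernel he).contDiff]
    congr 1
    ext w
    have h5 : diffInt timeVec (fun s => oddKernel s - truncKernel j s) u =
        fun w => diffInt timeVec oddKernel u w - diffInt timeVec (truncKernel j) u w := by
      ext w
      exact diffInt_sub_left diffKernel_oddKernel (diffKernel_truncKernel j) he hb w
    rw [h5, diffInt_sub_right diffKernel_evenKernel he hodd htr]
    ring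
  rw [h4, sub_add_cancel_left, norm_neg, Real.norm_eq_abs]
  refine hC _ _ (integral_nonneg fun _ => norm_nonneg _) ?_
  convert htail.diffInt diffKernel_evenKernel he using 2 with k
  ring

/-- The distribution recovered from its potential. -/
theorem apply_eq_heatPotential {ν : 𝓓'((⊤ : Opens (SpaceTime n)), ℝ)}
    (hν : IsCompact (Distribution.dsupport ν)) {G : SpaceTime n → EuclideanSpace ℝ (Fin n)}
    (hG : IsSpaceGradientPotential ν G) (φ : 𝓓((⊤ : Opens (SpaceTime n)), ℝ)) :
    ν φ = (∑ i, ∫ z, G z i * spaceDeriv i φ z) -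
      heatPotential ν fun z => fderiv ℝ φ z timeVec := by
  have hφ := isTest_coe φ
  -- Testing the gradient of the potential with `∂ᵢφ` yields the terms of the Laplacian; the rest is
  -- the backward heat identity paired with `ν`.
  have h1 : ∀ i, ∫ z, G z i * spaceDeriv i φ z =
      -pairing ν (backwardPotential (spaceDeriv i (spaceDeriv i φ))) := by
    intro i
    rw [← heatPotential_eq]
    exact hG.2 i (hφ.spaceDeriv i).toTest
  obtain ⟨c, hc⟩ := smoothBounded_backwardPotential (hφ.fderiv_apply timeVec)
  have hs : ∀ i, ContDiff ℝ (⊤ : ℕ∞) (backwardPotential (spaceDeriv i (spaceDeriv i φ))) :=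
    fun i => (smoothBounded_backwardPotential
      ((hφ.spaceDeriv i).spaceDeriv i)).choose_spec.contDiff
  have h2 : pairing ν (fun w => backwardPotential (fun z => fderiv ℝ φ z timeVec) w +
      ∑ i, backwardPotential (spaceDeriv i (spaceDeriv i φ)) w) = -ν φ := by
    simp_rw [backwardPotential_heat hφ]
    have := pairing_const_mul ν hν hφ.contDiff (-1)
    simpa [pairing_testFunction] using this
  rw [pairing_add ν hν hc.contDiff (ContDiff.sum fun i _ => hs i), pairing_sum ν hν _ hs] at h2
  simp_rw [h1, heatPotential_eq]
  rw [Finset.sum_neg_distrib]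
  linarith

end ParabolicHeat

namespace ParabolicHeat

/-! ### Parabolic cubes -/

variable {n : ℕ}

theorem parabolicCube_eq (a : SpaceTime n) (ℓ : ℝ) :
    parabolicCube a ℓ = ((EuclideanSpace.equiv (Fin n) ℝ) ⁻¹'
      (univ.pi fun i => Icc (a.1 i) (a.1 i + ℓ))) ×ˢ Icc a.2 (a.2 + ℓ ^ 2) := by
  ext z
  rw [mem_prod, mem_preimage, mem_univ_pi]
  rfl

theorem isCompact_parabolicCube (a : SpaceTime n) (ℓ : ℝ) : IsCompact (parabolicCube a ℓ) := by
  rw [parabolicCube_eq]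
  refine IsCompact.prod ?_ isCompact_Icc
  exact (EuclideanSpace.equiv (Fin n) ℝ).toHomeomorph.isCompact_preimage.2
    (isCompact_univ_pi fun _ => isCompact_Icc)

theorem measurableSet_parabolicCube (a : SpaceTime n) (ℓ : ℝ) :
    MeasurableSet (parabolicCube a ℓ) :=
  (isCompact_parabolicCube a ℓ).measurableSet

theorem volume_parabolicCube (a : SpaceTime n) {ℓ : ℝ} (hℓ : 0 ≤ ℓ) :
    volume (parabolicCube a ℓ) = ENNReal.ofReal (ℓ ^ (n + 2)) := by
  rw [parabolicCube_eq, Measure.volume_eq_prod, Measure.prod_prod, Real.volume_Icc]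
  have h := (EuclideanSpace.volume_preserving_symm_measurableEquiv_toLp (Fin n)).measure_preimage
    (MeasurableSet.univ_pi fun i => measurableSet_Icc (a := a.1 i) (b := a.1 i + ℓ)).nullMeasurableSet
  have h2 : volume (⇑(EuclideanSpace.equiv (Fin n) ℝ) ⁻¹'
      (univ.pi fun i => Icc (a.1 i) (a.1 i + ℓ))) = ENNReal.ofReal (ℓ ^ n) := by
    refine h.trans ?_
    rw [volume_pi, Measure.pi_pi]
    simp [Real.volume_Icc, ENNReal.ofReal_pow hℓ]
  rw [h2, add_sub_cancel_left, ← ENNReal.ofReal_mul (by positivity), ← pow_add]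

/-- The average of a function over a parabolic cube. -/
noncomputable def cubeAverage (h : SpaceTime n → ℝ) (a : SpaceTime n) (ℓ : ℝ) : ℝ :=
  ⨍ w in parabolicCube a ℓ, h w

theorem lintegral_sub_cubeAverage_le {h : SpaceTime n → ℝ} (hh : parabolicBMO h ≤ 1)
    (a : SpaceTime n) {ℓ : ℝ} (hℓ : 0 < ℓ) :
    ∫⁻ z in parabolicCube a ℓ, ‖h z - cubeAverage h a ℓ‖ₑ ≤ ENNReal.ofReal (ℓ ^ (n + 2)) := by
  have h1 : ⨍⁻ z in parabolicCube a ℓ, ‖h z - ⨍ w in parabolicCube a ℓ, h w‖ₑ ∂volume ≤ 1 := by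
    refine le_trans ?_ hh
    exact le_iSup_of_le a (le_iSup_of_le ℓ (le_iSup_of_le hℓ le_rfl))
  have h2 := measure_mul_setLAverage (μ := volume)
    (fun z => ‖h z - cubeAverage h a ℓ‖ₑ) (isCompact_parabolicCube a ℓ).measure_lt_top.ne
  rw [← h2, ← volume_parabolicCube a hℓ.le]
  exact mul_le_of_le_one_right' h1

/-- The oscillation over the larger cube dominates the integral over the smaller one; dividing by
the smaller volume leaves the ratio of the volumes. -/
theorem abs_cubeAverage_sub_le {h : SpaceTime n → ℝ} (hh : parabolicBMO h ≤ 1)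
    (hi : LocallyIntegrable h) {a b : SpaceTime n} {ℓ r : ℝ} (hℓ : 0 < ℓ) (hr : 0 < r)
    (hab : parabolicCube a ℓ ⊆ parabolicCube b r) :
    |cubeAverage h a ℓ - cubeAverage h b r| ≤ (r / ℓ) ^ (n + 2) := by
  set c := cubeAverage h b r
  have hfin : volume (parabolicCube a ℓ) ≠ ∞ := (isCompact_parabolicCube a ℓ).measure_lt_top.ne
  have hint : IntegrableOn h (parabolicCube a ℓ) :=
    hi.integrableOn_isCompact (isCompact_parabolicCube a ℓ)
  have h1 : ∫ z in parabolicCube a ℓ, (h z - c) = ℓ ^ (n + 2) * (cubeAverage h a ℓ - c) := by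
    rw [integral_sub hint (integrableOn_const hfin), ← measure_smul_setAverage h hfin]
    simp [measureReal_def, volume_parabolicCube a hℓ.le, cubeAverage,
      ENNReal.toReal_ofReal (by positivity : 0 ≤ ℓ ^ (n + 2))]
    ring
  have h2 : ‖ℓ ^ (n + 2) * (cubeAverage h a ℓ - c)‖ₑ ≤ ENNReal.ofReal (r ^ (n + 2)) := by
    rw [← h1]
    refine (enorm_integral_le_lintegral_enorm _).trans ((lintegral_mono_set hab).trans ?_)
    exact lintegral_sub_cubeAverage_le hh b hr
  rw [← ofReal_norm, ENNReal.ofReal_le_ofReal_iff (by positivity), norm_mul,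
    Real.norm_of_nonneg (by positivity), Real.norm_eq_abs] at h2
  rw [div_pow, le_div_iff₀ (by positivity)]
  linarith

theorem parabolicCube_subset {a : SpaceTime n} {ℓ r u : ℝ} (hℓr : ℓ ≤ r) (hu : 0 ≤ u)
    (hur : u + ℓ ^ 2 ≤ r ^ 2) : parabolicCube (a + u • timeVec) ℓ ⊆ parabolicCube a r := by
  rintro z ⟨h1, h2⟩
  refine ⟨fun i => ⟨?_, ?_⟩, ?_, ?_⟩
  · simpa [timeVec] using (h1 i).1
  · have := (h1 i).2
    simp only [timeVec, Prod.fst_add, Prod.smul_fst, smul_zero, add_zero] at this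
    linarith
  · have := h2.1
    simp only [timeVec, Prod.snd_add, Prod.smul_snd, smul_eq_mul, mul_one] at this
    linarith
  · have := h2.2
    simp only [timeVec, Prod.snd_add, Prod.smul_snd, smul_eq_mul, mul_one] at this
    linarith

theorem abs_cubeAverage_two_pow_sub_le {h : SpaceTime n → ℝ} (hh : parabolicBMO h ≤ 1)
    (hi : LocallyIntegrable h) (a : SpaceTime n) {ℓ : ℝ} (hℓ : 0 < ℓ) (k : ℕ) :
    |cubeAverage h a (2 ^ k * ℓ) - cubeAverage h a ℓ| ≤ k * 2 ^ (n + 2) := by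
  induction k with
  | zero => simp
  | succ k ih =>
    have h1 := abs_cubeAverage_sub_le hh hi (a := a + (0 : ℝ) • timeVec) (b := a)
      (ℓ := 2 ^ k * ℓ) (r := 2 ^ (k + 1) * ℓ) (by positivity) (by positivity)
      (parabolicCube_subset (by rw [pow_succ]; nlinarith [pow_pos two_pos (M₀ := ℝ) k])
        le_rfl (by rw [pow_succ (2 : ℝ) k]; nlinarith [sq_nonneg (2 ^ k * ℓ)]))
    have h2 : 2 ^ (k + 1) * ℓ / (2 ^ k * ℓ) = 2 := by
      field_simp
      ring
    rw [h2, zero_smul, add_zero, abs_sub_comm] at h1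
    push_cast
    have := abs_sub_le (cubeAverage h a (2 ^ (k + 1) * ℓ)) (cubeAverage h a (2 ^ k * ℓ))
      (cubeAverage h a ℓ)
    linarith

/-- After `k` doublings both cubes lie in the cube of side `2^(k+1) * ℓ` at the earlier corner. The
chain has `k` doublings on each side and two inclusions at the top, each costing `2^(n+2)`. -/
theorem abs_cubeAverage_shift_sub_le {h : SpaceTime n → ℝ} (hh : parabolicBMO h ≤ 1)
    (hi : LocallyIntegrable h) (a : SpaceTime n) {ℓ u : ℝ} (hℓ : 0 < ℓ) {k : ℕ}
    (huk : |u| ≤ 4 ^ k * ℓ ^ 2) :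
    |cubeAverage h (a + u • timeVec) ℓ - cubeAverage h a ℓ| ≤ (2 * k + 2) * 2 ^ (n + 2) := by
  wlog hu : 0 ≤ u generalizing a u
  · have := this (a + u • timeVec) (u := -u) (by rwa [abs_neg]) (by linarith)
    rwa [add_assoc, ← add_smul, add_neg_cancel, zero_smul, add_zero, abs_sub_comm] at this
  rw [abs_of_nonneg hu] at huk
  have e4 : (4 : ℝ) ^ k = (2 ^ k) ^ 2 := by rw [← pow_mul, mul_comm, pow_mul]; norm_num
  rw [e4] at huk
  have h2 : 2 ^ (k + 1) * ℓ / (2 ^ k * ℓ) = 2 := by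
    field_simp
    ring
  have key : ∀ v : ℝ, 0 ≤ v → v ≤ (2 ^ k) ^ 2 * ℓ ^ 2 →
      |cubeAverage h (a + v • timeVec) (2 ^ k * ℓ) - cubeAverage h a (2 ^ (k + 1) * ℓ)| ≤
        2 ^ (n + 2) := by
    intro v hv hvk
    have h1 := abs_cubeAverage_sub_le hh hi (a := a + v • timeVec) (b := a)
      (ℓ := 2 ^ k * ℓ) (r := 2 ^ (k + 1) * ℓ) (by positivity) (by positivity)
      (parabolicCube_subset (by rw [pow_succ]; nlinarith [pow_pos two_pos (M₀ := ℝ) k])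
        hv (by rw [pow_succ (2 : ℝ) k]; nlinarith [sq_nonneg (2 ^ k * ℓ)]))
    rwa [h2] at h1
  have k1 := abs_le.1 (key u hu huk)
  have k2 := abs_le.1 (key 0 le_rfl (by positivity))
  have k3 := abs_le.1 (abs_cubeAverage_two_pow_sub_le hh hi (a + u • timeVec) hℓ k)
  have k4 := abs_le.1 (abs_cubeAverage_two_pow_sub_le hh hi a hℓ k)
  rw [zero_smul, add_zero] at k2
  rw [abs_le]
  constructor <;> linarith [k1.1, k1.2, k2.1, k2.2, k3.1, k3.2, k4.1, k4.2]

/-- The averages over time translates of a cube grow slower than any power. -/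
theorem abs_cubeAverage_int_shift_sub_le {h : SpaceTime n → ℝ} (hh : parabolicBMO h ≤ 1)
    (hi : LocallyIntegrable h) (a : SpaceTime n) {ℓ : ℝ} (hℓ : 0 < ℓ) (j : ℤ) :
    |cubeAverage h (a + (j * ℓ ^ 2) • timeVec) ℓ - cubeAverage h a ℓ| ≤
      12 * 2 ^ (n + 2) * (1 + |(j : ℝ)|) ^ (1 / 4 : ℝ) := by
  set y : ℝ := 1 + |(j : ℝ)|
  have hy : 1 ≤ y := by simp [y]
  -- A logarithmic number of doublings suffices because `e < 4`. The logarithm is then traded for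
  -- the power `1/4`; any power below `1/2` would leave a summable series against the decay `-3/2`.
  obtain ⟨k, hk1, hk2⟩ : ∃ k : ℕ, |(j : ℝ)| ≤ 4 ^ k ∧ (k : ℝ) ≤ Real.log y + 1 := by
    refine ⟨⌈Real.log y⌉₊, ?_, (Nat.ceil_lt_add_one (Real.log_nonneg hy)).le⟩
    calc |(j : ℝ)| ≤ y := by simp [y]
      _ = Real.exp (Real.log y) := (Real.exp_log (by linarith)).symm
      _ ≤ Real.exp ⌈Real.log y⌉₊ := Real.exp_le_exp.2 (Nat.le_ceil _)
      _ = Real.exp 1 ^ ⌈Real.log y⌉₊ := by rw [← Real.exp_nat_mul, mul_one]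
      _ ≤ 4 ^ ⌈Real.log y⌉₊ := by
        have := Real.exp_one_lt_d9
        gcongr
        linarith
  have h1 := abs_cubeAverage_shift_sub_le hh hi a hℓ (u := j * ℓ ^ 2) (k := k) (by
    rw [abs_mul, abs_of_nonneg (sq_nonneg ℓ)]
    exact mul_le_mul_of_nonneg_right hk1 (sq_nonneg ℓ))
  refine h1.trans ?_
  have h2 := Real.log_le_rpow_div (by linarith : 0 ≤ y) (by norm_num : (0 : ℝ) < 1 / 4)
  have h3 : 1 ≤ y ^ (1 / 4 : ℝ) := Real.one_le_rpow hy (by norm_num)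
  have h4 : (2 * k + 2 : ℝ) ≤ 12 * y ^ (1 / 4 : ℝ) := by
    have : y ^ (1 / 4 : ℝ) / (1 / 4) = 4 * y ^ (1 / 4 : ℝ) := by ring
    rw [this] at h2
    linarith
  calc (2 * k + 2 : ℝ) * 2 ^ (n + 2) ≤ 12 * y ^ (1 / 4 : ℝ) * 2 ^ (n + 2) := by gcongr
    _ = _ := by ring

/-- Oscillation on the translated cube plus the drift of its average; the constants `1` and `12` add
up to `13`. -/
theorem lintegral_sub_cubeAverage_shift_le {h : SpaceTime n → ℝ} (hh : parabolicBMO h ≤ 1)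
    (hi : LocallyIntegrable h) (a : SpaceTime n) {ℓ : ℝ} (hℓ : 0 < ℓ) (j : ℤ) :
    ∫⁻ z in parabolicCube (a + (j * ℓ ^ 2) • timeVec) ℓ, ‖h z - cubeAverage h a ℓ‖ₑ ≤
      ENNReal.ofReal (ℓ ^ (n + 2) * (13 * 2 ^ (n + 2) * (1 + |(j : ℝ)|) ^ (1 / 4 : ℝ))) := by
  set b := a + (j * ℓ ^ 2) • (timeVec : SpaceTime n)
  have hm : ∀ z, ‖h z - cubeAverage h a ℓ‖ₑ ≤ ‖h z - cubeAverage h b ℓ‖ₑ +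
      ‖cubeAverage h b ℓ - cubeAverage h a ℓ‖ₑ := by
    intro z
    rw [← sub_add_sub_cancel (h z) (cubeAverage h b ℓ)]
    exact enorm_add_le _ _
  refine (lintegral_mono hm).trans ?_
  rw [lintegral_add_right _ measurable_const, setLIntegral_const, volume_parabolicCube b hℓ.le]
  have h1 := lintegral_sub_cubeAverage_le hh b hℓ
  have h2 : ‖cubeAverage h b ℓ - cubeAverage h a ℓ‖ₑ ≤
      ENNReal.ofReal (12 * 2 ^ (n + 2) * (1 + |(j : ℝ)|) ^ (1 / 4 : ℝ)) := by
    rw [← ofReal_norm]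
    exact ENNReal.ofReal_le_ofReal (abs_cubeAverage_int_shift_sub_le hh hi a hℓ j)
  refine (add_le_add h1 (mul_le_mul_left h2 _)).trans ?_
  rw [← ENNReal.ofReal_mul (by positivity), ← ENNReal.ofReal_add (by positivity) (by positivity)]
  refine ENNReal.ofReal_le_ofReal ?_
  have h3 : 1 ≤ (1 + |(j : ℝ)|) ^ (1 / 4 : ℝ) := Real.one_le_rpow (by simp) (by norm_num)
  have h4 : (1 : ℝ) ≤ 2 ^ (n + 2) := one_le_pow₀ (by norm_num)
  have h5 : 1 ≤ 2 ^ (n + 2) * (1 + |(j : ℝ)|) ^ (1 / 4 : ℝ) := one_le_mul_of_one_le_of_one_le h4 h3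
  nlinarith [pow_pos hℓ (n + 2)]

end ParabolicHeat

namespace ParabolicHeat

/-! ### The half derivative of a bump function -/

variable {n : ℕ}

theorem evenKernel_nonneg (s : ℝ) : 0 ≤ evenKernel s :=
  add_nonneg (rightKernel_nonneg s) (rightKernel_nonneg (-s))

theorem abs_truncKernel_le (R s : ℝ) : |truncKernel R s| ≤ evenKernel s := by
  unfold truncKernel
  by_cases hs : s ∈ Icc (-R) R
  · rw [indicator_of_mem hs, oddKernel, evenKernel]
    have h1 := rightKernel_nonneg s
    have h2 : 0 ≤ leftKernel s := rightKernel_nonneg (-s)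
    rw [abs_le]
    constructor <;> linarith
  · rw [indicator_of_notMem hs, abs_zero]
    exact evenKernel_nonneg s

/-- By Fubini, integrating each difference over space-time first gives zero by translation
invariance. Mean zero lets a constant be subtracted from `h`, which BMO determines only up to
constants. -/
theorem integral_diffInt_truncKernel {φ : SpaceTime n → ℝ} (hφ : IsTest φ) (R : ℝ) :
    ∫ z, diffInt timeVec (truncKernel R) φ z = 0 := by
  obtain ⟨b, hb⟩ := exists_smoothBounded hφ.contDiff hφ.hasCompactSupport
  obtain ⟨ρ, hρ⟩ := hφ.hasCompactSupport.isCompact.isBounded.subset_closedBall 0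
  have h0 : ∀ z, ρ < ‖z‖ → φ z = 0 := fun z hz => by
    by_contra h
    exact absurd (hρ (subset_tsupport φ h)) (by simpa using hz)
  have hφc := hφ.continuous
  set K := Metric.closedBall (0 : SpaceTime n) (ρ + |R|)
  have hK : Integrable (K.indicator (1 : SpaceTime n → ℝ)) :=
    (integrable_indicator_iff Metric.isClosed_closedBall.measurableSet).2
      (integrableOn_const (isCompact_closedBall _ _).measure_lt_top.ne)
  have hκ := diffKernel_truncKernel R
  have hint : Integrable (Function.uncurry fun (z : SpaceTime n) s =>
      truncKernel R s * (φ (z + s • timeVec) - φ z)) (volume.prod volume) := by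
    refine ((hK.mul_prod hκ.integrable.norm).const_mul (2 * (b 0 + b 1))).mono' ?_
      (Eventually.of_forall ?_)
    · refine ((hκ.measurable.comp measurable_snd).mul
        (Continuous.measurable ?_)).aestronglyMeasurable
      fun_prop
    rintro ⟨z, s⟩
    simp only [Function.uncurry]
    by_cases hz : z ∈ K
    · rw [indicator_of_mem hz, norm_mul, norm_mul, Pi.one_apply, one_mul,
        Real.norm_of_nonneg (by positivity : 0 ≤ min 1 |s|)]
      have := hb.diff_abs_le norm_timeVec_le s z
      rw [Real.norm_eq_abs (φ _ - φ _)]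
      nlinarith [norm_nonneg (truncKernel R s)]
    · rw [indicator_of_notMem hz, zero_mul, mul_zero]
      have hz' : ρ + |R| < ‖z‖ := by simpa [K] using hz
      by_cases hs : s ∈ Icc (-R) R
      · have h1 : |s| ≤ |R| := (abs_le.2 hs).trans (le_abs_self R)
        have h2 : ‖s • (timeVec : SpaceTime n)‖ ≤ |R| := by
          rw [norm_smul, Real.norm_eq_abs]
          exact (mul_le_of_le_one_right (abs_nonneg s) norm_timeVec_le).trans h1
        have h3 := norm_sub_le (z + s • timeVec) (s • (timeVec : SpaceTime n))
        rw [add_sub_cancel_right] at h3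
        rw [h0 z (by linarith [abs_nonneg R]), h0 _ (by linarith)]
        simp
      · simp [truncKernel, indicator_of_notMem hs]
  have hi : Integrable φ := hφ.continuous.integrable_of_hasCompactSupport hφ.hasCompactSupport
  simp only [diffInt]
  rw [integral_integral_swap hint]
  refine (integral_congr_ae (Eventually.of_forall fun s => ?_)).trans (integral_zero _ _)
  change ∫ z, truncKernel R s * (φ (z + s • timeVec) - φ z) = 0
  rw [integral_const_mul, integral_sub (hi.comp_add_right _) hi,
    integral_add_right_eq_self φ, sub_self, mul_zero]

/-- `φ` is a bump function of height `A` adapted in time to the parabolic cube `Q(a, ℓ)`. -/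
structure IsTimeBump (φ : SpaceTime n → ℝ) (a : SpaceTime n) (ℓ A : ℝ) : Prop extends IsTest φ where
  eq_zero : ∀ z, z ∉ parabolicCube a ℓ → φ z = 0
  abs_le : ∀ z, |φ z| ≤ A
  abs_timeDeriv_le : ∀ z, |fderiv ℝ φ z timeVec| ≤ A / ℓ ^ 2

variable {φ : SpaceTime n → ℝ} {a : SpaceTime n} {ℓ A : ℝ}

theorem IsTimeBump.height_nonneg (hφ : IsTimeBump φ a ℓ A) : 0 ≤ A :=
  (abs_nonneg _).trans (hφ.abs_le 0)

theorem IsTimeBump.abs_sub_le (hφ : IsTimeBump φ a ℓ A) (z : SpaceTime n) (s : ℝ) :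
    |φ (z + s • timeVec) - φ z| ≤ 2 * A * min 1 (|s| / ℓ ^ 2) := by
  have hA := hφ.height_nonneg
  rcases le_total 1 (|s| / ℓ ^ 2) with h | h
  · rw [min_eq_left h]
    have := abs_sub (φ (z + s • timeVec)) (φ z)
    linarith [hφ.abs_le z, hφ.abs_le (z + s • timeVec)]
  · rw [min_eq_right h]
    have hd : ∀ r ∈ (univ : Set ℝ), HasDerivWithinAt (fun r : ℝ => φ (z + r • timeVec))
        (fderiv ℝ φ (z + r • timeVec) timeVec) univ r := by
      intro r _
      have h1 : HasFDerivAt φ (fderiv ℝ φ (z + r • timeVec)) (z + r • timeVec) :=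
        (hφ.contDiff.differentiable (by simp) _).hasFDerivAt
      have h2 : HasDerivAt (fun r : ℝ => z + r • (timeVec : SpaceTime n)) timeVec r := by
        have := ((hasDerivAt_id r).smul_const (timeVec : SpaceTime n)).const_add z
        rwa [one_smul] at this
      exact (h1.comp_hasDerivAt r h2).hasDerivWithinAt
    have := convex_univ.norm_image_sub_le_of_norm_hasDerivWithin_le hd
      (fun r _ => hφ.abs_timeDeriv_le (z + r • timeVec)) (mem_univ 0) (mem_univ s)
    rw [zero_smul, add_zero, sub_zero, Real.norm_eq_abs, Real.norm_eq_abs] at this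
    have e : A / ℓ ^ 2 * |s| = A * (|s| / ℓ ^ 2) := by ring
    rw [e] at this
    have : 0 ≤ A * (|s| / ℓ ^ 2) := by positivity
    linarith

/-- `∫ |s|^(-3/2) min(1, |s|) ds`. -/
noncomputable def evenKernelMass : ℝ := ∫ s, evenKernel s * min 1 |s|

theorem evenKernelMass_nonneg : 0 ≤ evenKernelMass :=
  integral_nonneg fun s => mul_nonneg (evenKernel_nonneg s) (by positivity)

theorem evenKernel_mul (hℓ : 0 < ℓ) (u : ℝ) : evenKernel (ℓ ^ 2 * u) = (ℓ ^ 3)⁻¹ * evenKernel u := by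
  rw [evenKernel_eq, evenKernel_eq, abs_mul, abs_of_nonneg (sq_nonneg ℓ),
    Real.mul_rpow (sq_nonneg ℓ) (abs_nonneg u), mul_inv, ← Real.rpow_natCast ℓ 2,
    ← Real.rpow_mul hℓ.le, ← Real.rpow_natCast ℓ 3]
  norm_num

/-- The substitution `s = ℓ² u`: an operator of order one half in time scales like `1 / ℓ`. -/
theorem integral_evenKernel_mul_min (hℓ : 0 < ℓ) :
    Integrable (fun s => evenKernel s * min 1 (|s| / ℓ ^ 2)) ∧
    ∫ s, evenKernel s * min 1 (|s| / ℓ ^ 2) = evenKernelMass / ℓ := by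
  have e : (fun u => evenKernel (ℓ ^ 2 * u) * min 1 (|ℓ ^ 2 * u| / ℓ ^ 2)) =
      fun u => (ℓ ^ 3)⁻¹ * (evenKernel u * min 1 |u|) := by
    ext u
    rw [evenKernel_mul hℓ, abs_mul, abs_of_nonneg (sq_nonneg ℓ),
      mul_div_cancel_left₀ _ (by positivity), mul_assoc]
  constructor
  · rw [← integrable_comp_mul_left_iff _ (by positivity : ℓ ^ 2 ≠ 0), e]
    exact diffKernel_evenKernel.integrable.const_mul _
  · have := Measure.integral_comp_mul_left (fun s => evenKernel s * min 1 (|s| / ℓ ^ 2)) (ℓ ^ 2)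
    rw [e, integral_const_mul, abs_of_nonneg (by positivity), smul_eq_mul,
      inv_mul_eq_iff_eq_mul₀ (by positivity)] at this
    rw [evenKernelMass]
    field_simp at this ⊢
    nlinarith

theorem IsTimeBump.abs_diffInt_le (hφ : IsTimeBump φ a ℓ A) (hℓ : 0 < ℓ) (R : ℝ) (z : SpaceTime n) :
    |diffInt timeVec (truncKernel R) φ z| ≤ 2 * evenKernelMass * (A / ℓ) := by
  have hA := hφ.height_nonneg
  obtain ⟨h1, h2⟩ := integral_evenKernel_mul_min hℓ
  rw [diffInt, ← Real.norm_eq_abs]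
  refine (norm_integral_le_of_norm_le (h1.const_mul (2 * A)) (Eventually.of_forall fun s => ?_)).trans
    (le_of_eq ?_)
  · rw [norm_mul, Real.norm_eq_abs, Real.norm_eq_abs]
    calc _ ≤ evenKernel s * (2 * A * min 1 (|s| / ℓ ^ 2)) :=
          mul_le_mul (abs_truncKernel_le R s) (hφ.abs_sub_le z s) (abs_nonneg _)
            (evenKernel_nonneg s)
      _ = _ := by ring
  · rw [integral_const_mul, h2]
    ring

theorem IsTimeBump.abs_diffInt_le_of_far (hφ : IsTimeBump φ a ℓ A) (hℓ : 0 < ℓ) (R : ℝ) {j : ℤ}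
    (hj : 2 ≤ |(j : ℝ)|) {z : SpaceTime n} (hz : z ∈ parabolicCube (a + (j * ℓ ^ 2) • timeVec) ℓ) :
    |diffInt timeVec (truncKernel R) φ z| ≤
      3 ^ (3 / 2 : ℝ) * (A / ℓ) * (1 + |(j : ℝ)|) ^ (-(3 / 2) : ℝ) := by
  have hA := hφ.height_nonneg
  have hz1 : a.2 + j * ℓ ^ 2 ≤ z.2 := by simpa [timeVec] using hz.2.1
  have hz2 : z.2 ≤ a.2 + j * ℓ ^ 2 + ℓ ^ 2 := by simpa [timeVec] using hz.2.2
  have hℓ2 : 0 < ℓ ^ 2 := by positivity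
  -- The time gap to the support is at least `(|j| - 1) ℓ²`, and `|j| - 1 ≥ (1 + |j|)/3` holds
  -- exactly when `|j| ≥ 2`.
  have hfar : ∀ s : ℝ, |s| < (1 + |(j : ℝ)|) / 3 * ℓ ^ 2 → φ (z + s • timeVec) = 0 := by
    intro s hs
    refine hφ.eq_zero _ fun h => ?_
    have h1 : a.2 ≤ z.2 + s := by simpa [timeVec] using h.2.1
    have h2 : z.2 + s ≤ a.2 + ℓ ^ 2 := by simpa [timeVec] using h.2.2
    have h3 := abs_lt.1 hs
    rcases le_total 0 (j : ℝ) with hj0 | hj0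
    · rw [abs_of_nonneg hj0] at hj h3
      nlinarith
    · rw [abs_of_nonpos hj0] at hj h3
      nlinarith
  set c : ℝ := (((1 + |(j : ℝ)|) / 3 * ℓ ^ 2) ^ (3 / 2 : ℝ))⁻¹
  have hc : 0 ≤ c := by positivity
  have hφz : φ z = 0 := by
    have := hfar 0 (by rw [abs_zero]; positivity)
    rwa [zero_smul, add_zero] at this
  have hbound : ∀ s, ‖truncKernel R s * (φ (z + s • timeVec) - φ z)‖ ≤
      (Icc (a.2 - z.2) (a.2 - z.2 + ℓ ^ 2)).indicator (fun _ => c * A) s := by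
    intro s
    rw [hφz, sub_zero]
    by_cases h0 : φ (z + s • timeVec) = 0
    · rw [h0, mul_zero, norm_zero]
      exact indicator_nonneg (fun _ _ => by positivity) s
    have hs : s ∈ Icc (a.2 - z.2) (a.2 - z.2 + ℓ ^ 2) := by
      by_contra h
      refine h0 (hφ.eq_zero _ fun hm => h ?_)
      have h1 : a.2 ≤ z.2 + s := by simpa [timeVec] using hm.2.1
      have h2 : z.2 + s ≤ a.2 + ℓ ^ 2 := by simpa [timeVec] using hm.2.2
      constructor <;> linarith
    have hs' : (1 + |(j : ℝ)|) / 3 * ℓ ^ 2 ≤ |s| := by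
      by_contra h
      exact h0 (hfar s (not_le.1 h))
    rw [indicator_of_mem hs, norm_mul]
    refine mul_le_mul ((abs_truncKernel_le R s).trans ?_) (hφ.abs_le _) (norm_nonneg _) hc
    rw [evenKernel_eq]
    exact inv_anti₀ (by positivity) (Real.rpow_le_rpow (by positivity) hs' (by norm_num))
  refine (norm_integral_le_of_norm_le ((integrable_indicator_iff measurableSet_Icc).2
    (integrableOn_const (by simp))) (Eventually.of_forall hbound)).trans (le_of_eq ?_)
  rw [integral_indicator measurableSet_Icc, setIntegral_const, smul_eq_mul, Real.volume_real_Icc,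
    add_sub_cancel_left, max_eq_left hℓ2.le]
  have e : c = 3 ^ (3 / 2 : ℝ) * (1 + |(j : ℝ)|) ^ (-(3 / 2) : ℝ) * (ℓ ^ 3)⁻¹ := by
    simp only [c]
    rw [Real.mul_rpow (by positivity) (by positivity), Real.div_rpow (by positivity) (by positivity),
      Real.rpow_neg (by positivity), ← Real.rpow_natCast ℓ 2, ← Real.rpow_mul hℓ.le,
      ← Real.rpow_natCast ℓ 3, mul_inv, inv_div]
    norm_num
    left
    ring
  rw [e]
  field_simp

/-- The constant in the decay of half derivatives of bump functions. -/
noncomputable def decayConst : ℝ := 3 ^ (3 / 2 : ℝ) * (2 * evenKernelMass + 1)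

theorem decayConst_nonneg : 0 ≤ decayConst := by
  have := evenKernelMass_nonneg
  unfold decayConst
  positivity

theorem IsTimeBump.abs_diffInt_le_decay (hφ : IsTimeBump φ a ℓ A) (hℓ : 0 < ℓ) (R : ℝ) (j : ℤ)
    {z : SpaceTime n} (hz : z ∈ parabolicCube (a + (j * ℓ ^ 2) • timeVec) ℓ) :
    |diffInt timeVec (truncKernel R) φ z| ≤
      decayConst * (A / ℓ) * (1 + |(j : ℝ)|) ^ (-(3 / 2) : ℝ) := by
  have hA := hφ.height_nonneg
  have hI := evenKernelMass_nonneg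
  have hAℓ : 0 ≤ A / ℓ := by positivity
  rcases le_or_gt 2 |(j : ℝ)| with hj | hj
  · refine (hφ.abs_diffInt_le_of_far hℓ R hj hz).trans ?_
    unfold decayConst
    gcongr
    nlinarith [Real.rpow_pos_of_pos three_pos (3 / 2 : ℝ)]
  · refine (hφ.abs_diffInt_le hℓ R z).trans ?_
    -- For `|j| < 2` one has `1 + |j| ≤ 3`, so the factor `3^(3/2)` cancels the decay and the
    -- uniform bound suffices.
    have h1 : (1 : ℝ) ≤ 3 ^ (3 / 2 : ℝ) * (1 + |(j : ℝ)|) ^ (-(3 / 2) : ℝ) := by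
      rw [Real.rpow_neg (by positivity), ← div_eq_mul_inv, le_div_iff₀ (by positivity), one_mul]
      gcongr
      linarith
    calc 2 * evenKernelMass * (A / ℓ) ≤ (2 * evenKernelMass + 1) * (A / ℓ) * 1 := by nlinarith
      _ ≤ (2 * evenKernelMass + 1) * (A / ℓ) *
          (3 ^ (3 / 2 : ℝ) * (1 + |(j : ℝ)|) ^ (-(3 / 2) : ℝ)) := by gcongr
      _ = _ := by
        unfold decayConst
        ring

/-- The translates fill the whole time column over the cube, and the operator moves points only in
time. -/
theorem IsTimeBump.diffInt_eq_zero (hφ : IsTimeBump φ a ℓ A) (hℓ : 0 < ℓ) (R : ℝ) {z : SpaceTime n}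
    (hz : z ∉ ⋃ j : ℤ, parabolicCube (a + (j * ℓ ^ 2) • timeVec) ℓ) :
    diffInt timeVec (truncKernel R) φ z = 0 := by
  have h0 : ∀ s : ℝ, φ (z + s • timeVec) = 0 := by
    intro s
    refine hφ.eq_zero _ fun h => hz (mem_iUnion.2 ⟨⌊(z.2 - a.2) / ℓ ^ 2⌋, fun i => ?_, ?_⟩)
    · simpa [timeVec] using h.1 i
    · have h1 := Int.floor_le ((z.2 - a.2) / ℓ ^ 2)
      have h2 := (Int.lt_floor_add_one ((z.2 - a.2) / ℓ ^ 2)).le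
      rw [le_div_iff₀ (by positivity)] at h1
      rw [div_le_iff₀ (by positivity)] at h2
      simp only [timeVec, Prod.snd_add, Prod.smul_snd, smul_eq_mul, mul_one, mem_Icc]
      constructor <;> linarith
  refine (integral_congr_ae (Eventually.of_forall fun s => ?_)).trans (integral_zero _ _)
  change truncKernel R s * (φ (z + s • timeVec) - φ z) = 0
  have := h0 0
  rw [zero_smul, add_zero] at this
  rw [h0, this, sub_zero, mul_zero]

theorem summable_one_add_abs_rpow : Summable fun j : ℤ => (1 + |(j : ℝ)|) ^ (-(5 / 4) : ℝ) := by
  have h : Summable fun k : ℕ => (1 + (k : ℝ)) ^ (-(5 / 4) : ℝ) := by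
    have := (summable_nat_add_iff 1).2 (Real.summable_nat_rpow (p := -(5 / 4)) |>.2 (by norm_num))
    refine this.congr fun k => ?_
    push_cast
    rw [add_comm]
  refine Summable.of_nat_of_neg ?_ ?_ <;> simpa using h

/-- The constant in the estimate of half derivatives paired with functions of bounded mean
oscillation. -/
noncomputable def oscillationConst (n : ℕ) : ℝ :=
  ∑' j : ℤ, decayConst * (13 * 2 ^ (n + 2)) * (1 + |(j : ℝ)|) ^ (-(5 / 4) : ℝ)

theorem oscillationConst_nonneg (n : ℕ) : 0 ≤ oscillationConst n :=
  tsum_nonneg fun j => by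
    have := decayConst_nonneg
    positivity

/-- The truncated half derivative is tested against BMO like a sum of atoms with decaying tails:
after subtraction of the average of `h` on the cube, the `j`-th translate contributes `ℓ^(n+2) (1 +
|j|)^(1/4)` times `(A/ℓ) (1 + |j|)^(-3/2)`. The exponents add to `-5/4`, so the sum converges. The
bound does not depend on `R`. -/
theorem IsTimeBump.abs_integral_mul_diffInt_le (hφ : IsTimeBump φ a ℓ A) (hℓ : 0 < ℓ) (R : ℝ)
    {h : SpaceTime n → ℝ} (hh : parabolicBMO h ≤ 1) (hi : LocallyIntegrable h) :
    |∫ z, h z * diffInt timeVec (truncKernel R) φ z| ≤ oscillationConst n * (A * ℓ ^ (n + 1)) := by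
  have hA := hφ.height_nonneg
  have hD := decayConst_nonneg
  set g := diffInt timeVec (truncKernel R) φ with hg
  have hgt : IsTest g := isTest_diffInt_truncKernel hφ.toIsTest R
  set c := cubeAverage h a ℓ
  have hgi : Integrable g := hgt.continuous.integrable_of_hasCompactSupport hgt.hasCompactSupport
  have hhg : Integrable fun z => h z * g z := by
    simpa only [smul_eq_mul, mul_comm] using hi.integrable_smul_left_of_hasCompactSupport
      hgt.continuous hgt.hasCompactSupport
  have h1 : ∫ z, h z * g z = ∫ z, (h z - c) * g z := by
    simp_rw [sub_mul]
    rw [integral_sub hhg (hgi.const_mul c), integral_const_mul, hg,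
      integral_diffInt_truncKernel hφ.toIsTest R, mul_zero, sub_zero]
  set Q : ℤ → Set (SpaceTime n) := fun j => parabolicCube (a + (j * ℓ ^ 2) • timeVec) ℓ
  have hsum := summable_one_add_abs_rpow.mul_left (decayConst * (13 * 2 ^ (n + 2)))
  have h2 : ‖∫ z, (h z - c) * g z‖ₑ ≤ ENNReal.ofReal (oscillationConst n * (A * ℓ ^ (n + 1))) := by
    calc ‖∫ z, (h z - c) * g z‖ₑ ≤ ∫⁻ z, ‖(h z - c) * g z‖ₑ := enorm_integral_le_lintegral_enorm _
      _ = ∫⁻ z in ⋃ j, Q j, ‖(h z - c) * g z‖ₑ := by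
        rw [setLIntegral_eq_of_support_subset]
        intro z hz
        by_contra hzQ
        refine hz ?_
        simp only [hg, hφ.diffInt_eq_zero hℓ R hzQ, mul_zero, enorm_zero]
      _ ≤ ∑' j, ∫⁻ z in Q j, ‖(h z - c) * g z‖ₑ := lintegral_iUnion_le _ _
      _ ≤ ∑' j : ℤ, ENNReal.ofReal ((decayConst * (13 * 2 ^ (n + 2)) *
          (1 + |(j : ℝ)|) ^ (-(5 / 4) : ℝ)) * (A * ℓ ^ (n + 1))) := by
        refine ENNReal.tsum_le_tsum fun j => ?_
        calc ∫⁻ z in Q j, ‖(h z - c) * g z‖ₑ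
            ≤ ∫⁻ z in Q j, ‖h z - c‖ₑ *
              ENNReal.ofReal (decayConst * (A / ℓ) * (1 + |(j : ℝ)|) ^ (-(3 / 2) : ℝ)) := by
              refine setLIntegral_mono' (measurableSet_parabolicCube _ _) fun z hz => ?_
              rw [enorm_mul, ← ofReal_norm (g z)]
              gcongr
              exact hφ.abs_diffInt_le_decay hℓ R j hz
          _ = (∫⁻ z in Q j, ‖h z - c‖ₑ) *
              ENNReal.ofReal (decayConst * (A / ℓ) * (1 + |(j : ℝ)|) ^ (-(3 / 2) : ℝ)) :=
              lintegral_mul_const' _ _ ENNReal.ofReal_ne_top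
          _ ≤ _ := by
              refine (mul_le_mul_left (lintegral_sub_cubeAverage_shift_le hh hi a hℓ j) _).trans ?_
              rw [← ENNReal.ofReal_mul (by positivity)]
              refine ENNReal.ofReal_le_ofReal (le_of_eq ?_)
              have e : (1 + |(j : ℝ)|) ^ (-(5 / 4) : ℝ) =
                  (1 + |(j : ℝ)|) ^ (1 / 4 : ℝ) * (1 + |(j : ℝ)|) ^ (-(3 / 2) : ℝ) := by
                rw [← Real.rpow_add (by positivity)]
                norm_num
              rw [e]
              field_simp
              ring
      _ = ENNReal.ofReal (oscillationConst n * (A * ℓ ^ (n + 1))) := by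
        rw [← ENNReal.ofReal_tsum_of_nonneg (fun j => by positivity) (hsum.mul_right _),
          tsum_mul_right]
        rfl
  rw [h1]
  have h3 := oscillationConst_nonneg n
  rwa [← ofReal_norm, ENNReal.ofReal_le_ofReal_iff (by positivity)] at h2

end ParabolicHeat

namespace ParabolicHeat

/-! ### Growth of the distribution on bump functions -/

variable {n : ℕ}

/-- `φ` is a bump function of height `A` adapted to the parabolic cube `Q(a, ℓ)`. -/
structure IsBump (φ : SpaceTime n → ℝ) (a : SpaceTime n) (ℓ A : ℝ) : Prop extends
    IsTimeBump φ a ℓ A where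
  abs_spaceDeriv_le : ∀ i z, |spaceDeriv i φ z| ≤ A / ℓ

variable {φ : SpaceTime n → ℝ} {a : SpaceTime n} {ℓ A : ℝ}

theorem IsTimeBump.spaceDeriv_eq_zero (hφ : IsTimeBump φ a ℓ A) (i : Fin n) {z : SpaceTime n}
    (hz : z ∉ parabolicCube a ℓ) : spaceDeriv i φ z = 0 := by
  have h : φ =ᶠ[𝓝 z] fun _ => 0 := by
    filter_upwards [(isCompact_parabolicCube a ℓ).isClosed.isOpen_compl.mem_nhds hz] with w hw
    exact hφ.eq_zero w hw
  rw [spaceDeriv, h.fderiv_eq]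
  simp

/-- Size `A / ℓ` times the volume `ℓ^(n+2)` of the cube. -/
theorem IsBump.abs_integral_mul_spaceDeriv_le (hφ : IsBump φ a ℓ A) (hℓ : 0 < ℓ)
    {G : SpaceTime n → EuclideanSpace ℝ (Fin n)} (hG : eLpNorm G ⊤ volume ≤ 1) (i : Fin n) :
    |∫ z, G z i * spaceDeriv i φ z| ≤ A * ℓ ^ (n + 1) := by
  have hA := hφ.height_nonneg
  have hG1 : ∀ᵐ z, ‖G z‖ₑ ≤ 1 := by
    rw [eLpNorm_exponent_top] at hG
    filter_upwards [enorm_ae_le_eLpNormEssSup G volume] with z hz using hz.trans hG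
  rw [← Real.norm_eq_abs]
  refine (norm_integral_le_of_norm_le (g := (parabolicCube a ℓ).indicator fun _ => A / ℓ)
    ((integrable_indicator_iff (measurableSet_parabolicCube a ℓ)).2
    (integrableOn_const (isCompact_parabolicCube a ℓ).measure_lt_top.ne)) ?_).trans (le_of_eq ?_)
  · filter_upwards [hG1] with z hz
    by_cases hzQ : z ∈ parabolicCube a ℓ
    · rw [indicator_of_mem hzQ, norm_mul]
      have h1 : ‖G z‖ ≤ 1 := by
        rw [← ofReal_norm, ENNReal.ofReal_le_one] at hz
        exact hz
      have h2 : ‖G z i‖ ≤ 1 := (PiLp.norm_apply_le (G z) i).trans h1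
      have h3 := hφ.abs_spaceDeriv_le i z
      calc ‖G z i‖ * ‖spaceDeriv i φ z‖ ≤ 1 * (A / ℓ) :=
            mul_le_mul h2 h3 (norm_nonneg _) zero_le_one
        _ = _ := one_mul _
    · rw [indicator_of_notMem hzQ, hφ.spaceDeriv_eq_zero i hzQ, mul_zero, norm_zero]
  · rw [integral_indicator (measurableSet_parabolicCube a ℓ), setIntegral_const, smul_eq_mul,
      measureReal_def, volume_parabolicCube a hℓ.le, ENNReal.toReal_ofReal (by positivity)]
    field_simp
    ring

/-- The constant in the growth condition. -/
noncomputable def growthConst (n : ℕ) : ℝ := n + oscillationConst n / (8 * Real.pi)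

theorem growthConst_nonneg (n : ℕ) : 0 ≤ growthConst n := by
  have := oscillationConst_nonneg n
  have := Real.pi_pos
  unfold growthConst
  positivity

/-- The distribution has growth `ℓ^(n+1)` on bump functions adapted to parabolic cubes. -/
theorem IsBump.abs_apply_le {ν : 𝓓'((⊤ : Opens (SpaceTime n)), ℝ)}
    {G : SpaceTime n → EuclideanSpace ℝ (Fin n)} {h : SpaceTime n → ℝ}
    (hν : IsCompact (Distribution.dsupport ν))
    (hG : IsSpaceGradientPotential ν G) (hG1 : eLpNorm G ⊤ volume ≤ 1)
    (hh : IsHalfTimeDerivPotential ν h) (hh1 : parabolicBMO h ≤ 1)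
    (hφ : IsBump φ a ℓ A) (hℓ : 0 < ℓ) :
    |ν hφ.toIsTest.toTest| ≤ growthConst n * (A * ℓ ^ (n + 1)) := by
  have hA := hφ.height_nonneg
  have hpi := Real.pi_pos
  rw [apply_eq_heatPotential hν hG]
  have h1 : |∑ i, ∫ z, G z i * spaceDeriv i φ z| ≤ n * (A * ℓ ^ (n + 1)) := by
    refine (Finset.abs_sum_le_sum_abs _ _).trans
      ((Finset.sum_le_sum fun i _ => hφ.abs_integral_mul_spaceDeriv_le hℓ hG1 i).trans ?_)
    simp
  -- The estimates for the truncations are uniform in the truncation and therefore pass to the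
  -- limit.
  have h2 : |(-(8 * Real.pi) * heatPotential ν fun z => fderiv ℝ φ z timeVec)| ≤
      oscillationConst n * (A * ℓ ^ (n + 1)) :=
    le_of_tendsto (tendsto_integral_mul_diffInt_truncKernel hν hh hφ.toIsTest).abs
      (Eventually.of_forall fun j => hφ.abs_integral_mul_diffInt_le hℓ j hh1 hh.1)
  rw [abs_mul, abs_neg, abs_of_pos (by positivity), mul_comm, ← le_div_iff₀ (by positivity)] at h2
  refine (abs_sub _ _).trans ((add_le_add h1 h2).trans (le_of_eq ?_))
  unfold growthConst
  ring

end ParabolicHeat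

namespace ParabolicHeat

/-! ### Dyadic bump functions -/

variable {n : ℕ}

/-- The radius of the support of the basic bump function. -/
def bumpRadius (n : ℕ) : ℕ := 2 * n + 4

/-- The basic bump function. -/
noncomputable def baseBump (n : ℕ) : ContDiffBump (0 : SpaceTime n) where
  -- The inner radius exceeds `2 * n + 2`, a bound for the Euclidean norm of a vector with `n`
  -- coordinates in `[-2, 2]`; this is used in `exists_mem_core`.
  rIn := 2 * n + 3
  rOut := bumpRadius n
  rIn_pos := by positivity
  rIn_lt_rOut := by
    unfold bumpRadius
    push_cast
    linarith

theorem exists_fderiv_baseBump_le (n : ℕ) : ∃ B : ℝ, ∀ z : SpaceTime n,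
    ‖fderiv ℝ (baseBump n) z‖ ≤ B := by
  obtain ⟨b, hb⟩ := exists_smoothBounded ((baseBump n).contDiff (n := (⊤ : ℕ∞)))
    (baseBump n).hasCompactSupport
  refine ⟨b 1, fun z => ?_⟩
  have := hb.bound 1 z
  rwa [norm_iteratedFDeriv_one] at this

/-- A bound of the derivative of the basic bump function. -/
noncomputable def bumpSlope (n : ℕ) : ℝ := (exists_fderiv_baseBump_le n).choose

theorem norm_fderiv_baseBump_le (z : SpaceTime n) : ‖fderiv ℝ (baseBump n) z‖ ≤ bumpSlope n :=
  (exists_fderiv_baseBump_le n).choose_spec z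

theorem bumpSlope_nonneg (n : ℕ) : 0 ≤ bumpSlope n :=
  (norm_nonneg _).trans (norm_fderiv_baseBump_le (0 : SpaceTime n))

/-- Indices of dyadic bump functions: a scale `m` and a point of the integer grid. -/
def DyadicIndex (n : ℕ) : Type := ℕ × (Fin n → ℤ) × ℤ

namespace DyadicIndex

/-- Coarse scales come first. -/
noncomputable instance : LinearOrder (DyadicIndex n) :=
  -- Only the scale matters for the estimates; the encoding of the grid point breaks ties to make
  -- the order linear.
  LinearOrder.lift' (fun j : DyadicIndex n => toLex (j.1, Encodable.encode j.2)) fun i j h => by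
    obtain ⟨h1, h2⟩ := Prod.mk.inj (toLex.injective h)
    exact Prod.ext h1 (Encodable.encode_injective h2)

theorem scale_le {i j : DyadicIndex n} (h : i ≤ j) : i.1 ≤ j.1 :=
  Prod.Lex.monotone_fst (toLex (i.1, Encodable.encode i.2)) (toLex (j.1, Encodable.encode j.2)) h

/-- The side length `2^(-m)`. -/
noncomputable def side (j : DyadicIndex n) : ℝ := (2 ^ j.1)⁻¹

theorem side_pos (j : DyadicIndex n) : 0 < j.side := by
  unfold side
  positivity

/-- The parabolic scaling that maps the dyadic cube to the unit cube at the origin. -/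
noncomputable def normalize (j : DyadicIndex n) (z : SpaceTime n) : SpaceTime n :=
  ((2 : ℝ) ^ j.1 • z.1 - WithLp.toLp 2 fun i => (j.2.1 i : ℝ), (4 : ℝ) ^ j.1 * z.2 - j.2.2)

/-- The bump function adapted to a dyadic parabolic cube. -/
noncomputable def bump (j : DyadicIndex n) (z : SpaceTime n) : ℝ := baseBump n (j.normalize z)

theorem contDiff_normalize (j : DyadicIndex n) : ContDiff ℝ (⊤ : ℕ∞) j.normalize := by
  unfold normalize
  fun_prop

theorem contDiff_bump (j : DyadicIndex n) : ContDiff ℝ (⊤ : ℕ∞) j.bump :=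
  (baseBump n).contDiff.comp j.contDiff_normalize

theorem bump_nonneg (j : DyadicIndex n) (z : SpaceTime n) : 0 ≤ j.bump z := (baseBump n).nonneg

theorem bump_le_one (j : DyadicIndex n) (z : SpaceTime n) : j.bump z ≤ 1 := (baseBump n).le_one

theorem fderiv_bump (j : DyadicIndex n) (z v : SpaceTime n) :
    fderiv ℝ j.bump z v =
      fderiv ℝ (baseBump n) (j.normalize z) ((2 : ℝ) ^ j.1 • v.1, (4 : ℝ) ^ j.1 * v.2) := by
  have h1 : HasFDerivAt (baseBump n) (fderiv ℝ (baseBump n) (j.normalize z)) (j.normalize z) :=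
    (((baseBump n).contDiff (n := 1)).differentiable (by simp) _).hasFDerivAt
  have h2 : HasFDerivAt j.normalize
      (((2 : ℝ) ^ j.1 • ContinuousLinearMap.fst ℝ (EuclideanSpace ℝ (Fin n)) ℝ).prod
        ((4 : ℝ) ^ j.1 • ContinuousLinearMap.snd ℝ (EuclideanSpace ℝ (Fin n)) ℝ)) z := by
    refine HasFDerivAt.prodMk ?_ ?_
    · exact ((hasFDerivAt_fst (𝕜 := ℝ) (p := z)).fun_const_smul ((2 : ℝ) ^ j.1)).sub_const _
    · exact ((hasFDerivAt_snd (𝕜 := ℝ) (p := z)).fun_const_smul ((4 : ℝ) ^ j.1)).sub_const _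
  have h3 := (h1.comp z h2).fderiv
  change fderiv ℝ j.bump z = _ at h3
  rw [h3]
  rfl

/-- The integer points near a given one. -/
noncomputable def nearFinset (w : SpaceTime n) : Finset ((Fin n → ℤ) × ℤ) :=
  (Fintype.piFinset fun i => Finset.Icc ⌈w.1 i - bumpRadius n⌉ ⌊w.1 i + bumpRadius n⌋) ×ˢ
    Finset.Icc ⌈w.2 - bumpRadius n⌉ ⌊w.2 + bumpRadius n⌋

theorem card_nearFinset_le (w : SpaceTime n) :
    (nearFinset w).card ≤ (2 * bumpRadius n + 1) ^ (n + 1) := by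
  have h : ∀ u : ℝ, (Finset.Icc ⌈u - bumpRadius n⌉ ⌊u + bumpRadius n⌋).card ≤
      2 * bumpRadius n + 1 := by
    intro u
    rw [Int.card_Icc]
    have h1 := Int.le_ceil (u - bumpRadius n)
    have h2 := Int.floor_le (u + bumpRadius n)
    have h3 : ((⌊u + bumpRadius n⌋ + 1 - ⌈u - bumpRadius n⌉ : ℤ) : ℝ) ≤
        ((2 * bumpRadius n + 1 : ℤ) : ℝ) := by
      push_cast
      linarith
    have := Int.cast_le.1 h3
    omega
  rw [nearFinset, Finset.card_product, Fintype.card_piFinset, pow_succ]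
  refine Nat.mul_le_mul ((Finset.prod_le_pow_card _ _ _ fun i _ => h _).trans ?_) (h _)
  simp

theorem mem_nearFinset (j : DyadicIndex n) {z : SpaceTime n}
    (hz : ‖j.normalize z‖ ≤ bumpRadius n) :
    j.2 ∈ nearFinset ((2 : ℝ) ^ j.1 • z.1, (4 : ℝ) ^ j.1 * z.2) := by
  have h1 := abs_le.1 ((norm_snd_le _).trans hz)
  have h2 : ∀ i, |(2 : ℝ) ^ j.1 * z.1 i - j.2.1 i| ≤ bumpRadius n := fun i =>
    (PiLp.norm_apply_le (j.normalize z).1 i).trans ((norm_fst_le _).trans hz)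
  simp only [normalize] at h1
  rw [nearFinset, Finset.mem_product, Fintype.mem_piFinset]
  refine ⟨fun i => Finset.mem_Icc.2 ⟨Int.ceil_le.2 ?_, Int.le_floor.2 ?_⟩,
    Finset.mem_Icc.2 ⟨Int.ceil_le.2 ?_, Int.le_floor.2 ?_⟩⟩
  · have := abs_le.1 (h2 i)
    simp only [PiLp.smul_apply, smul_eq_mul]
    linarith
  · have := abs_le.1 (h2 i)
    simp only [PiLp.smul_apply, smul_eq_mul]
    linarith
  · linarith
  · linarith

/-- The overlap constant. -/
noncomputable def overlap (n : ℕ) : ℝ := (2 * bumpRadius n + 1) ^ (n + 1)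

theorem overlap_nonneg (n : ℕ) : 0 ≤ overlap n := by
  unfold overlap
  positivity

theorem fderiv_bump_eq_zero (j : DyadicIndex n) {z : SpaceTime n}
    (hz : ¬ ‖j.normalize z‖ ≤ bumpRadius n) (v : SpaceTime n) : fderiv ℝ j.bump z v = 0 := by
  rw [fderiv_bump, fderiv_of_notMem_tsupport]
  · rfl
  · rw [(baseBump n).tsupport_eq]
    simpa [baseBump] using hz

/-- A sum of derivatives of dyadic bump functions is controlled by its finest scale. -/
theorem sum_abs_fderiv_bump_le (T : Finset (DyadicIndex n)) {M : ℕ} (hT : ∀ j ∈ T, j.1 ≤ M)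
    {q : ℝ} (hq : 2 ≤ q) {v z : SpaceTime n}
    (hv : ∀ j : DyadicIndex n, |fderiv ℝ j.bump z v| ≤ bumpSlope n * q ^ j.1) :
    ∑ j ∈ T, |fderiv ℝ j.bump z v| ≤ 2 * bumpSlope n * overlap n * q ^ M := by
  classical
  have hB := bumpSlope_nonneg n
  have hN := overlap_nonneg n
  -- At each scale at most `overlap n` bumps have a nonzero derivative at `z`, and since `q ≥ 2` the
  -- geometric sum over scales is dominated by its last term.
  have hgeom : ∀ M : ℕ, ∑ m ∈ Finset.range (M + 1), q ^ m ≤ 2 * q ^ M := by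
    intro M
    induction M with
    | zero => simp
    | succ M ih =>
      rw [Finset.sum_range_succ, pow_succ]
      nlinarith [pow_pos (by linarith : 0 < q) M]
  have hmaps : ∀ j ∈ T, j.1 ∈ Finset.range (M + 1) :=
    fun j hj => Finset.mem_range_succ_iff.2 (hT j hj)
  rw [← Finset.sum_fiberwise_of_maps_to hmaps]
  have hm : ∀ m, ∑ j ∈ T with j.1 = m, |fderiv ℝ j.bump z v| ≤
      overlap n * (bumpSlope n * q ^ m) := by
    intro m
    have h1 : ∑ j ∈ T with j.1 = m, |fderiv ℝ j.bump z v| =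
        ∑ j ∈ (T.filter fun j => j.1 = m).filter fun j => ‖j.normalize z‖ ≤ bumpRadius n,
          |fderiv ℝ j.bump z v| := by
      refine (Finset.sum_filter_of_ne fun j _ hj => ?_).symm
      by_contra h
      exact hj (by rw [fderiv_bump_eq_zero j h, abs_zero])
    rw [h1]
    have h2 : ∀ j ∈ (T.filter fun j => j.1 = m).filter fun j => ‖j.normalize z‖ ≤ bumpRadius n,
        |fderiv ℝ j.bump z v| ≤ bumpSlope n * q ^ m := by
      intro j hj
      have := hv j
      rwa [(Finset.mem_filter.1 (Finset.mem_filter.1 hj).1).2] at this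
    refine (Finset.sum_le_card_nsmul _ _ _ h2).trans ?_
    rw [nsmul_eq_mul]
    refine mul_le_mul_of_nonneg_right ?_ (by positivity)
    have h3 : ((T.filter fun j => j.1 = m).filter fun j =>
        ‖j.normalize z‖ ≤ bumpRadius n).card ≤ (2 * bumpRadius n + 1) ^ (n + 1) := by
      refine le_trans ?_ (card_nearFinset_le ((2 : ℝ) ^ m • z.1, (4 : ℝ) ^ m * z.2))
      refine Finset.card_le_card_of_injOn (fun j : DyadicIndex n => j.2) ?_ ?_
      · intro j hj
        obtain ⟨hj1, hj2⟩ := Finset.mem_filter.1 (Finset.mem_coe.1 hj)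
        have := mem_nearFinset j hj2
        rw [(Finset.mem_filter.1 hj1).2] at this
        exact this
      · intro i hi j hj hij
        have hi1 := (Finset.mem_filter.1 (Finset.mem_filter.1 (Finset.mem_coe.1 hi)).1).2
        have hj1 := (Finset.mem_filter.1 (Finset.mem_filter.1 (Finset.mem_coe.1 hj)).1).2
        exact Prod.ext (hi1.trans hj1.symm) hij
    unfold overlap
    exact_mod_cast h3
  calc _ ≤ ∑ m ∈ Finset.range (M + 1), overlap n * (bumpSlope n * q ^ m) :=
        Finset.sum_le_sum fun m _ => hm m
    _ = overlap n * bumpSlope n * ∑ m ∈ Finset.range (M + 1), q ^ m := by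
        rw [Finset.mul_sum]
        exact Finset.sum_congr rfl fun m _ => by ring
    _ ≤ overlap n * bumpSlope n * (2 * q ^ M) := by gcongr; exact hgeom M
    _ = _ := by ring

theorem abs_fderiv_bump_space_le (j : DyadicIndex n) (i : Fin n) (z : SpaceTime n) :
    |fderiv ℝ j.bump z (EuclideanSpace.single i 1, 0)| ≤ bumpSlope n * 2 ^ j.1 := by
  rw [fderiv_bump]
  have e : (((2 : ℝ) ^ j.1 • (EuclideanSpace.single i 1 : EuclideanSpace ℝ (Fin n)),
      (4 : ℝ) ^ j.1 * (0 : ℝ)) : SpaceTime n) =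
      (2 : ℝ) ^ j.1 • ((EuclideanSpace.single i 1, 0) : SpaceTime n) := by
    simp
  rw [e, map_smul, smul_eq_mul, abs_mul, abs_of_pos (by positivity), mul_comm]
  refine mul_le_mul_of_nonneg_right ?_ (by positivity)
  refine ((fderiv ℝ (baseBump n) _).le_opNorm _).trans ?_
  exact (mul_le_of_le_one_right (norm_nonneg _) (norm_spaceVec_le i)).trans
    (norm_fderiv_baseBump_le _)

theorem abs_fderiv_bump_time_le (j : DyadicIndex n) (z : SpaceTime n) :
    |fderiv ℝ j.bump z timeVec| ≤ bumpSlope n * 4 ^ j.1 := by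
  rw [fderiv_bump]
  have e : (((2 : ℝ) ^ j.1 • (timeVec : SpaceTime n).1,
      (4 : ℝ) ^ j.1 * (timeVec : SpaceTime n).2) : SpaceTime n) =
      (4 : ℝ) ^ j.1 • (timeVec : SpaceTime n) := by
    simp [timeVec]
  rw [e, map_smul, smul_eq_mul, abs_mul, abs_of_pos (by positivity), mul_comm]
  refine mul_le_mul_of_nonneg_right ?_ (by positivity)
  refine ((fderiv ℝ (baseBump n) _).le_opNorm _).trans ?_
  exact (mul_le_of_le_one_right (norm_nonneg _) norm_timeVec_le).trans
    (norm_fderiv_baseBump_le _)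

/-- The corner of the parabolic cube that contains the support of the bump function. -/
noncomputable def corner (j : DyadicIndex n) : SpaceTime n :=
  (j.side • (WithLp.toLp 2 fun i => (j.2.1 i : ℝ) - bumpRadius n), j.side ^ 2 * (j.2.2 - bumpRadius n))

theorem mem_parabolicCube (j : DyadicIndex n) {z : SpaceTime n}
    (hz : ‖j.normalize z‖ ≤ bumpRadius n) :
    z ∈ parabolicCube j.corner (2 * bumpRadius n * j.side) := by
  have h1 := abs_le.1 ((norm_snd_le _).trans hz)
  have h2 : ∀ i, |(2 : ℝ) ^ j.1 * z.1 i - j.2.1 i| ≤ bumpRadius n := fun i =>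
    (PiLp.norm_apply_le (j.normalize z).1 i).trans ((norm_fst_le _).trans hz)
  simp only [normalize] at h1
  have hs := j.side_pos
  have e2 : j.side * 2 ^ j.1 = 1 := inv_mul_cancel₀ (by positivity)
  have e4 : j.side ^ 2 * 4 ^ j.1 = 1 := by
    rw [show (4 : ℝ) = 2 ^ 2 by norm_num, ← pow_mul, mul_comm 2, pow_mul, ← mul_pow, e2, one_pow]
  have hΛ : (1 : ℝ) ≤ bumpRadius n := by
    unfold bumpRadius
    push_cast
    linarith [(Nat.cast_nonneg n : (0 : ℝ) ≤ n)]
  have key : ∀ r x c k Λ : ℝ, 0 < r → r * c = 1 → -Λ ≤ c * x - k → c * x - k ≤ Λ →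
      r * (k - Λ) ≤ x ∧ x ≤ r * (k - Λ) + 2 * Λ * r := by
    intro r x c k Λ hr hrc h3 h4
    have h5 := mul_le_mul_of_nonneg_left h3 hr.le
    have h6 := mul_le_mul_of_nonneg_left h4 hr.le
    have h7 : r * (c * x - k) = x - r * k := by
      rw [mul_sub, ← mul_assoc, hrc, one_mul]
    constructor <;> linarith
  refine ⟨fun i => ?_, ?_⟩
  · have := abs_le.1 (h2 i)
    exact key j.side (z.1 i) _ _ _ hs e2 this.1 this.2
  · have h := key (j.side ^ 2) z.2 _ _ _ (by positivity) e4 h1.1 h1.2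
    refine ⟨h.1, h.2.trans ?_⟩
    simp only [corner]
    -- The bump needs a time interval of length `2Λr²`, where `Λ = bumpRadius n` and `r = side`; the
    -- parabolic cube of side `2Λr` offers `(2Λr)²`, which is longer.
    have : 2 * (bumpRadius n : ℝ) ≤ (2 * bumpRadius n) ^ 2 := by nlinarith
    rw [mul_pow]
    nlinarith [sq_nonneg j.side]

theorem bump_eq_zero (j : DyadicIndex n) {z : SpaceTime n}
    (hz : z ∉ parabolicCube j.corner (2 * bumpRadius n * j.side)) : j.bump z = 0 := by
  refine (baseBump n).zero_of_le_dist ?_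
  rw [dist_zero_right]
  by_contra h
  exact hz (j.mem_parabolicCube (not_le.1 h).le)

/-- The open set on which the bump function is one. -/
def core (j : DyadicIndex n) : Set (SpaceTime n) := j.normalize ⁻¹' Metric.ball 0 (2 * n + 3)

theorem isOpen_core (j : DyadicIndex n) : IsOpen j.core :=
  Metric.isOpen_ball.preimage j.contDiff_normalize.continuous

theorem bump_eq_one (j : DyadicIndex n) {z : SpaceTime n} (hz : z ∈ j.core) : j.bump z = 1 :=
  (baseBump n).one_of_mem_closedBall (Metric.ball_subset_closedBall hz)

/-- A set of small parabolic diameter lies in the core of a dyadic bump function. -/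
theorem exists_mem_core (m : ℕ) (w : SpaceTime n) : ∃ j : DyadicIndex n, j.1 = m ∧
    ∀ z : SpaceTime n, ‖z.1 - w.1‖ ≤ (2 ^ m)⁻¹ → |z.2 - w.2| ≤ ((2 ^ m)⁻¹) ^ 2 → z ∈ j.core := by
  refine ⟨(m, fun i => ⌊(2 : ℝ) ^ m * w.1 i⌋, ⌊(4 : ℝ) ^ m * w.2⌋), rfl, fun z h1 h2 => ?_⟩
  -- One unit comes from the distance of the points after scaling, the other from rounding down to
  -- the grid.
  have key : ∀ c x y : ℝ, 0 < c → |x - y| ≤ c⁻¹ → |c * x - ⌊c * y⌋| ≤ 2 := by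
    intro c x y hc h
    have h3 : |c * x - c * y| ≤ 1 := by
      rw [← mul_sub, abs_mul, abs_of_pos hc]
      calc c * |x - y| ≤ c * c⁻¹ := by gcongr
        _ = 1 := mul_inv_cancel₀ hc.ne'
    have h4 := abs_le.1 h3
    have h5 := Int.floor_le (c * y)
    have h6 := Int.lt_floor_add_one (c * y)
    rw [abs_le]
    constructor <;> linarith
  have e4 : ((2 ^ m)⁻¹ : ℝ) ^ 2 = (4 ^ m)⁻¹ := by
    rw [inv_pow, ← pow_mul, mul_comm, pow_mul]
    norm_num
  rw [e4] at h2
  have hn : (0 : ℝ) ≤ n := Nat.cast_nonneg n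
  refine mem_ball_zero_iff.2 ?_
  refine max_lt ?_ ?_
  · refine lt_of_le_of_lt (b := (2 * n + 2 : ℝ)) ?_ (by linarith)
    refine abs_le_of_sq_le_sq' ?_ (by positivity) |>.2
    rw [EuclideanSpace.real_norm_sq_eq]
    calc _ ≤ ∑ i : Fin n, (4 : ℝ) := by
          refine Finset.sum_le_sum fun i _ => ?_
          have h3 := key (2 ^ m) (z.1 i) (w.1 i) (by positivity)
            ((PiLp.norm_apply_le (z.1 - w.1) i).trans h1)
          have := sq_le_sq' (abs_le.1 h3).1 (abs_le.1 h3).2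
          refine this.trans (by norm_num)
      _ ≤ _ := by
          rw [Finset.sum_const, Finset.card_univ, Fintype.card_fin, nsmul_eq_mul]
          nlinarith
  · refine lt_of_le_of_lt (key (4 ^ m) z.2 w.2 (by positivity) h2) (by linarith)

end DyadicIndex

end ParabolicHeat

namespace ParabolicHeat

/-! ### A partition of unity with several scales -/

section Prod

variable {V ι : Type*} [NormedAddCommGroup V] [NormedSpace ℝ V]

theorem fderiv_mul_apply {u w : V → ℝ} {z : V} (hu : DifferentiableAt ℝ u z)
    (hw : DifferentiableAt ℝ w z) (v : V) :
    fderiv ℝ (fun x => u x * w x) z v = u z * fderiv ℝ w z v + w z * fderiv ℝ u z v := by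
  rw [fderiv_fun_mul hu hw]
  rfl

theorem abs_fderiv_mul_le {u w : V → ℝ} {z : V} (hu : DifferentiableAt ℝ u z)
    (hw : DifferentiableAt ℝ w z) {M : ℝ} (huM : |u z| ≤ M) (hw1 : |w z| ≤ 1) (v : V) :
    |fderiv ℝ (fun x => u x * w x) z v| ≤ |fderiv ℝ u z v| + M * |fderiv ℝ w z v| := by
  rw [fderiv_mul_apply hu hw, add_comm]
  refine (abs_add_le _ _).trans (add_le_add ?_ ?_)
  · rw [abs_mul]
    exact mul_le_of_le_one_left (abs_nonneg _) hw1
  · rw [abs_mul]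
    exact mul_le_mul_of_nonneg_right huM (abs_nonneg _)

theorem abs_fderiv_prod_le (s : Finset ι) {u : ι → V → ℝ} (hu : ∀ i, Differentiable ℝ (u i))
    (h1 : ∀ i z, |u i z| ≤ 1) (z v : V) :
    |fderiv ℝ (fun x => ∏ i ∈ s, u i x) z v| ≤ ∑ i ∈ s, |fderiv ℝ (u i) z v| := by
  classical
  induction s using Finset.induction_on with
  | empty => simp
  | insert a s ha ih =>
    simp_rw [Finset.prod_insert ha]
    rw [Finset.sum_insert ha]
    have hp : |∏ i ∈ s, u i z| ≤ 1 := by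
      rw [Finset.abs_prod]
      exact Finset.prod_le_one (fun i _ => abs_nonneg _) fun i _ => h1 i z
    have hd : DifferentiableAt ℝ (fun x => ∏ i ∈ s, u i x) z :=
      (HasFDerivAt.finsetProd fun i _ => (hu i z).hasFDerivAt).differentiableAt
    have := abs_fderiv_mul_le (hu a z) hd (h1 a z) hp v
    linarith

end Prod

variable {n : ℕ}

namespace DyadicIndex

theorem differentiable_bump (j : DyadicIndex n) : Differentiable ℝ j.bump :=
  j.contDiff_bump.differentiable (by simp)

/-- The members of the partition of unity. -/
noncomputable def piece (J : Finset (DyadicIndex n)) (j : DyadicIndex n) (z : SpaceTime n) : ℝ :=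
  j.bump z * ∏ i ∈ J with i < j, (1 - i.bump z)

/-- The bumps are peeled off one after another. The remaining product vanishes on every core, hence
near the part of the support that the cores cover. -/
theorem sum_piece (J : Finset (DyadicIndex n)) (z : SpaceTime n) :
    ∑ j ∈ J, piece J j z + ∏ j ∈ J, (1 - j.bump z) = 1 := by
  rw [Finset.prod_one_sub_ordered]
  unfold piece
  ring

theorem abs_one_sub_bump_le (j : DyadicIndex n) (z : SpaceTime n) : |1 - j.bump z| ≤ 1 := by
  rw [abs_le]
  constructor <;> linarith [j.bump_nonneg z, j.bump_le_one z]

theorem abs_prod_one_sub_bump_le (J : Finset (DyadicIndex n)) (z : SpaceTime n) :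
    |∏ j ∈ J, (1 - j.bump z)| ≤ 1 := by
  rw [Finset.abs_prod]
  exact Finset.prod_le_one (fun i _ => abs_nonneg _) fun i _ => i.abs_one_sub_bump_le z

theorem contDiff_prod_one_sub_bump (J : Finset (DyadicIndex n)) :
    ContDiff ℝ (⊤ : ℕ∞) fun z => ∏ j ∈ J, (1 - j.bump z) :=
  contDiff_prod fun i _ => contDiff_const.sub i.contDiff_bump

theorem contDiff_piece (J : Finset (DyadicIndex n)) (j : DyadicIndex n) :
    ContDiff ℝ (⊤ : ℕ∞) (piece J j) :=
  j.contDiff_bump.mul (contDiff_prod_one_sub_bump _)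

theorem abs_piece_le (J : Finset (DyadicIndex n)) (j : DyadicIndex n) (z : SpaceTime n) :
    |piece J j z| ≤ 1 := by
  rw [piece, abs_mul, abs_of_nonneg (j.bump_nonneg z)]
  exact mul_le_one₀ (j.bump_le_one z) (abs_nonneg _) (abs_prod_one_sub_bump_le _ z)

/-- A piece involves, besides its own bump, only bumps earlier in the order, whose scales are at
least as coarse. Its derivatives are therefore of the size natural for its own scale, however many
scales overlap at the point. -/
theorem abs_fderiv_piece_le (J : Finset (DyadicIndex n)) (j : DyadicIndex n)
    {q : ℝ} (hq : 2 ≤ q) {v z : SpaceTime n}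
    (hv : ∀ j : DyadicIndex n, |fderiv ℝ j.bump z v| ≤ bumpSlope n * q ^ j.1) :
    |fderiv ℝ (piece J j) z v| ≤ 2 * bumpSlope n * overlap n * q ^ j.1 := by
  refine le_trans ?_ (sum_abs_fderiv_bump_le (insert j (J.filter (· < j))) (M := j.1) ?_ hq hv)
  · rw [Finset.sum_insert (by simp)]
    have h1 := abs_fderiv_mul_le (u := j.bump) (w := fun x => ∏ i ∈ J with i < j, (1 - i.bump x))
      (j.differentiable_bump z)
      ((contDiff_prod_one_sub_bump _).differentiable (by simp) z) (M := 1)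
      (by rw [abs_of_nonneg (j.bump_nonneg z)]; exact j.bump_le_one z)
      (abs_prod_one_sub_bump_le _ z) v
    have h2 := abs_fderiv_prod_le (J.filter (· < j)) (u := fun i x => 1 - i.bump x)
      (fun i => (differentiable_const 1).sub i.differentiable_bump)
      (fun i => i.abs_one_sub_bump_le) z v
    have h3 : ∀ i : DyadicIndex n, |fderiv ℝ (fun x => 1 - i.bump x) z v| =
        |fderiv ℝ i.bump z v| := by
      intro i
      rw [fderiv_const_sub]
      exact abs_neg _
    simp_rw [h3] at h2
    rw [one_mul] at h1
    exact h1.trans (add_le_add le_rfl h2)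
  · intro i hi
    rcases Finset.mem_insert.1 hi with rfl | hi
    · exact le_rfl
    · exact scale_le (Finset.mem_filter.1 hi).2.le

/-- The side length of the parabolic cube that contains the support of the bump function. -/
noncomputable def supportSide (j : DyadicIndex n) : ℝ := 2 * bumpRadius n * j.side

theorem bumpRadius_pos (n : ℕ) : (1 : ℝ) ≤ bumpRadius n := by
  unfold bumpRadius
  push_cast
  linarith [(Nat.cast_nonneg n : (0 : ℝ) ≤ n)]

theorem supportSide_pos (j : DyadicIndex n) : 0 < j.supportSide := by
  have := bumpRadius_pos n
  have := j.side_pos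
  unfold supportSide
  positivity

end DyadicIndex

/-- The constant in the estimate of the pieces of a test function. -/
noncomputable def pieceConst (n : ℕ) : ℝ :=
  1 + 2 * bumpSlope n * DyadicIndex.overlap n * (2 * bumpRadius n) ^ 2

theorem one_le_pieceConst (n : ℕ) : 1 ≤ pieceConst n := by
  have := bumpSlope_nonneg n
  have := DyadicIndex.overlap_nonneg n
  unfold pieceConst
  have : 0 ≤ 2 * bumpSlope n * DyadicIndex.overlap n * (2 * bumpRadius n) ^ 2 := by positivity
  linarith

/-- The hypotheses `hs` and `ht` say that `φ` varies slowly at the scale of `j`, so the product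
inherits the bounds of the piece. The constant is dictated by the time derivative; the spatial one
needs only the first power of `2 * bumpRadius n`. -/
theorem isBump_mul_piece {φ : SpaceTime n → ℝ} (hφ : IsTest φ) {M : ℝ} (hM : ∀ z, |φ z| ≤ M)
    (J : Finset (DyadicIndex n)) (j : DyadicIndex n)
    (hs : ∀ i z, |spaceDeriv i φ z| ≤ M / j.supportSide)
    (ht : ∀ z, |fderiv ℝ φ z timeVec| ≤ M / j.supportSide ^ 2) :
    IsBump (fun z => φ z * DyadicIndex.piece J j z) j.corner j.supportSide (pieceConst n * M) := by
  have hM0 : 0 ≤ M := (abs_nonneg _).trans (hM 0)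
  have hC := one_le_pieceConst n
  have hB := bumpSlope_nonneg n
  have hN := DyadicIndex.overlap_nonneg n
  have hΛ := DyadicIndex.bumpRadius_pos n
  have hj := j.side_pos
  have hjs := j.supportSide_pos
  have hd : Differentiable ℝ φ := hφ.contDiff.differentiable (by simp)
  have hdp : Differentiable ℝ (DyadicIndex.piece J j) :=
    (DyadicIndex.contDiff_piece J j).differentiable (by simp)
  have e2 : (2 : ℝ) ^ j.1 = 2 * bumpRadius n / j.supportSide := by
    rw [DyadicIndex.supportSide, DyadicIndex.side]
    field_simp
  have e4 : (4 : ℝ) ^ j.1 = (2 * bumpRadius n) ^ 2 / j.supportSide ^ 2 := by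
    rw [← div_pow, ← e2, ← pow_mul, mul_comm, pow_mul]
    norm_num
  refine ⟨⟨⟨hφ.contDiff.mul (DyadicIndex.contDiff_piece J j), hφ.hasCompactSupport.mul_right⟩,
    fun z hz => ?_, fun z => ?_, fun z => ?_⟩, fun i z => ?_⟩
  · change φ z * (j.bump z * _) = 0
    rw [j.bump_eq_zero hz, zero_mul, mul_zero]
  · rw [abs_mul]
    have := mul_le_mul (hM z) (DyadicIndex.abs_piece_le J j z) (abs_nonneg _) hM0
    nlinarith
  · refine (abs_fderiv_mul_le (hd z) (hdp z) (hM z) (DyadicIndex.abs_piece_le J j z) _).trans ?_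
    have h1 := DyadicIndex.abs_fderiv_piece_le J j (q := 4) (by norm_num) (v := timeVec) (z := z)
      fun i => i.abs_fderiv_bump_time_le z
    refine (add_le_add (ht z) (mul_le_mul_of_nonneg_left h1 hM0)).trans (le_of_eq ?_)
    rw [e4, pieceConst]
    ring
  · refine (abs_fderiv_mul_le (hd z) (hdp z) (hM z) (DyadicIndex.abs_piece_le J j z) _).trans ?_
    have h1 := DyadicIndex.abs_fderiv_piece_le J j (q := 2) (by norm_num)
      (v := (EuclideanSpace.single i 1, 0)) (z := z) fun k => k.abs_fderiv_bump_space_le i z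
    refine (add_le_add (hs i z) (mul_le_mul_of_nonneg_left h1 hM0)).trans ?_
    rw [e2, pieceConst]
    have h2 : (2 * bumpRadius n : ℝ) ≤ (2 * bumpRadius n) ^ 2 := by nlinarith
    calc _ = (1 + 2 * bumpSlope n * DyadicIndex.overlap n * (2 * bumpRadius n)) * M /
          j.supportSide := by ring
      _ ≤ _ := by gcongr

/-- The constant in the estimate of the distribution by a cover. -/
noncomputable def coverConst (n : ℕ) : ℝ :=
  growthConst n * pieceConst n * (2 * bumpRadius n) ^ (n + 1)

theorem coverConst_nonneg (n : ℕ) : 0 ≤ coverConst n := by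
  have := growthConst_nonneg n
  have := one_le_pieceConst n
  unfold coverConst
  positivity

/-- The distribution is controlled by a cover of the part of `E` in the support of the test
function. -/
theorem abs_apply_le_sum {ν : 𝓓'((⊤ : Opens (SpaceTime n)), ℝ)}
    {G : SpaceTime n → EuclideanSpace ℝ (Fin n)} {h : SpaceTime n → ℝ}
    (hν : IsCompact (Distribution.dsupport ν))
    (hG : IsSpaceGradientPotential ν G) (hG1 : eLpNorm G ⊤ volume ≤ 1)
    (hh : IsHalfTimeDerivPotential ν h) (hh1 : parabolicBMO h ≤ 1)
    {φ : SpaceTime n → ℝ} (hφ : IsTest φ) {M : ℝ} (hM : ∀ z, |φ z| ≤ M)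
    (J : Finset (DyadicIndex n))
    (hs : ∀ j ∈ J, ∀ i z, |spaceDeriv i φ z| ≤ M / j.supportSide)
    (ht : ∀ j ∈ J, ∀ z, |fderiv ℝ φ z timeVec| ≤ M / j.supportSide ^ 2)
    (hJ : tsupport φ ∩ Distribution.dsupport ν ⊆ ⋃ j ∈ J, j.core) :
    |ν hφ.toTest| ≤ coverConst n * M * ∑ j ∈ J, j.side ^ (n + 1) := by
  classical
  have hp : ∀ j, IsTest fun z => φ z * DyadicIndex.piece J j z := fun j =>
    ⟨hφ.contDiff.mul (DyadicIndex.contDiff_piece J j), hφ.hasCompactSupport.mul_right⟩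
  have hr : IsTest fun z => φ z * ∏ j ∈ J, (1 - j.bump z) :=
    ⟨hφ.contDiff.mul (DyadicIndex.contDiff_prod_one_sub_bump J), hφ.hasCompactSupport.mul_right⟩
  have hsum : hφ.toTest = ∑ j ∈ J, (hp j).toTest + hr.toTest := by
    ext z
    change φ z = (∑ j ∈ J, (hp j).toTest) z + φ z * ∏ j ∈ J, (1 - j.bump z)
    rw [FunLike.coe_sum, Finset.sum_apply]
    change φ z = ∑ j ∈ J, φ z * DyadicIndex.piece J j z + φ z * ∏ j ∈ J, (1 - j.bump z)
    rw [← Finset.mul_sum, ← mul_add, DyadicIndex.sum_piece, mul_one]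
  -- Near each point of the support of `ν` the remainder vanishes: inside a core one factor of the
  -- product is zero, and off `tsupport φ` the function `φ` is zero.
  have hr0 : ν hr.toTest = 0 := by
    apply apply_eq_zero_of_disjoint_dsupport
    rw [Set.disjoint_right]
    intro z hz
    rw [notMem_tsupport_iff_eventuallyEq]
    change (fun z => φ z * ∏ j ∈ J, (1 - j.bump z)) =ᶠ[𝓝 z] 0
    by_cases hzφ : z ∈ tsupport φ
    · obtain ⟨j, hj, hzj⟩ := mem_iUnion₂.1 (hJ ⟨hzφ, hz⟩)
      filter_upwards [j.isOpen_core.mem_nhds hzj] with w hw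
      rw [Finset.prod_eq_zero hj (by rw [j.bump_eq_one hw, sub_self]), mul_zero]
      rfl
    · filter_upwards [notMem_tsupport_iff_eventuallyEq.1 hzφ] with w hw
      rw [hw, Pi.zero_apply, zero_mul]
  rw [hsum, map_add, hr0, add_zero, map_sum]
  refine (Finset.abs_sum_le_sum_abs _ _).trans ?_
  rw [Finset.mul_sum]
  refine Finset.sum_le_sum fun j hj => ?_
  refine (IsBump.abs_apply_le hν hG hG1 hh hh1
    (isBump_mul_piece hφ hM J j (hs j hj) (ht j hj)) j.supportSide_pos).trans (le_of_eq ?_)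
  rw [DyadicIndex.supportSide, mul_pow, coverConst]
  ring

end ParabolicHeat

namespace ParabolicHeat

/-! ### Dyadic covers and parabolic Hausdorff measure -/

variable {n : ℕ}

/-- A set of small parabolic diameter lies in the core of a dyadic bump function of comparable
size. -/
theorem exists_subset_core {t : Set (ParabolicSpace n)} (m₀ : ℕ)
    (ht : Metric.ediam t ≤ ENNReal.ofReal (2 ^ m₀)⁻¹) {τ : NNReal} (hτ : 0 < τ) :
    ∃ j : DyadicIndex n, m₀ ≤ j.1 ∧ toParabolic ⁻¹' t ⊆ j.core ∧
      ENNReal.ofReal (j.side ^ (n + 1)) ≤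
        2 ^ (n + 1) * ((⨆ _ : t.Nonempty, Metric.ediam t ^ ((n : ℝ) + 1)) + τ) := by
  have hfin : Metric.ediam t ≠ ∞ := (ht.trans_lt ENNReal.ofReal_lt_top).ne
  set x := (Metric.ediam t).toReal
  have hx0 : 0 ≤ x := ENNReal.toReal_nonneg
  have hx : x ≤ (2 ^ m₀)⁻¹ := ENNReal.toReal_le_of_le_ofReal (by positivity) ht
  have hxe : ENNReal.ofReal x = Metric.ediam t := ENNReal.ofReal_toReal hfin
  have hm1 : ((2 : ℝ) ^ m₀)⁻¹ ≤ 1 := inv_le_one_of_one_le₀ (one_le_pow₀ (by norm_num))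
  have hm0 : (0 : ℝ) < (2 ^ m₀)⁻¹ := by positivity
  -- A set of diameter zero has no natural scale, so diameters are raised to at least `δ`. As `δ ≤
  -- 1`, this costs at most `δ^(n+1) ≤ δ ≤ τ`.
  set δ : ℝ := min τ (2 ^ m₀)⁻¹
  have hδ : 0 < δ := lt_min hτ hm0
  set y := max x δ
  have hy : 0 < y := lt_max_of_lt_right hδ
  have hym : y ≤ (2 ^ m₀)⁻¹ := max_le hx (min_le_right _ _)
  -- The scale with `2^(-m-1) < y ≤ 2^(-m)`; rounding up to a dyadic size costs the factor
  -- `2^(n+1)`.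
  obtain ⟨m, hm, hm'⟩ := exists_nat_pow_near_of_lt_one hy (hym.trans hm1)
    (by norm_num : (0 : ℝ) < 2⁻¹) (by norm_num)
  have hmm : m₀ ≤ m := by
    have : (2⁻¹ : ℝ) ^ (m + 1) < 2⁻¹ ^ m₀ := hm.trans_le (by rwa [inv_pow])
    have := (pow_lt_pow_iff_right_of_lt_one₀ (by norm_num) (by norm_num)).1 this
    omega
  rw [inv_pow] at hm'
  have hsum : ∀ j : DyadicIndex n, j.1 = m → ENNReal.ofReal (j.side ^ (n + 1)) ≤
      2 ^ (n + 1) * ((⨆ _ : t.Nonempty, Metric.ediam t ^ ((n : ℝ) + 1)) + τ) := by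
    intro j hj
    have h1 : j.side ≤ 2 * y := by
      rw [DyadicIndex.side, hj]
      rw [pow_succ, inv_pow] at hm
      linarith
    have h2 : j.side ^ (n + 1) ≤ 2 ^ (n + 1) * (x ^ (n + 1) + τ) := by
      have := j.side_pos
      refine (pow_le_pow_left₀ this.le h1 _).trans ?_
      rw [mul_pow]
      refine mul_le_mul_of_nonneg_left ?_ (by positivity)
      rcases le_total δ x with h | h
      · simp only [y, max_eq_left h]
        linarith [τ.coe_nonneg]
      · simp only [y, max_eq_right h]
        have h3 : δ ^ (n + 1) ≤ δ :=
          pow_le_of_le_one hδ.le ((min_le_right _ _).trans hm1) (Nat.succ_ne_zero n)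
        have h4 : δ ≤ τ := min_le_left _ _
        have : 0 ≤ x ^ (n + 1) := by positivity
        linarith
    refine (ENNReal.ofReal_le_ofReal h2).trans ?_
    rw [ENNReal.ofReal_mul (by positivity), ENNReal.ofReal_add (by positivity) τ.coe_nonneg,
      ENNReal.ofReal_pow (by norm_num), ENNReal.ofReal_ofNat, ENNReal.ofReal_coe_nnreal]
    gcongr
    rw [ENNReal.ofReal_pow hx0, hxe]
    rcases t.eq_empty_or_nonempty with rfl | hne
    · simp
    · rw [ciSup_pos hne, ← Nat.cast_succ, ENNReal.rpow_natCast]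
  rcases t.eq_empty_or_nonempty with rfl | ⟨p, hp⟩
  · obtain ⟨j, hj, -⟩ := DyadicIndex.exists_mem_core m (0 : SpaceTime n)
    exact ⟨j, hj ▸ hmm, by simp, hsum j hj⟩
  · obtain ⟨j, hj, hcore⟩ := DyadicIndex.exists_mem_core m (ofParabolic p)
    refine ⟨j, hj ▸ hmm, fun z hz => ?_, hsum j hj⟩
    have h1 : dist (toParabolic z) (toParabolic (ofParabolic p)) ≤ (2 ^ m)⁻¹ := by
      have h2 := Metric.edist_le_ediam_of_mem (show toParabolic z ∈ t from hz) hp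
      rw [edist_dist, ← hxe, ENNReal.ofReal_le_ofReal_iff hx0] at h2
      exact h2.trans ((le_max_left _ _).trans hm')
    rw [dist_toParabolic, ← Real.sqrt_eq_rpow] at h1
    exact hcore z ((le_max_left _ _).trans h1)
      (Real.sqrt_le_left (by positivity) |>.1 ((le_max_right _ _).trans h1))

/-- Efficient covers of compact sets by cores of dyadic bump functions. -/
theorem exists_dyadic_cover {F : Set (SpaceTime n)} (hF : IsCompact F)
    (hfin : parabolicHausdorff n (n + 1) F ≠ ⊤) (m₀ : ℕ) {η : ℝ} (hη : 0 < η) :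
    ∃ J : Finset (DyadicIndex n), (∀ j ∈ J, m₀ ≤ j.1) ∧ F ⊆ ⋃ j ∈ J, j.core ∧
      ∑ j ∈ J, j.side ^ (n + 1) ≤
        2 ^ (n + 1) * ((parabolicHausdorff n (n + 1) F).toReal + η) := by
  classical
  -- Half of `η` is spent on near-optimality of the cover, the other half on the total of the errors
  -- `τ k`.
  have hη2 : ENNReal.ofReal (η / 2) ≠ 0 := by
    rw [Ne, ENNReal.ofReal_eq_zero]
    linarith
  have hlt : (⨅ (t : ℕ → Set (ParabolicSpace n)) (_ : toParabolic '' F ⊆ ⋃ k, t k)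
      (_ : ∀ k, Metric.ediam (t k) ≤ ENNReal.ofReal (2 ^ m₀)⁻¹),
        ∑' k, ⨆ _ : (t k).Nonempty, Metric.ediam (t k) ^ ((n : ℝ) + 1)) <
      parabolicHausdorff n (n + 1) F + ENNReal.ofReal (η / 2) := by
    refine lt_of_le_of_lt ?_ (ENNReal.lt_add_right hfin hη2)
    rw [parabolicHausdorff_apply _ hF.measurableSet, Measure.hausdorffMeasure_apply]
    exact le_iSup₂_of_le (ENNReal.ofReal (2 ^ m₀)⁻¹) (ENNReal.ofReal_pos.2 (by positivity)) le_rfl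
  simp only [iInf_lt_iff] at hlt
  obtain ⟨t, hFt, ht, hsum⟩ := hlt
  obtain ⟨τ, hτ, hτsum⟩ := ENNReal.exists_pos_sum_of_countable hη2 ℕ
  choose j hj hcore hside using fun k => exists_subset_core m₀ (ht k) (hτ k)
  have hcov : F ⊆ ⋃ k, (j k).core := by
    intro z hz
    obtain ⟨k, hk⟩ := mem_iUnion.1 (hFt (mem_image_of_mem _ hz))
    exact mem_iUnion.2 ⟨k, hcore k hk⟩
  obtain ⟨s, hs⟩ := hF.elim_finite_subcover _ (fun k => (j k).isOpen_core) hcov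
  -- Different covering sets may select the same index. Passing to the image removes repetitions, on
  -- which the overlap count at each scale relies, and can only decrease the sum.
  refine ⟨s.image j, ?_, ?_, ?_⟩
  · intro i hi
    obtain ⟨k, -, rfl⟩ := Finset.mem_image.1 hi
    exact hj k
  · intro z hz
    obtain ⟨k, hk, hzk⟩ := mem_iUnion₂.1 (hs hz)
    exact mem_iUnion₂.2 ⟨j k, Finset.mem_image_of_mem j hk, hzk⟩
  · have h1 : ENNReal.ofReal (∑ k ∈ s, (j k).side ^ (n + 1)) ≤
        2 ^ (n + 1) * (parabolicHausdorff n (n + 1) F + ENNReal.ofReal (η / 2) +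
          ENNReal.ofReal (η / 2)) := by
      rw [ENNReal.ofReal_sum_of_nonneg fun k _ => pow_nonneg (j k).side_pos.le _]
      refine (Finset.sum_le_sum fun k _ => hside k).trans ?_
      rw [← Finset.mul_sum]
      gcongr
      refine (ENNReal.sum_le_tsum s).trans ?_
      rw [ENNReal.tsum_add]
      exact add_le_add hsum.le hτsum.le
    have e : parabolicHausdorff n (n + 1) F + ENNReal.ofReal (η / 2) + ENNReal.ofReal (η / 2) =
        ENNReal.ofReal ((parabolicHausdorff n (n + 1) F).toReal + η) := by
      rw [add_assoc, ← ENNReal.ofReal_add (by positivity) (by positivity), add_halves,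
        ENNReal.ofReal_add ENNReal.toReal_nonneg hη.le, ENNReal.ofReal_toReal hfin]
    have e2 : (2 : ℝ≥0∞) ^ (n + 1) = ENNReal.ofReal (2 ^ (n + 1)) := by
      rw [ENNReal.ofReal_pow (by norm_num), ENNReal.ofReal_ofNat]
    rw [e, e2, ← ENNReal.ofReal_mul (by positivity), ENNReal.ofReal_le_ofReal_iff (by positivity)]
      at h1
    refine le_trans ?_ h1
    exact Finset.sum_image_le_of_nonneg (f := fun i : DyadicIndex n => i.side ^ (n + 1))
      fun i _ => pow_nonneg i.side_pos.le _

/-- The constant in the estimate of the distribution by Hausdorff measure. -/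
noncomputable def localConst (n : ℕ) : ℝ := coverConst n * 2 ^ (n + 1)

theorem localConst_nonneg (n : ℕ) : 0 ≤ localConst n := by
  have := coverConst_nonneg n
  unfold localConst
  positivity

theorem tendsto_supportSide_bound (n : ℕ) :
    Tendsto (fun m : ℕ => 2 * (bumpRadius n : ℝ) * (2 ^ m)⁻¹) atTop (𝓝 0) := by
  have : Tendsto (fun m : ℕ => ((2 : ℝ) ^ m)⁻¹) atTop (𝓝 0) := by
    simpa using tendsto_pow_atTop_nhds_zero_of_lt_one (r := (2⁻¹ : ℝ)) (by norm_num) (by norm_num)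
  simpa using this.const_mul (2 * (bumpRadius n : ℝ))

/-- The distribution is controlled by the Hausdorff measure of the part of `E` in the support of
the test function. -/
theorem abs_apply_le_mul_hausdorff {ν : 𝓓'((⊤ : Opens (SpaceTime n)), ℝ)}
    {E : Set (SpaceTime n)} (hE : IsCompact E) (hEfin : parabolicHausdorff n (n + 1) E < ⊤)
    (hνE : Distribution.dsupport ν ⊆ E)
    {G : SpaceTime n → EuclideanSpace ℝ (Fin n)} {h : SpaceTime n → ℝ}
    (hν : IsCompact (Distribution.dsupport ν))
    (hG : IsSpaceGradientPotential ν G) (hG1 : eLpNorm G ⊤ volume ≤ 1)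
    (hh : IsHalfTimeDerivPotential ν h) (hh1 : parabolicBMO h ≤ 1)
    {φ : SpaceTime n → ℝ} (hφ : IsTest φ) {M : ℝ} (hM0 : 0 < M) (hM : ∀ z, |φ z| ≤ M) :
    |ν hφ.toTest| ≤
      localConst n * M * (parabolicHausdorff n (n + 1) (tsupport φ ∩ E)).toReal := by
  obtain ⟨b, hb⟩ := exists_smoothBounded hφ.contDiff hφ.hasCompactSupport
  have hb1 : ∀ z v, ‖v‖ ≤ 1 → |fderiv ℝ φ z v| ≤ b 1 := fun z v hv => by
    have h1 := hb.bound 1 z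
    rw [norm_iteratedFDeriv_one] at h1
    exact ((fderiv ℝ φ z).le_opNorm v).trans
      ((mul_le_of_le_one_right (norm_nonneg _) hv).trans h1)
  have hF : IsCompact (tsupport φ ∩ E) := hE.inter_left (isClosed_tsupport φ)
  have hFfin : parabolicHausdorff n (n + 1) (tsupport φ ∩ E) ≠ ⊤ :=
    ((measure_mono inter_subset_right).trans_lt hEfin).ne
  -- Scales so fine that `φ` is slowly varying on them. The first condition makes support sides less
  -- than one, so the bound with `supportSide ^ 2` follows from the one with `supportSide`.
  obtain ⟨m₀, hm1, hm2⟩ : ∃ m₀ : ℕ, 2 * (bumpRadius n : ℝ) * (2 ^ m₀)⁻¹ < 1 ∧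
      2 * (bumpRadius n : ℝ) * (2 ^ m₀)⁻¹ < M / (|b 1| + 1) :=
    (((tendsto_supportSide_bound n).eventually_lt_const one_pos).and
      ((tendsto_supportSide_bound n).eventually_lt_const (by positivity))).exists
  have hsmall : ∀ j : DyadicIndex n, m₀ ≤ j.1 → b 1 ≤ M / j.supportSide ∧
      b 1 ≤ M / j.supportSide ^ 2 := by
    intro j hj
    have hpos := j.supportSide_pos
    have hle : j.supportSide ≤ 2 * (bumpRadius n : ℝ) * (2 ^ m₀)⁻¹ := by
      unfold DyadicIndex.supportSide DyadicIndex.side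
      gcongr
      norm_num
    have h1 : j.supportSide ≤ M / (|b 1| + 1) := hle.trans hm2.le
    rw [le_div_iff₀ (by positivity)] at h1
    have h2 : b 1 ≤ M / j.supportSide := by
      rw [le_div_iff₀ hpos]
      nlinarith [le_abs_self (b 1)]
    refine ⟨h2, h2.trans ?_⟩
    gcongr
    nlinarith
  have key : ∀ η : ℝ, 0 < η → |ν hφ.toTest| ≤
      localConst n * M * ((parabolicHausdorff n (n + 1) (tsupport φ ∩ E)).toReal + η) := by
    intro η hη
    obtain ⟨J, hJ1, hJ2, hJ3⟩ := exists_dyadic_cover hF hFfin m₀ hη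
    refine (abs_apply_le_sum hν hG hG1 hh hh1 hφ hM J (fun j hj i z => ?_) (fun j hj z => ?_)
      ((inter_subset_inter_right _ hνE).trans hJ2)).trans ?_
    · exact (hb1 z _ (norm_spaceVec_le i)).trans (hsmall j (hJ1 j hj)).1
    · exact (hb1 z _ norm_timeVec_le).trans (hsmall j (hJ1 j hj)).2
    · have := coverConst_nonneg n
      calc _ ≤ coverConst n * M * (2 ^ (n + 1) *
            ((parabolicHausdorff n (n + 1) (tsupport φ ∩ E)).toReal + η)) := by gcongr
        _ = _ := by
          unfold localConst
          ring
  have hlim : Tendsto (fun η : ℝ => localConst n * M *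
      ((parabolicHausdorff n (n + 1) (tsupport φ ∩ E)).toReal + η)) (𝓝[>] 0)
      (𝓝 (localConst n * M * ((parabolicHausdorff n (n + 1) (tsupport φ ∩ E)).toReal + 0))) :=
    ((tendsto_id.mono_left nhdsWithin_le_nhds).const_add _).const_mul _
  rw [add_zero] at hlim
  exact ge_of_tendsto hlim (by
    filter_upwards [self_mem_nhdsWithin] with η hη
    exact key η hη)

end ParabolicHeat

namespace ParabolicHeat

/-! ### From the supremum norm to the norm of `L¹` -/

/-- A smooth bump function on the line; its integer translates form a partition of unity. -/
noncomputable def hat (u : ℝ) : ℝ := Real.smoothTransition (u + 1) - Real.smoothTransition u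

theorem contDiff_hat : ContDiff ℝ (⊤ : ℕ∞) hat := by
  have h : ContDiff ℝ (⊤ : ℕ∞) Real.smoothTransition := Real.smoothTransition.contDiff
  exact (h.comp (contDiff_id.add contDiff_const)).sub h

theorem abs_hat_le (u : ℝ) : |hat u| ≤ 1 := by
  have h1 := Real.smoothTransition.nonneg (u + 1)
  have h2 := Real.smoothTransition.nonneg u
  have h3 := Real.smoothTransition.le_one (u + 1)
  have h4 := Real.smoothTransition.le_one u
  rw [hat, abs_le]
  constructor <;> linarith

theorem abs_le_one_of_hat_ne_zero {u : ℝ} (hu : hat u ≠ 0) : |u| ≤ 1 := by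
  by_contra h
  rcases lt_abs.1 (not_le.1 h) with h | h
  · exact hu (by
      rw [hat, Real.smoothTransition.one_of_one_le (by linarith),
        Real.smoothTransition.one_of_one_le h.le, sub_self])
  · exact hu (by
      rw [hat, Real.smoothTransition.zero_of_nonpos (by linarith),
        Real.smoothTransition.zero_of_nonpos (by linarith), sub_self])

/-- A telescoping sum of smooth steps; the range of indices is just long enough for the end values
to be `1` and `0`. -/
theorem sum_hat {K : ℕ} {u : ℝ} (hu : |u| ≤ K) :
    ∑ i ∈ Finset.range (2 * K + 1), hat (u + K - i) = 1 := by
  have h1 : ∀ i : ℕ, hat (u + K - i) = Real.smoothTransition (u + K + 1 - i) -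
      Real.smoothTransition (u + K + 1 - (i + 1 : ℕ)) := by
    intro i
    rw [hat]
    push_cast
    congr 2 <;> ring
  obtain ⟨h2, h3⟩ := abs_le.1 hu
  simp_rw [h1]
  rw [Finset.sum_range_sub' (fun i : ℕ => Real.smoothTransition (u + K + 1 - i)),
    Real.smoothTransition.one_of_one_le (by simp; linarith),
    Real.smoothTransition.zero_of_nonpos (by push_cast; linarith), sub_zero]

theorem card_filter_abs_sub_le (s : Finset ℕ) (v : ℝ) :
    (s.filter fun i : ℕ => |v - i| ≤ 1).card ≤ 3 := by
  have h1 : (s.filter fun i : ℕ => |v - i| ≤ 1).card ≤ (Finset.Icc ⌈v - 1⌉ ⌊v + 1⌋).card := by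
    refine Finset.card_le_card_of_injOn (fun i : ℕ => (i : ℤ)) ?_ (fun i _ j _ h => by simpa using h)
    intro i hi
    obtain ⟨-, h⟩ := Finset.mem_filter.1 (Finset.mem_coe.1 hi)
    obtain ⟨h2, h3⟩ := abs_le.1 h
    refine Finset.mem_coe.2 (Finset.mem_Icc.2 ⟨Int.ceil_le.2 ?_, Int.le_floor.2 ?_⟩) <;>
      push_cast <;> linarith
  refine h1.trans ?_
  rw [Int.card_Icc]
  have h2 := Int.le_ceil (v - 1)
  have h3 := Int.floor_le (v + 1)
  have h4 : ((⌊v + 1⌋ + 1 - ⌈v - 1⌉ : ℤ) : ℝ) ≤ ((3 : ℤ) : ℝ) := by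
    push_cast
    linarith
  have := Int.cast_le.1 h4
  omega

variable {n : ℕ}

/-- A bound by the supremum norm and the measure of the support implies a bound by the norm
of `L¹`. -/
theorem abs_apply_le_integral_abs {ν : 𝓓'((⊤ : Opens (SpaceTime n)), ℝ)}
    {μ : Measure (SpaceTime n)} [IsFiniteMeasure μ] {c : ℝ} (hc : 0 ≤ c)
    (hν : ∀ (φ : SpaceTime n → ℝ) (hφ : IsTest φ) (M : ℝ), 0 < M → (∀ z, |φ z| ≤ M) →
      |ν hφ.toTest| ≤ c * M * μ.real (tsupport φ))
    {φ : SpaceTime n → ℝ} (hφ : IsTest φ) :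
    |ν hφ.toTest| ≤ 3 * c * ∫ z, |φ z| ∂μ := by
  classical
  have hφc := hφ.continuous
  have hφi : Integrable φ μ := hφc.integrable_of_hasCompactSupport hφ.hasCompactSupport
  obtain ⟨b, hb⟩ := exists_smoothBounded hφ.contDiff hφ.hasCompactSupport
  have key : ∀ ε : ℝ, 0 < ε →
      |ν hφ.toTest| ≤ 3 * c * ((∫ z, |φ z| ∂μ) + 2 * ε * μ.real univ) := by
    intro ε hε
    obtain ⟨K, hK⟩ := exists_nat_ge (b 0 / ε)
    have hφK : ∀ z, |φ z / ε| ≤ K := fun z => by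
      rw [abs_div, abs_of_pos hε]
      exact le_trans (by have := hb.abs_le z; gcongr) hK
    set s := Finset.range (2 * K + 1)
    -- The part of `φ` whose values are near `(i - K) ε`. On its window the supremum bound is at
    -- most `|φ| + 2ε`, so supremum times measure is at most an integral over the window. The
    -- windows `A i` overlap at most three times, which gives the factor `3`.
    let ψ : ℕ → SpaceTime n → ℝ := fun i z => φ z * hat (φ z / ε + K - i)
    have hψ : ∀ i, IsTest (ψ i) := fun i => by
      refine ⟨hφ.contDiff.mul (contDiff_hat.comp ?_), hφ.hasCompactSupport.mul_right⟩
      exact ((hφ.contDiff.div_const ε).add contDiff_const).sub contDiff_const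
    have hsum : hφ.toTest = ∑ i ∈ s, (hψ i).toTest := by
      ext z
      rw [FunLike.coe_sum, Finset.sum_apply]
      change φ z = ∑ i ∈ s, φ z * hat (φ z / ε + K - i)
      rw [← Finset.mul_sum, sum_hat (hφK z), mul_one]
    let A : ℕ → Set (SpaceTime n) := fun i => {z | |φ z / ε + K - i| ≤ 1}
    have hA : ∀ i, IsClosed (A i) := fun i => isClosed_le (by fun_prop) continuous_const
    let g : SpaceTime n → ℝ := fun z => |φ z| + 2 * ε
    have hg : Integrable g μ := hφi.abs.add (integrable_const _)
    have hpiece : ∀ i, |ν (hψ i).toTest| ≤ c * ∫ z, (A i).indicator g z ∂μ := by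
      intro i
      have hM : ∀ z, |ψ i z| ≤ (|(i : ℝ) - K| + 1) * ε := by
        intro z
        by_cases h : hat (φ z / ε + K - i) = 0
        · simp only [ψ, h, mul_zero, abs_zero]
          positivity
        · have h1 := abs_le_one_of_hat_ne_zero h
          have h2 : |φ z / ε| ≤ |(i : ℝ) - K| + 1 := by
            have := abs_add_le (φ z / ε + K - i) (i - K)
            rw [show φ z / ε + K - i + (i - K) = φ z / ε by ring] at this
            linarith
          rw [abs_div, abs_of_pos hε, div_le_iff₀ hε] at h2
          rw [abs_mul]
          exact (mul_le_of_le_one_right (abs_nonneg _) (abs_hat_le _)).trans h2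
      have hsupp : tsupport (ψ i) ⊆ A i := by
        refine closure_minimal (fun z hz => ?_) (hA i)
        exact abs_le_one_of_hat_ne_zero (right_ne_zero_of_mul hz)
      refine (hν _ (hψ i) _ (by positivity) hM).trans ?_
      rw [mul_assoc]
      refine mul_le_mul_of_nonneg_left ?_ hc
      calc (|(i : ℝ) - K| + 1) * ε * μ.real (tsupport (ψ i))
          ≤ (|(i : ℝ) - K| + 1) * ε * μ.real (A i) := by
            gcongr
            exact measure_ne_top μ _
        _ = ∫ z in A i, (|(i : ℝ) - K| + 1) * ε ∂μ := by
            rw [setIntegral_const, smul_eq_mul, mul_comm]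
        _ ≤ ∫ z in A i, g z ∂μ := by
            refine setIntegral_mono_on (integrableOn_const (measure_ne_top μ _)) hg.integrableOn
              (hA i).measurableSet fun z hz => ?_
            have h1 : |φ z / ε + K - i| ≤ 1 := hz
            have h2 : |(i : ℝ) - K| ≤ |φ z / ε| + 1 := by
              have := abs_sub (φ z / ε) (φ z / ε + K - i)
              rw [show φ z / ε - (φ z / ε + K - i) = i - K by ring] at this
              linarith
            have h3 : |φ z / ε| * ε = |φ z| := by
              rw [abs_div, abs_of_pos hε, div_mul_cancel₀ _ hε.ne']
            simp only [g]
            nlinarith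
        _ = ∫ z, (A i).indicator g z ∂μ := (integral_indicator (hA i).measurableSet).symm
    rw [hsum, map_sum]
    calc |∑ i ∈ s, ν (hψ i).toTest| ≤ ∑ i ∈ s, c * ∫ z, (A i).indicator g z ∂μ :=
          (Finset.abs_sum_le_sum_abs _ _).trans (Finset.sum_le_sum fun i _ => hpiece i)
      _ = c * ∫ z, ∑ i ∈ s, (A i).indicator g z ∂μ := by
          rw [← Finset.mul_sum, integral_finsetSum]
          exact fun i _ => hg.indicator (hA i).measurableSet
      _ ≤ c * ∫ z, 3 * g z ∂μ := by
          refine mul_le_mul_of_nonneg_left (integral_mono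
            (integrable_finsetSum _ fun i _ => hg.indicator (hA i).measurableSet)
            (hg.const_mul 3) fun z => ?_) hc
          have hgz : 0 ≤ g z := by
            simp only [g]
            positivity
          have h1 : ∑ i ∈ s, (A i).indicator g z =
              ((s.filter fun i : ℕ => |φ z / ε + K - i| ≤ 1).card : ℝ) * g z := by
            simp only [indicator_apply]
            rw [← Finset.sum_filter, Finset.sum_const, nsmul_eq_mul]
            rfl
          change ∑ i ∈ s, (A i).indicator g z ≤ 3 * g z
          rw [h1]
          refine mul_le_mul_of_nonneg_right ?_ hgz
          exact_mod_cast card_filter_abs_sub_le s (φ z / ε + K)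
      _ = _ := by
          simp only [g]
          rw [integral_const_mul, integral_add hφi.abs (integrable_const _), integral_const,
            smul_eq_mul]
          ring
  have hlim : Tendsto (fun ε : ℝ => 3 * c * ((∫ z, |φ z| ∂μ) + 2 * ε * μ.real univ)) (𝓝[>] 0)
      (𝓝 (3 * c * ((∫ z, |φ z| ∂μ) + 2 * 0 * μ.real univ))) := by
    refine ((((tendsto_id.mono_left nhdsWithin_le_nhds).const_mul 2).mul_const _).const_add _
      ).const_mul _
  rw [mul_zero, zero_mul, add_zero] at hlim
  exact ge_of_tendsto hlim (by
    filter_upwards [self_mem_nhdsWithin] with ε hε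
    exact key ε hε)

end ParabolicHeat

namespace ParabolicHeat

/-! ### Representation by a bounded density -/

section Density

variable {n : ℕ} {μ : Measure (SpaceTime n)} [IsFiniteMeasure μ]

theorem integral_abs_le_mul_norm : ∃ K : ℝ, 0 ≤ K ∧ ∀ {f : SpaceTime n → ℝ} (hf : MemLp f 2 μ),
    ∫ z, |f z| ∂μ ≤ K * ‖hf.toLp f‖ := by
  refine ⟨(μ univ ^ (1 / (1 : ℝ≥0∞).toReal - 1 / (2 : ℝ≥0∞).toReal)).toReal,
    ENNReal.toReal_nonneg, fun {f} hf => ?_⟩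
  have h1 := eLpNorm_le_eLpNorm_mul_rpow_measure_univ (μ := μ) (one_le_two : (1 : ℝ≥0∞) ≤ 2)
    hf.aestronglyMeasurable
  have h2 : ∫ z, |f z| ∂μ = (eLpNorm f 1 μ).toReal := by
    rw [eLpNorm_one_eq_lintegral_enorm]
    exact integral_norm_eq_lintegral_enorm hf.aestronglyMeasurable
  rw [h2, Lp.norm_toLp, mul_comm, ← ENNReal.toReal_mul]
  refine ENNReal.toReal_mono (ENNReal.mul_ne_top hf.eLpNorm_ne_top ?_) h1
  exact ENNReal.rpow_ne_top_of_nonneg (by norm_num) (measure_ne_top μ _)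

theorem memLp_testFunction (φ : 𝓓((⊤ : Opens (SpaceTime n)), ℝ)) : MemLp φ 2 μ :=
  (isTest_coe φ).continuous.memLp_of_hasCompactSupport φ.hasCompactSupport

variable (μ) in
/-- Test functions as elements of `L²`. -/
noncomputable def toL2 : 𝓓((⊤ : Opens (SpaceTime n)), ℝ) →ₗ[ℝ] Lp ℝ 2 μ where
  toFun φ := (memLp_testFunction φ).toLp φ
  map_add' _ _ := rfl
  map_smul' _ _ := rfl

/-- The measure is finite, so the bound in `L¹` is also one in `L²`. In particular `ν φ` depends
only on the class of `φ`, and Hahn–Banach with the Riesz representation applies. -/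
theorem exists_L2_density {ν : 𝓓'((⊤ : Opens (SpaceTime n)), ℝ)} {C : ℝ} (hC : 0 ≤ C)
    (hν : ∀ φ : 𝓓((⊤ : Opens (SpaceTime n)), ℝ), |ν φ| ≤ C * ∫ z, |φ z| ∂μ) :
    ∃ F : Lp ℝ 2 μ, ∀ φ, ν φ = inner ℝ F (toL2 μ φ) := by
  obtain ⟨K, hK, hK'⟩ := integral_abs_le_mul_norm (μ := μ)
  have hb : ∀ φ, |ν φ| ≤ C * K * ‖toL2 μ φ‖ := fun φ => by
    rw [mul_assoc]
    exact (hν φ).trans (mul_le_mul_of_nonneg_left (hK' (memLp_testFunction φ)) hC)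
  let ν' : 𝓓((⊤ : Opens (SpaceTime n)), ℝ) →ₗ[ℝ] ℝ :=
    { toFun := ν, map_add' := map_add ν, map_smul' := map_smul ν }
  have hker : (toL2 μ).ker ≤ ν'.ker := by
    intro φ hφ
    have h1 := hb φ
    rw [LinearMap.mem_ker.1 hφ, norm_zero, mul_zero] at h1
    exact LinearMap.mem_ker.2 (abs_nonpos_iff.1 h1)
  let T₀ : (toL2 μ).range →ₗ[ℝ] ℝ :=
    ((toL2 μ).ker.liftQ ν' hker) ∘ₗ (toL2 μ).quotKerEquivRange.symm.toLinearMap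
  have hT₀ : ∀ φ, T₀ ⟨toL2 μ φ, LinearMap.mem_range_self _ φ⟩ = ν φ := by
    intro φ
    change (toL2 μ).ker.liftQ ν' hker ((toL2 μ).quotKerEquivRange.symm _) = _
    rw [LinearMap.quotKerEquivRange_symm_apply_image (toL2 μ) φ]
    rfl
  let T : StrongDual ℝ (toL2 μ).range := T₀.mkContinuous (C * K) (by
    rintro ⟨-, φ, rfl⟩
    rw [hT₀]
    exact hb φ)
  obtain ⟨g, hg, -⟩ := _root_.exists_extension_norm_eq (toL2 μ).range T
  refine ⟨(InnerProductSpace.toDual ℝ _).symm g, fun φ => ?_⟩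
  rw [InnerProductSpace.toDual_symm_apply, hg ⟨toL2 μ φ, LinearMap.mem_range_self _ φ⟩]
  exact (hT₀ φ).symm

/-- Test functions are dense in `L²(μ)`, and for finite `μ` both sides are continuous in the `L²`
norm. The bound thus reaches indicators of Borel sets, which pin down the size of `F`. -/
theorem abs_inner_le_of_forall_test {F : Lp ℝ 2 μ} {C : ℝ} (hC : 0 ≤ C)
    (hF : ∀ φ : 𝓓((⊤ : Opens (SpaceTime n)), ℝ),
      |inner ℝ F (toL2 μ φ)| ≤ C * ∫ z, |φ z| ∂μ) {f : SpaceTime n → ℝ} (hf : MemLp f 2 μ) :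
    |inner ℝ F (hf.toLp f)| ≤ C * ∫ z, |f z| ∂μ := by
  obtain ⟨K, hK, hK'⟩ := integral_abs_le_mul_norm (μ := μ)
  have key : ∀ ε : ℝ, 0 < ε →
      |inner ℝ F (hf.toLp f)| ≤ C * (∫ z, |f z| ∂μ) + (C * K + ‖F‖) * ε := by
    intro ε hε
    obtain ⟨g, hgc, hg, hfg⟩ := hf.exist_eLpNorm_sub_le (by norm_num) (by norm_num) hε
    have hgt : IsTest g := ⟨hg, hgc⟩
    have hg2 : MemLp g 2 μ := memLp_testFunction hgt.toTest
    have h1 : ‖(hf.sub hg2).toLp (f - g)‖ ≤ ε := by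
      rw [Lp.norm_toLp]
      exact ENNReal.toReal_le_of_le_ofReal hε.le hfg
    have h2 : inner ℝ F (hf.toLp f) =
        inner ℝ F (toL2 μ hgt.toTest) + inner ℝ F ((hf.sub hg2).toLp (f - g)) := by
      rw [← inner_add_right, MemLp.toLp_sub hf hg2]
      congr 1
      exact (add_sub_cancel _ _).symm
    have h3 : ∫ z, |g z| ∂μ ≤ (∫ z, |f z| ∂μ) + K * ε := by
      have hfi := hf.integrable (by norm_num)
      have hgi := hg2.integrable (by norm_num)
      have h4 : ∫ z, |g z| ∂μ ≤ ∫ z, (|f z| + |(f - g) z|) ∂μ := by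
        refine integral_mono hgi.abs (hfi.abs.add (hfi.sub hgi).abs) fun z => ?_
        have := abs_sub (f z) ((f - g) z)
        rwa [Pi.sub_apply, sub_sub_cancel] at this
      rw [integral_add hfi.abs (hfi.sub hgi).abs] at h4
      have h5 := (hK' (hf.sub hg2)).trans (mul_le_mul_of_nonneg_left h1 hK)
      linarith
    rw [h2]
    have h6 := (hF hgt.toTest).trans (mul_le_mul_of_nonneg_left h3 hC)
    have h7 := (abs_real_inner_le_norm F ((hf.sub hg2).toLp (f - g))).trans
      (mul_le_mul_of_nonneg_left h1 (norm_nonneg F))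
    calc _ ≤ _ := abs_add_le _ _
      _ ≤ _ := add_le_add h6 h7
      _ = _ := by ring
  refine le_of_forall_pos_le_add fun δ hδ => ?_
  have hpos : 0 < C * K + ‖F‖ + 1 := by positivity
  refine (key (δ / (C * K + ‖F‖ + 1)) (by positivity)).trans (add_le_add le_rfl ?_)
  rw [mul_div_assoc', div_le_iff₀ hpos]
  nlinarith

theorem abs_setIntegral_le_of_forall_test {F : Lp ℝ 2 μ} {C : ℝ} (hC : 0 ≤ C)
    (hF : ∀ φ : 𝓓((⊤ : Opens (SpaceTime n)), ℝ),
      |inner ℝ F (toL2 μ φ)| ≤ C * ∫ z, |φ z| ∂μ) {A : Set (SpaceTime n)} (hA : MeasurableSet A) :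
    |∫ z in A, F z ∂μ| ≤ C * μ.real A := by
  have hm : MemLp (A.indicator fun _ => (1 : ℝ)) 2 μ :=
    memLp_indicator_const 2 hA 1 (Or.inr (measure_ne_top μ A))
  have h1 := abs_inner_le_of_forall_test hC hF hm
  have h2 : hm.toLp _ = indicatorConstLp 2 hA (measure_ne_top μ A) (1 : ℝ) := rfl
  rw [h2, real_inner_comm, L2.inner_indicatorConstLp_one] at h1
  refine h1.trans (le_of_eq ?_)
  have h3 : (fun z => |A.indicator (fun _ => (1 : ℝ)) z|) = A.indicator 1 := by
    ext z
    by_cases hz : z ∈ A <;> simp [hz]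
  rw [h3, integral_indicator_one hA]

/-- A distribution bounded by the norm of `L¹(μ)` has a bounded density. -/
theorem exists_bounded_density {ν : 𝓓'((⊤ : Opens (SpaceTime n)), ℝ)} {C : ℝ} (hC : 0 ≤ C)
    (hν : ∀ φ : 𝓓((⊤ : Opens (SpaceTime n)), ℝ), |ν φ| ≤ C * ∫ z, |φ z| ∂μ) :
    ∃ f : SpaceTime n → ℝ, Measurable f ∧ (∀ z, |f z| ≤ C) ∧
      ∀ φ : 𝓓((⊤ : Opens (SpaceTime n)), ℝ), ν φ = ∫ z, φ z * f z ∂μ := by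
  obtain ⟨F, hF⟩ := exists_L2_density hC hν
  have hA := fun A hA => abs_setIntegral_le_of_forall_test (F := F) (A := A) hC
    (fun φ => (hF φ) ▸ hν φ) hA
  have hFi : Integrable F μ := (Lp.memLp F).integrable (by norm_num)
  have h1 : F ≤ᵐ[μ] fun _ => C := by
    refine ae_le_of_forall_setIntegral_le hFi (integrable_const _) fun s hs _ => ?_
    rw [setIntegral_const, smul_eq_mul, mul_comm]
    exact (le_abs_self _).trans (hA s hs)
  have h2 : (fun _ => -C) ≤ᵐ[μ] F := by
    refine ae_le_of_forall_setIntegral_le (integrable_const _) hFi fun s hs _ => ?_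
    rw [setIntegral_const, smul_eq_mul]
    have := neg_le_of_abs_le (hA s hs)
    linarith
  -- Clamping changes `F` only on a null set and makes the bound hold everywhere.
  refine ⟨fun z => max (-C) (min C (F z)), ?_, fun z => ?_, fun φ => ?_⟩
  · exact measurable_const.max (measurable_const.min (Lp.stronglyMeasurable F).measurable)
  · exact abs_le.2 ⟨le_max_left _ _, max_le (by linarith) (min_le_left _ _)⟩
  · rw [hF, L2.inner_def]
    refine integral_congr_ae ?_
    filter_upwards [h1, h2, (memLp_testFunction φ).coeFn_toLp] with z hz1 hz2 hz3
    change (toL2 μ φ) z = φ z at hz3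
    rw [min_eq_right hz1, max_eq_right hz2, hz3]
    rfl

end Density

/-- Integration against a signed measure with a density. -/
theorem integral_withDensity {n : ℕ} {μ : Measure (SpaceTime n)} {f g : SpaceTime n → ℝ} (hf : Integrable f μ) (hfm : Measurable f)
    {M : ℝ} (hg : Measurable g) (hgM : ∀ z, |g z| ≤ M) :
    ∫ᵛ z, g z ∂•(μ.withDensityᵥ f) = ∫ z, g z * f z ∂μ := by
  have hgi : ∀ (κ : Measure (SpaceTime n)) [IsFiniteMeasure κ], Integrable g κ := fun κ _ =>
    (integrable_const M).mono' hg.aestronglyMeasurable (Eventually.of_forall hgM)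
  have i1 := isFiniteMeasure_withDensity_ofReal hf.2
  have i2 : IsFiniteMeasure (μ.withDensity fun x => ENNReal.ofReal (-f x)) :=
    isFiniteMeasure_withDensity_ofReal hf.neg.2
  have hflip : (ContinuousLinearMap.lsmul ℝ ℝ : ℝ →L[ℝ] ℝ →L[ℝ] ℝ) =
      (ContinuousLinearMap.lsmul ℝ ℝ : ℝ →L[ℝ] ℝ →L[ℝ] ℝ).flip := by
    ext
    simp
  have hs : ∀ (κ : Measure (SpaceTime n)) [IsFiniteMeasure κ],
      VectorMeasure.Integrable κ.toSignedMeasure g := fun κ _ => by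
    rw [VectorMeasure.Integrable, Measure.variation_toSignedMeasure]
    exact hgi κ
  rw [withDensityᵥ_eq_withDensity_pos_part_sub_withDensity_neg_part hf,
    VectorMeasure.integral_sub_vectorMeasure (hs _) (hs _), hflip,
    VectorMeasure.integral_toSignedMeasure, VectorMeasure.integral_toSignedMeasure,
    integral_withDensity_eq_integral_toReal_smul hfm.ennreal_ofReal
      (Eventually.of_forall fun _ => ENNReal.ofReal_lt_top),
    integral_withDensity_eq_integral_toReal_smul (f := fun x => ENNReal.ofReal (-f x))
      hfm.neg.ennreal_ofReal
      (Eventually.of_forall fun _ => ENNReal.ofReal_lt_top)]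
  have hb : ∀ h : SpaceTime n → ℝ, Integrable h μ →
      Integrable (fun z => (ENNReal.ofReal (h z)).toReal • g z) μ := fun h hh => by
    simp only [smul_eq_mul]
    exact hh.real_toNNReal.mul_bdd hg.aestronglyMeasurable (Eventually.of_forall hgM)
  rw [← integral_sub (hb f hf) (hb (fun x => -f x) hf.neg)]
  refine integral_congr_ae (Eventually.of_forall fun z => ?_)
  change (ENNReal.ofReal (f z)).toReal * g z - (ENNReal.ofReal (-f z)).toReal * g z = g z * f z
  rcases le_total 0 (f z) with h | h
  · rw [ENNReal.toReal_ofReal h, ENNReal.ofReal_of_nonpos (neg_nonpos.2 h), ENNReal.toReal_zero]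
    ring
  · rw [ENNReal.toReal_ofReal (neg_nonneg.2 h), ENNReal.ofReal_of_nonpos h, ENNReal.toReal_zero]
    ring

end ParabolicHeat

/-! ### The main theorem. -/

theorem mainTheorem7 (n : ℕ) (hn : 1 ≤ n) :
    ∃ C : ℝ, 0 < C ∧
      ∀ (E : Set (ParabolicHeat.SpaceTime n)), IsCompact E →
        ParabolicHeat.parabolicHausdorff n (n + 1) E < ⊤ →
      ∀ (ν : 𝓓'((⊤ : Opens (ParabolicHeat.SpaceTime n)), ℝ)), Distribution.dsupport ν ⊆ E →
      ∀ (G : ParabolicHeat.SpaceTime n → EuclideanSpace ℝ (Fin n))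
        (h : ParabolicHeat.SpaceTime n → ℝ),
        ParabolicHeat.IsSpaceGradientPotential ν G → eLpNorm G ⊤ volume ≤ 1 →
        ParabolicHeat.IsHalfTimeDerivPotential ν h → ParabolicHeat.parabolicBMO h ≤ 1 →
      ∃ (σ : SignedMeasure (ParabolicHeat.SpaceTime n)) (f : ParabolicHeat.SpaceTime n → ℝ),
        (∀ φ : 𝓓((⊤ : Opens (ParabolicHeat.SpaceTime n)), ℝ), ν φ = ∫ᵛ z, φ z ∂•σ) ∧
        VectorMeasure.AbsolutelyContinuous σ
          ((ParabolicHeat.parabolicHausdorff n (n + 1)).restrict E).toENNRealVectorMeasure ∧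
        Measurable f ∧
        Integrable f ((ParabolicHeat.parabolicHausdorff n (n + 1)).restrict E) ∧
        σ = ((ParabolicHeat.parabolicHausdorff n (n + 1)).restrict E).withDensityᵥ f ∧
        eLpNorm f ⊤ ((ParabolicHeat.parabolicHausdorff n (n + 1)).restrict E)
          ≤ ENNReal.ofReal C := by
  have hc := ParabolicHeat.localConst_nonneg n
  -- The summand `1` serves only to make the constant positive.
  refine ⟨3 * ParabolicHeat.localConst n + 1, by positivity, ?_⟩
  intro E hE hEfin ν hνE G h hG hG1 hh hh1
  set μ := (ParabolicHeat.parabolicHausdorff n (n + 1)).restrict E with hμ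
  have hfin : IsFiniteMeasure μ := ⟨by rwa [hμ, Measure.restrict_apply_univ]⟩
  have hν : IsCompact (Distribution.dsupport ν) :=
    hE.of_isClosed_subset Distribution.isClosed_dsupport hνE
  have hL1 : ∀ φ : 𝓓((⊤ : Opens (ParabolicHeat.SpaceTime n)), ℝ),
      |ν φ| ≤ (3 * ParabolicHeat.localConst n + 1) * ∫ z, |φ z| ∂μ := by
    intro φ
    have h1 : |ν φ| ≤ 3 * ParabolicHeat.localConst n * ∫ z, |φ z| ∂μ := by
      refine ParabolicHeat.abs_apply_le_integral_abs hc (fun ψ hψ M hM0 hM => ?_)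
        (ParabolicHeat.isTest_coe φ)
      rw [measureReal_def, hμ, Measure.restrict_apply (isClosed_tsupport ψ).measurableSet]
      exact ParabolicHeat.abs_apply_le_mul_hausdorff hE hEfin hνE hν hG hG1 hh hh1 hψ hM0 hM
    have h2 : 0 ≤ ∫ z, |φ z| ∂μ := integral_nonneg fun z => abs_nonneg _
    linarith
  obtain ⟨f, hfm, hfC, hνf⟩ := ParabolicHeat.exists_bounded_density (by positivity) hL1
  have hfi : Integrable f μ :=
    (integrable_const (3 * ParabolicHeat.localConst n + 1)).mono' hfm.aestronglyMeasurable
      (Eventually.of_forall hfC)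
  refine ⟨μ.withDensityᵥ f, f, fun φ => ?_, Measure.withDensityᵥ_absolutelyContinuous μ f, hfm, hfi,
    rfl, ?_⟩
  · obtain ⟨b, hb⟩ := ParabolicHeat.exists_smoothBounded φ.contDiff φ.hasCompactSupport
    rw [hνf, ParabolicHeat.integral_withDensity hfi hfm
      (ParabolicHeat.isTest_coe φ).continuous.measurable hb.abs_le]
  · rw [eLpNorm_exponent_top]
    refine eLpNormEssSup_le_of_ae_bound (Eventually.of_forall hfC)
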